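/- Let $\lambda\ge 0$ and $\eta\ge 1$ be integers, and let $\alpha_1,\dots,\alpha_\lambda$ be integers with $0<\alpha_1<\cdots<\alpha_\lambda<\eta$ and $\alpha_i=\eta-\alpha_{\lambda+1-i}$ for $1\le i\le\lambda$. Let $k,r$ be integers with $k\ge r\ge\lambda$, $k>\lambda$ and $(k,r)\neq(1,1)$. Let $B_0(\alpha_1,\dots,\alpha_\lambda;\eta,k,r;n)$ be the number of partitions $\pi=(\pi_1,\dots,\pi_s)$ of $n$, $\pi_1\ge\cdots\ge\pi_s$, such that (1) every $\pi_i$ is congruent to one of $0,\alpha_1,\dots,\alpha_\lambda$ modulo $\eta$; (2) only multiples of $\eta$ may be repeated; (3) $\pi_i\ge\pi_{i+k-1}+\eta$, with strict inequality if $\eta\mid\pi_i$, whenever $i+k-1\le s$; (4) at most $r-1$ of the $\pi_i$ are less than or equal to $\eta$; (5) if $i+k-2\le s$ and $\pi_i\le\pi_{i+k-2}+\eta$, with strict inequality if $\eta\nmid\pi_i$, then $\lfloor\pi_i/\eta\rfloor+\cdots+\lfloor\pi_{i+k-2}/\eta\rfloor\equiv r-1+V_\pi(\pi_i)\pmod 2$,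 where $V_\pi(N)$ is the number of parts of $\pi$ not exceeding $N$ that are not divisible by $\eta$. An overpartition of $n$ is a partition of $n$ in which the first occurrence of each part size may be overlined; parts are ordered by $1<\overline1<2<\overline2<\cdots$, and adding $\eta$ to a part increases its size by $\eta$ and keeps it overlined or non-overlined. Let $\overline B_1(\alpha_1,\dots,\alpha_\lambda;\eta,k,r;n)$ be the number of overpartitions $\pi=(\pi_1,\dots,\pi_s)$ of $n$, $\pi_1\ge\cdots\ge\pi_s$, such that (1) the size of every $\pi_i$ is congruent to one of $0,\alpha_1,\dots,\alpha_\lambda$ modulo $\eta$; (2) only multiples of $\eta$ may be non-overlined; (3) $\pi_i\ge\pi_{i+k-1}+\eta$, with strict inequality if $\pi_i$ is non-overlined, whenever $i+k-1\le s$; (4) at most $r-1$ of the $\pi_i$ are less than or equal to the non-overlined part $\eta$ (so a part $\overline\eta$ is not counted). Then, as formal power series in $q$, $$\sum_{n\ge0}\overline B_1(\alpha_1,\dots,\alpha_\lambda;\eta,k,r;n)\,q^n=(-q^\eta;q^\eta)_\infty\sum_{n\ge0}B_0(\alpha_1,\dots,\alpha_\lambda;\eta,k,r;n)\,q^n,$$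 where $(a;q)_\infty=\prod_{i\ge0}(1-aq^i)$. Equivalently, let $\mathcal D_\eta$ be the set of partitions into distinct parts divisible by $\eta$, and let $\mathcal B_0$ and $\overline{\mathcal B}_1$ be the sets of all partitions, respectively overpartitions, counted by $B_0(\alpha_1,\dots,\alpha_\lambda;\eta,k,r;n)$, respectively $\overline B_1(\alpha_1,\dots,\alpha_\lambda;\eta,k,r;n)$, for some $n\ge0$. Then there is a bijection $\Phi:\mathcal D_\eta\times\mathcal B_0\to\overline{\mathcal B}_1$ with $|\Phi(\zeta,\mu)|=|\zeta|+|\mu|$ for all $(\zeta,\mu)$, where $|\cdot|$ denotes the sum of the parts. -/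

import Mathlib

open PowerSeries
open scoped PowerSeries.WithPiTopology

/-- A part of an overpartition: its size, together with a flag which is `true` when the part is
overlined. With the lexicographic order, parts are ordered as `1 < 1̄ < 2 < 2̄ < ⋯`. -/
abbrev OPart : Type := ℕ ×ₗ Bool

namespace OPart

/-- The size of a part. -/
def size (p : OPart) : ℕ := (ofLex p).1

/-- The part is overlined. -/
def Overlined (p : OPart) : Prop := (ofLex p).2 = true

instance (p : OPart) : Decidable p.Overlined := inferInstanceAs (Decidable (_ = true))

/-- The non-overlined part of size `m`. -/
def plain (m : ℕ) : OPart := toLex (m, false)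

/-- The part `p + η`: its size is increased by `η`, and it is overlined exactly when `p` is. -/
def shift (p : OPart) (η : ℕ) : OPart := toLex (p.size + η, (ofLex p).2)

end OPart

/-- An overpartition of `n`: a finite multiset of positive parts whose sizes sum to `n`, in which,
for each size, at most one of the occurrences is overlined. -/
@[ext]
structure Overpartition (n : ℕ) where
  parts : Multiset OPart
  parts_pos : ∀ p ∈ parts, 0 < p.size
  parts_sum : (parts.map OPart.size).sum = n
  overlined_once : ∀ p ∈ parts, p.Overlined → parts.count p = 1

/-- The parts `(π₁, …, πₛ)` of a partition, in weakly decreasing order. -/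
def Nat.Partition.seq {n : ℕ} (π : n.Partition) : List ℕ := π.parts.sort (· ≥ ·)

/-- The parts `(π₁, …, πₛ)` of an overpartition, in weakly decreasing order. -/
def Overpartition.seq {n : ℕ} (π : Overpartition n) : List OPart := π.parts.sort (· ≥ ·)

/-- There are only finitely many overpartitions of `n`, so that counting them makes sense. -/
instance Overpartition.instFinite (n : ℕ) : Finite (Overpartition n) := by
  let F : Finset OPart := ((Finset.range (n + 1)) ×ˢ Finset.univ).map toLex.toEmbedding
  refine Finite.of_injective
    (fun π : Overpartition n => (⟨π.parts, ?_⟩ : Set.Iic (n • F.val))) ?_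
  · rw [Set.mem_Iic, Multiset.le_iff_count]
    intro p
    by_cases hp : p ∈ π.parts
    · have hle : p.size ≤ n := by
        rw [← π.parts_sum]
        exact Multiset.le_sum_of_mem (Multiset.mem_map_of_mem _ hp)
      have hF : p ∈ F := by
        refine Finset.mem_map.2 ⟨ofLex p, ?_, rfl⟩
        exact Finset.mem_product.2 ⟨Finset.mem_range.2 (Nat.lt_succ_of_le hle), Finset.mem_univ _⟩
      have h1 : Multiset.count p F.val = 1 := Multiset.count_eq_one_of_mem F.nodup hF
      have hcard : π.parts.card ≤ n := by
        have h := Multiset.card_nsmul_le_sum (s := π.parts.map OPart.size) (a := 1) (by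
          intro x hx
          obtain ⟨q, hq, rfl⟩ := Multiset.mem_map.1 hx
          exact π.parts_pos q hq)
        rw [π.parts_sum] at h
        simpa using h
      rw [Multiset.count_nsmul, h1]
      simpa using (Multiset.count_le_card p π.parts).trans hcard
    · simp [Multiset.count_eq_zero_of_notMem hp]
  · intro π ρ h
    exact Overpartition.ext (congrArg Subtype.val h)

/-- The conditions on a weakly decreasing sequence of parts `π` (0-indexed) that define the
partitions counted by `B_j(α₁, …, α_λ; η, k, r; n)`. -/
structure IsB (j : ℕ) {l : ℕ} (α : Fin l → ℕ) (η k r : ℕ) (π : List ℕ) : Prop where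
  /-- every part is congruent to `0, α₁, …, α_λ` modulo `η` -/
  congr : ∀ p ∈ π, p ≡ 0 [MOD η] ∨ ∃ i, p ≡ α i [MOD η]
  /-- only multiples of `η` may be repeated -/
  repeated : ∀ p ∈ π, ¬ η ∣ p → π.count p = 1
  /-- `π_i ≥ π_{i+k-1} + η`, with strict inequality if `η ∣ π_i` -/
  diff : ∀ (i : ℕ) (h : i + (k - 1) < π.length),
    π[i + (k - 1)] + η ≤ π[i] ∧ (η ∣ π[i] → π[i + (k - 1)] + η < π[i])
  /-- at most `r - 1` parts are less than or equal to `η` -/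
  small : (π.countP (fun p => p ≤ η) : ℤ) ≤ (r : ℤ) - 1
  /-- if `π_i ≤ π_{i+k-2} + η`, with strict inequality if `η ∤ π_i`, then
  `[π_i/η] + ⋯ + [π_{i+k-2}/η] ≡ r - 1 + V(π_i) (mod 2 - j)`, where `V(N)` is the number of parts
  not exceeding `N` that are not divisible by `η` -/
  parity : ∀ (i : ℕ) (h : i + (k - 2) < π.length),
    π[i] ≤ π[i + (k - 2)] + η → (¬ η ∣ π[i] → π[i] < π[i + (k - 2)] + η) →
    (((((π.drop i).take (k - 1)).map (fun p => p / η)).sum : ℕ) : ℤ) ≡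
      (r : ℤ) - 1 + (π.countP (fun p => p ≤ π[i] ∧ ¬ η ∣ p) : ℤ) [ZMOD 2 - (j : ℤ)]

/-- The conditions on a weakly decreasing sequence of parts `π` (0-indexed) that define the
overpartitions counted by `B̄_j(α₁, …, α_λ; η, k, r; n)`. All comparisons of parts use the order
`1 < 1̄ < 2 < 2̄ < ⋯`. -/
structure IsOverB (j : ℕ) {l : ℕ} (α : Fin l → ℕ) (η k r : ℕ) (π : List OPart) : Prop where
  /-- every part is congruent to `0, α₁, …, α_λ` modulo `η` -/
  congr : ∀ p ∈ π, p.size ≡ 0 [MOD η] ∨ ∃ i, p.size ≡ α i [MOD η]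
  /-- only multiples of `η` may be non-overlined -/
  nonoverlined : ∀ p ∈ π, ¬ p.Overlined → η ∣ p.size
  /-- `π_i ≥ π_{i+k-1} + η`, with strict inequality if `π_i` is non-overlined -/
  diff : ∀ (i : ℕ) (h : i + (k - 1) < π.length),
    π[i + (k - 1)].shift η ≤ π[i] ∧ (¬ π[i].Overlined → π[i + (k - 1)].shift η < π[i])
  /-- at most `r - 1` parts are less than or equal to the non-overlined part `η` -/
  small : (π.countP (fun p => p ≤ OPart.plain η) : ℤ) ≤ (r : ℤ) - 1
  /-- if `π_i ≤ π_{i+k-2} + η`, with strict inequality if `π_i` is overlined, then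
  `[π_i/η] + ⋯ + [π_{i+k-2}/η] ≡ r - 1 + V̄(π_i) (mod 2 - j)`, where `V̄(N)` is the number of
  overlined parts not exceeding `N` -/
  parity : ∀ (i : ℕ) (h : i + (k - 2) < π.length),
    π[i] ≤ π[i + (k - 2)].shift η → (π[i].Overlined → π[i] < π[i + (k - 2)].shift η) →
    (((((π.drop i).take (k - 1)).map (fun p => p.size / η)).sum : ℕ) : ℤ) ≡
      (r : ℤ) - 1 + (π.countP (fun p => p ≤ π[i] ∧ p.Overlined) : ℤ) [ZMOD 2 - (j : ℤ)]

/-- The number `B_j(α₁, …, α_λ; η, k, r; n)`. -/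
noncomputable def numB (j : ℕ) {l : ℕ} (α : Fin l → ℕ) (η k r n : ℕ) : ℕ :=
  Nat.card {π : n.Partition // IsB j α η k r π.seq}

/-- The number `B̄_j(α₁, …, α_λ; η, k, r; n)`. -/
noncomputable def numOverB (j : ℕ) {l : ℕ} (α : Fin l → ℕ) (η k r n : ℕ) : ℕ :=
  Nat.card {π : Overpartition n // IsOverB j α η k r π.seq}

/-- The set of all partitions counted by `B_j(α₁, …, α_λ; η, k, r; n)` for some `n`. The first
component of an element is its weight `n`. -/
def SetB (j : ℕ) {l : ℕ} (α : Fin l → ℕ) (η k r : ℕ) : Set (Σ n, Nat.Partition n) :=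
  {μ | IsB j α η k r μ.2.seq}

/-- The set of all overpartitions counted by `B̄_j(α₁, …, α_λ; η, k, r; n)` for some `n`. The first
component of an element is its weight `n`. -/
def SetOverB (j : ℕ) {l : ℕ} (α : Fin l → ℕ) (η k r : ℕ) : Set (Σ n, Overpartition n) :=
  {π | IsOverB j α η k r π.2.seq}

/-- The set of partitions into distinct parts divisible by `η`. The first component of an element
is its weight. -/
def SetD (η : ℕ) : Set (Σ n, Nat.Partition n) :=
  {ζ | ζ.2.parts.Nodup ∧ ∀ p ∈ ζ.2.parts, η ∣ p}

/-- The infinite product `(a; q)_∞ = ∏_{i ≥ 0} (1 - a qⁱ)` of formal power series. -/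
noncomputable def qPochInf (a q : ℤ⟦X⟧) : ℤ⟦X⟧ := ∏' i : ℕ, (1 - a * q ^ i)

/-- The product defining `(-q^η; q^η)_∞` converges. -/
theorem multipliable_qPochInf {η : ℕ} (hη : 0 < η) :
    Multipliable fun i : ℕ => (1 : ℤ⟦X⟧) - (-(X ^ η)) * (X ^ η) ^ i := by
  have h : (fun i : ℕ => (1 : ℤ⟦X⟧) - (-(X ^ η)) * (X ^ η) ^ i)
      = fun i : ℕ => 1 + (X : ℤ⟦X⟧) ^ (η * (i + 1)) := by
    funext i
    ring
  rw [h]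
  apply WithPiTopology.multipliable_one_add_of_tendsto_order_atTop_nhds_top
  refine ENat.tendsto_nhds_top_iff_natCast_lt.mpr (fun n => Filter.eventually_atTop.mpr ⟨n, ?_⟩)
  intro m hm
  rw [order_X_pow]
  norm_cast
  nlinarith

/-! Put `K = k - 1` and cut an overpartition into layers: layer `m` consists of plain parts `η m`
followed by a set of overlined parts `a + η m`, where the residues `a` are called letters.
Overlining the parts not divisible by `η` turns the partitions of `B_0` into overpartitions that
never use the letter `0`. The difference condition says that every window of length `η` has at most
`K` parts. The parity condition concerns only the full windows, and one element of `ZMod n` carried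
from layer to layer records it, with `n = 2` for `B_0` and `n = 1` (no condition) for `B̄_1`. The
bound on small parts is the window condition at the bottom once `u = k - r` weightless plain parts
are put into layer `0`. So both sides are sums of the same kind, with `q = X ^ η`: for `n = 1` there
is an extra letter of weight `1`, absent from layer `0`, and for `n = 2` there is none.

The engine is a comparison of a letter placed right after the plain parts of each layer with the
same letter placed right before the plain parts of the next layer (`highSum_eq`). Let `T(u)` be the
total for letters `x :: xs` and `T'(u)` the one for `xs ++ [x * q]`. Reflected to negative `u` by `u
↦ -u` if `n = 2` and `u ↦ -1 - u` if `n = 1`, they satisfy `(1 + x) T(u) = (1 + x²) T'(u) + x (T'(u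
- 1) + T'(u + 1))` minus a multiple of `T'(K)` whose coefficient is made of elementary symmetric
polynomials (`extTotal_cons`). For `n = 1` this forces the totals to be symmetric in the letters
(`extTotal_one_swap`).

Twice the desired identity says that `defect` vanishes. Its `n = 1` part is built from `G(u) + G(u -
1)`, where `G` is the total with the extra letter moved to the end. This sum is even in `u` because
`G(-1 - u) = G(u)`, so the defect obeys the recurrence of the case `n = 2` (`defect_cons`). Modulo a
power of `q`, repeated rotation makes every letter zero, and zero letters can be erased. This
reduces the claim to the empty alphabet. That case is reached from the other side: for the single
letter `-q` the sums collapse (`topSum_neg_one`, `defect_neg_q`), and the recurrence read in the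
opposite direction passes from `-q` to `-q * q ^ i`, hence to `0` (`defect_nil`). Reading it forward
again gives all alphabets (`defect_eq_zero`).

The combinatorial half identifies coefficients with cardinalities (`isOverB_iff_valid`,
`coeff_baseTotal`). The bijection then exists because the two sides have equally many elements of
each weight. -/

namespace Layered

variable {R : Type*} [CommRing R]

/-! ### Capacity conditions, crossing numbers and sums over subsets of letters -/

/-- `s` does not exceed `K`, and is equal to `K` only if `b` vanishes. -/
def Fits (K n s : ℕ) (b : ZMod n) : Prop := s < K ∨ (s = K ∧ b = 0)

instance (K n s : ℕ) (b : ZMod n) : Decidable (Fits K n s b) :=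
  inferInstanceAs (Decidable (_ ∨ _))

theorem Fits.le {K n s : ℕ} {b : ZMod n} (h : Fits K n s b) : s ≤ K := by
  rcases h with h | h <;> omega

theorem Fits.eq_zero {K n s : ℕ} {b : ZMod n} (h : Fits K n s b) (hs : s = K) : b = 0 := by
  rcases h with h | h
  · omega
  · exact h.2

theorem Fits.of_lt {K n s : ℕ} {b : ZMod n} (h : s < K) : Fits K n s b := Or.inl h

theorem Fits.mono {K n s s' : ℕ} {b : ZMod n} (h : Fits K n s b) (hs : s' ≤ s) :
    Fits K n s' b := by
  rcases h with h | h
  · exact Or.inl (by omega)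
  · rcases hs.lt_or_eq with h' | h'
    · exact Or.inl (by omega)
    · exact Or.inr ⟨by omega, h.2⟩

/-- The sum of `φ` over the subsets of a list of letters, each letter of the subset contributing
its weight. -/
def bitSum : List R → (List Bool → R) → R
  | [], φ => φ []
  | x :: xs, φ => bitSum xs (fun A => φ (false :: A)) + x * bitSum xs (fun A => φ (true :: A))

/-- The number of letters in a subset. -/
def ones : List Bool → ℕ
  | [] => 0
  | a :: A => a.toNat + ones A

/-- The largest number of letters in a final segment of the first subset and the complementary
initial segment of the second one. -/
def cross : List Bool → List Bool → ℕ
  | a :: A, b :: B => max (a.toNat + ones A) (b.toNat + cross A B)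
  | _, _ => 0

theorem ones_append_singleton (A : List Bool) (a : Bool) : ones (A ++ [a]) = ones A + a.toNat := by
  induction A with
  | nil => simp [ones]
  | cons b A ih => simp [ones, ih]; omega

theorem ones_le_length (A : List Bool) : ones A ≤ A.length := by
  induction A with
  | nil => simp [ones]
  | cons b A ih => cases b <;> simp [ones] <;> omega

theorem ones_le_cross_left {A B : List Bool} (h : A.length = B.length) : ones A ≤ cross A B := by
  cases A with
  | nil => simp [ones]
  | cons a A =>
    cases B with
    | nil => simp at h
    | cons b B => simp [ones, cross]

theorem ones_le_cross_right {A B : List Bool} (h : A.length = B.length) : ones B ≤ cross A B := by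
  induction A generalizing B with
  | nil => cases B with
    | nil => simp [ones]
    | cons b B => simp at h
  | cons a A ih =>
    cases B with
    | nil => simp at h
    | cons b B =>
      have := ih (B := B) (by simpa using h)
      simp only [ones, cross]; omega

theorem cross_le_length {A B : List Bool} (h : A.length = B.length) : cross A B ≤ A.length := by
  induction A generalizing B with
  | nil => simp [cross]
  | cons a A ih =>
    cases B with
    | nil => simp at h
    | cons b B =>
      have := ih (B := B) (by simpa using h)
      have h1 := ones_le_length A
      have ha : a.toNat ≤ 1 := Bool.toNat_le a
      have hb : b.toNat ≤ 1 := Bool.toNat_le b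
      simp only [cross, List.length_cons]; omega

/-- `cross` is defined by recursion from the first letter. This is the recursion from the last one,
needed when a letter is added at the end of each layer. -/
theorem cross_append_singleton {A B : List Bool} (h : A.length = B.length) (a b : Bool) :
    cross (A ++ [a]) (B ++ [b]) = max (cross A B + a.toNat) (ones B + b.toNat) := by
  induction A generalizing B with
  | nil =>
    cases B with
    | nil => simp [cross, ones]
    | cons b B => simp at h
  | cons a' A ih =>
    cases B with
    | nil => simp at h
    | cons b' B =>
      have := ih (B := B) (by simpa using h)
      simp only [cross, ones, List.cons_append, this, ones_append_singleton]
      omega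

theorem bitSum_congr {xs : List R} {φ ψ : List Bool → R}
    (h : ∀ A : List Bool, A.length = xs.length → φ A = ψ A) : bitSum xs φ = bitSum xs ψ := by
  induction xs generalizing φ ψ with
  | nil => exact h [] rfl
  | cons x xs ih =>
    simp only [bitSum]
    rw [ih (ψ := fun A => ψ (false :: A)) fun A hA => h _ (by simp [hA]),
      ih (φ := fun A => φ (true :: A)) (ψ := fun A => ψ (true :: A)) fun A hA => h _ (by simp [hA])]

theorem bitSum_add (xs : List R) (φ ψ : List Bool → R) :
    bitSum xs (fun A => φ A + ψ A) = bitSum xs φ + bitSum xs ψ := by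
  induction xs generalizing φ ψ with
  | nil => rfl
  | cons x xs ih => simp only [bitSum, ih]; ring

theorem bitSum_mul_left (xs : List R) (c : R) (φ : List Bool → R) :
    bitSum xs (fun A => c * φ A) = c * bitSum xs φ := by
  induction xs generalizing φ with
  | nil => rfl
  | cons x xs ih => simp only [bitSum, ih]; ring

theorem bitSum_zero (xs : List R) : bitSum xs (fun _ => (0 : R)) = 0 := by
  simpa using bitSum_mul_left xs 0 (fun _ => (0 : R))

theorem bitSum_append_singleton (xs : List R) (y : R) (φ : List Bool → R) :
    bitSum (xs ++ [y]) φ =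
      bitSum xs (fun A => φ (A ++ [false]) + y * φ (A ++ [true])) := by
  induction xs generalizing φ with
  | nil => rfl
  | cons x xs ih => simp only [bitSum, List.cons_append, ih]

/-- The contribution of two consecutive layers with total `s` and crossing number `g`. -/
def gate (K n s g : ℕ) (b : ZMod n) (φ : ZMod n → R) : R :=
  if Fits K n s b ∧ Fits K n g (b + s - K) then φ (b + s - K) else 0

theorem gate_congr {K n s g : ℕ} {b : ZMod n} {φ ψ : ZMod n → R}
    (h : ∀ b', Fits K n g b' → φ b' = ψ b') : gate K n s g b φ = gate K n s g b ψ := by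
  unfold gate
  split_ifs with h1
  · exact h _ h1.2
  · rfl

theorem gate_add (K n s g : ℕ) (b : ZMod n) (φ ψ : ZMod n → R) :
    gate K n s g b (fun b' => φ b' + ψ b') = gate K n s g b φ + gate K n s g b ψ := by
  unfold gate; split_ifs <;> simp

theorem gate_mul_left (K n s g : ℕ) (b : ZMod n) (c : R) (φ : ZMod n → R) :
    gate K n s g b (fun b' => c * φ b') = c * gate K n s g b φ := by
  unfold gate; split_ifs <;> simp

theorem gate_eq_zero {K n s g : ℕ} {b : ZMod n} {φ : ZMod n → R} (h : K < g) :
    gate K n s g b φ = 0 := by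
  unfold gate
  rw [if_neg]
  rintro ⟨-, h2⟩
  exact absurd h2.le (by omega)

/-! ### Generating functions of stacked layers -/

/-- The generating function of the `t` layers after a layer with letters `A`, with `f` plain parts
and with parity `b`. The letters of that layer have weights `xs`, its plain parts have weight `Q`,
and all weights are multiplied by `q` from one layer to the next. -/
def layerSum (K n : ℕ) (q : R) : ℕ → R → List R → List Bool → ℕ → ZMod n → R
  | 0, _, _, A, f, b => if Fits K n (f + ones A) b then 1 else 0
  | t + 1, Q, xs, A, f, b => ∑ f' ∈ Finset.range (K + 1), (Q * q) ^ f' *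
      bitSum (xs.map (q * ·)) fun A' => gate K n (f + ones A + f') (f' + cross A A') b
        (layerSum K n q t (Q * q) (xs.map (q * ·)) A' f')

/-- The variant of `layerSum` in which an additional letter of weight `x * Q` is placed right after
the plain parts of each layer, and `h` counts this letter together with the plain parts. -/
def lowSum (K n : ℕ) (q x : R) : ℕ → R → List R → List Bool → ℕ → ZMod n → R
  | 0, _, _, A, h, b => if Fits K n (h + ones A) b then 1 else 0
  | t + 1, Q, xs, A, h, b => ∑ h' ∈ Finset.range (K + 1), (Q * q) ^ h' *
      bitSum (xs.map (q * ·)) fun A' =>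
        gate K n (h + ones A + h') (h' + cross A A') b
          (lowSum K n q x t (Q * q) (xs.map (q * ·)) A' h') +
        if 0 < h' then x * gate K n (h + ones A + h' - 1) (h' + cross A A') b
          (lowSum K n q x t (Q * q) (xs.map (q * ·)) A' h') else 0

/-- `layerSum` with an additional last letter of weight `x * Q * q`, which is free in the present
layer. -/
def topSum (K n : ℕ) (q x : R) (t : ℕ) (Q : R) (xs : List R) (A : List Bool) (f : ℕ)
    (b : ZMod n) : R :=
  layerSum K n q t Q (xs ++ [x * Q * q]) (A ++ [false]) f b +
    x * Q * q * layerSum K n q t Q (xs ++ [x * Q * q]) (A ++ [true]) f b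

/-- The variant of `topSum` in which `h` counts the additional letter of the preceding layer
together with the plain parts. -/
def highSum (K n : ℕ) (q x : R) (t : ℕ) (Q : R) (xs : List R) (A : List Bool) (h : ℕ)
    (b : ZMod n) : R :=
  topSum K n q x t Q xs A h b + if 0 < h then x * topSum K n q x t Q xs A (h - 1) b else 0

theorem layerSum_eq_zero {K n : ℕ} {q : R} {t : ℕ} {Q : R} {xs : List R} {A : List Bool} {f : ℕ}
    {b : ZMod n} (h : ¬ Fits K n (f + ones A) b) : layerSum K n q t Q xs A f b = 0 := by
  cases t with
  | zero => simp [layerSum, h]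
  | succ t =>
    rw [layerSum]
    refine Finset.sum_eq_zero fun f' _ => ?_
    have : ∀ A', gate K n (f + ones A + f') (f' + cross A A') b
        (layerSum K n q t (Q * q) (xs.map (q * ·)) A' f') = 0 := by
      intro A'
      unfold gate
      rw [if_neg]
      rintro ⟨h1, -⟩
      exact h (h1.mono (by omega))
    simp only [this, bitSum_zero, mul_zero]

/-! ### Moving one letter past the plain parts -/

theorem sum_range_shift {K : ℕ} (F : ℕ → R) (h : F (K + 1) = 0) :
    ∑ f ∈ Finset.range (K + 1), F (f + 1) =
      ∑ h ∈ Finset.range (K + 1), if 0 < h then F h else 0 := by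
  rw [Finset.sum_range_succ, h, Finset.sum_range_succ']
  simp

/-- No window starting at a later letter, or at the plain parts of the next layer, separates the
first letter from the plain parts of its own layer, so only their joint number matters. The one
window that does separate them starts at the first letter; it is contained in the window of the
plain parts, and if it is full then so is the latter, which already forces the parity to vanish. -/
theorem layerSum_cons (K n : ℕ) (q x : R) (t : ℕ) (Q : R) (xs : List R) (o : Bool) (A : List Bool)
    (f : ℕ) (b : ZMod n) (hA : A.length = xs.length) :
    layerSum K n q t Q (x * Q :: xs) (o :: A) f b = lowSum K n q x t Q xs A (f + o.toNat) b := by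
  induction t generalizing Q xs A f b o with
  | zero =>
    rw [layerSum, lowSum]
    exact if_congr (by rw [ones, add_assoc]) rfl rfl
  | succ t ih =>
    have key : ∀ (f' : ℕ) (o' : Bool) (A' : List Bool), A'.length = xs.length →
        gate K n (f + ones (o :: A) + f') (f' + cross (o :: A) (o' :: A')) b
          (layerSum K n q t (Q * q) (q * (x * Q) :: xs.map (q * ·)) (o' :: A') f') =
        gate K n (f + o.toNat + ones A + f') (f' + o'.toNat + cross A A') b
          (lowSum K n q x t (Q * q) (xs.map (q * ·)) A' (f' + o'.toNat)) := by
      intro f' o' A' hA'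
      have h1 : q * (x * Q) = x * (Q * q) := by ring
      have h2 : f + ones (o :: A) + f' = f + o.toNat + ones A + f' := by simp only [ones]; omega
      have h3 : (layerSum K n q t (Q * q) (q * (x * Q) :: xs.map (q * ·)) (o' :: A') f') =
          (lowSum K n q x t (Q * q) (xs.map (q * ·)) A' (f' + o'.toNat)) := by
        funext b'
        rw [h1, ih _ _ _ _ _ _ (by simpa using hA')]
      rw [h2, h3]
      unfold gate
      refine if_congr (and_congr_right fun hs => ?_) rfl rfl
      constructor
      · intro h
        exact h.mono (by simp only [cross]; omega)
      · intro h
        simp only [cross]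
        rcases le_total (o.toNat + ones A) (o'.toNat + cross A A') with h4 | h4
        · rw [max_eq_right h4, ← add_assoc]; exact h
        · rw [max_eq_left h4]
          by_cases h5 : f' + (o.toNat + ones A) < K
          · exact Fits.of_lt h5
          · have h6 := hs.le
            have h7 : f + o.toNat + ones A + f' = K := by omega
            have h8 := hs.eq_zero h7
            exact Or.inr ⟨by omega, by rw [h7, h8]; simp⟩
    rw [layerSum, lowSum]
    simp only [List.map_cons, bitSum]
    have e1 : ∀ f', bitSum (xs.map (q * ·)) (fun A' =>
        gate K n (f + ones (o :: A) + f') (f' + cross (o :: A) (false :: A')) b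
          (layerSum K n q t (Q * q) (q * (x * Q) :: xs.map (q * ·)) (false :: A') f')) =
        bitSum (xs.map (q * ·)) (fun A' =>
          gate K n (f + o.toNat + ones A + f') (f' + cross A A') b
          (lowSum K n q x t (Q * q) (xs.map (q * ·)) A' f')) := fun f' =>
      bitSum_congr fun A' hA' => key f' false A' (by simpa using hA')
    have e2 : ∀ f', bitSum (xs.map (q * ·)) (fun A' =>
        gate K n (f + ones (o :: A) + f') (f' + cross (o :: A) (true :: A')) b
          (layerSum K n q t (Q * q) (q * (x * Q) :: xs.map (q * ·)) (true :: A') f')) =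
        bitSum (xs.map (q * ·)) (fun A' =>
          gate K n (f + o.toNat + ones A + (f' + 1) - 1) (f' + 1 + cross A A') b
          (lowSum K n q x t (Q * q) (xs.map (q * ·)) A' (f' + 1))) := fun f' =>
      bitSum_congr fun A' hA' => key f' true A' (by simpa using hA')
    simp only [e1, e2, mul_add, bitSum_add, Finset.sum_add_distrib]
    congr 1
    -- When the letter is present the joint number is `f' + 1`. The value `K + 1` lies outside the
    -- range, but there the gate is closed.
    refine Eq.trans (Finset.sum_congr rfl fun f' _ => ?_) ((sum_range_shift (fun h => (Q * q) ^ h *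
        bitSum (xs.map (q * ·)) (fun A' =>
          x * gate K n (f + o.toNat + ones A + h - 1) (h + cross A A') b
          (lowSum K n q x t (Q * q) (xs.map (q * ·)) A' h))) ?_).trans ?_)
    · simp only [bitSum_mul_left, pow_succ]; ring
    · rw [bitSum_congr (ψ := fun _ => 0), bitSum_zero, mul_zero]
      intro A' _
      rw [gate_eq_zero (by omega), mul_zero]
    · refine Finset.sum_congr rfl fun h _ => ?_
      split_ifs <;> simp [bitSum_zero]

/-- Dually to `layerSum_cons`, the last letter of a layer behaves like a plain part of the next
layer. The other term in the maximum defining the new crossing number is a condition on the next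
layer alone, which `layerSum` of that layer imposes anyway. -/
theorem topSum_succ (K n : ℕ) (q x : R) (t : ℕ) (Q : R) (xs : List R) (A : List Bool) (f : ℕ)
    (b : ZMod n) (hA : A.length = xs.length) :
    topSum K n q x (t + 1) Q xs A f b = ∑ h' ∈ Finset.range (K + 1), (Q * q) ^ h' *
      bitSum (xs.map (q * ·)) fun A' => gate K n (f + ones A + h') (h' + cross A A') b
        (highSum K n q x t (Q * q) (xs.map (q * ·)) A' h') := by
  have hy : q * (x * Q * q) = x * (Q * q) * q := by ring
  have key : ∀ (a : Bool) (f' : ℕ), bitSum ((xs ++ [x * Q * q]).map (q * ·)) (fun A' =>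
      gate K n (f + ones (A ++ [a]) + f') (f' + cross (A ++ [a]) A') b
        (layerSum K n q t (Q * q) ((xs ++ [x * Q * q]).map (q * ·)) A' f')) =
      bitSum (xs.map (q * ·)) (fun A' =>
        gate K n (f + ones A + (f' + a.toNat)) (f' + a.toNat + cross A A') b
          (topSum K n q x t (Q * q) (xs.map (q * ·)) A' f')) := by
    intro a f'
    have hm : (xs ++ [x * Q * q]).map (q * ·) = xs.map (q * ·) ++ [x * (Q * q) * q] := by
      simp [hy]
    rw [hm, bitSum_append_singleton]
    refine bitSum_congr fun A' hA' => ?_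
    have hAA : A.length = A'.length := by rw [hA, hA']; simp
    have h1 : ∀ c : Bool, gate K n (f + ones (A ++ [a]) + f')
        (f' + cross (A ++ [a]) (A' ++ [c])) b (layerSum K n q t (Q * q)
          (xs.map (q * ·) ++ [x * (Q * q) * q]) (A' ++ [c]) f') =
        gate K n (f + ones A + (f' + a.toNat)) (f' + a.toNat + cross A A') b
          (layerSum K n q t (Q * q) (xs.map (q * ·) ++ [x * (Q * q) * q]) (A' ++ [c]) f') := by
      intro c
      rw [ones_append_singleton, cross_append_singleton hAA,
        show f + (ones A + a.toNat) + f' = f + ones A + (f' + a.toNat) by omega]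
      unfold gate
      by_cases hs : Fits K n (f' + a.toNat + cross A A')
          (b + ((f + ones A + (f' + a.toNat) : ℕ) : ZMod n) - K)
      · by_cases hs' : Fits K n (f' + (ones A' + c.toNat))
          (b + ((f + ones A + (f' + a.toNat) : ℕ) : ZMod n) - K)
        · have hm' : Fits K n (f' + max (cross A A' + a.toNat) (ones A' + c.toNat))
              (b + ((f + ones A + (f' + a.toNat) : ℕ) : ZMod n) - K) := by
            rcases le_total (cross A A' + a.toNat) (ones A' + c.toNat) with h4 | h4
            · rwa [max_eq_right h4]
            · rw [max_eq_left h4]; exact hs.mono (by omega)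
          exact if_congr (and_congr_right fun _ => iff_of_true hm' hs) rfl rfl
        · rw [layerSum_eq_zero (by rw [ones_append_singleton]; exact hs')]
          simp
      · rw [if_neg, if_neg]
        · rintro ⟨-, h⟩; exact hs h
        · rintro ⟨-, h⟩; exact hs (h.mono (by omega))
    rw [h1, h1, ← gate_mul_left, ← gate_add]
    rfl
  have e0 := fun f' => key false f'
  have e1 := fun f' => key true f'
  simp only [Bool.toNat_false, Bool.toNat_true, add_zero] at e0 e1
  have hh : ∀ (A' : List Bool) (h' : ℕ), highSum K n q x t (Q * q) (xs.map (q * ·)) A' h' =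
      fun b' => topSum K n q x t (Q * q) (xs.map (q * ·)) A' h' b' +
        (fun b' => if 0 < h' then x * topSum K n q x t (Q * q) (xs.map (q * ·)) A' (h' - 1) b'
          else 0) b' := fun _ _ => rfl
  rw [topSum, layerSum, layerSum]
  simp only [e0, e1]
  simp only [hh, gate_add, bitSum_add, mul_add, Finset.sum_add_distrib]
  congr 1
  rw [Finset.mul_sum]
  refine Eq.trans (Finset.sum_congr rfl fun f' _ => ?_) ((sum_range_shift (fun h => (Q * q) ^ h *
      bitSum (xs.map (q * ·)) (fun A' =>
        gate K n (f + ones A + h) (h + cross A A') b (fun b' => x *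
          topSum K n q x t (Q * q) (xs.map (q * ·)) A' (h - 1) b'))) ?_).trans ?_)
  · simp only [gate_mul_left, bitSum_mul_left, pow_succ, Nat.add_sub_cancel]; ring
  · rw [bitSum_congr (ψ := fun _ => 0), bitSum_zero, mul_zero]
    intro A' _
    rw [gate_eq_zero (by omega)]
  · refine Finset.sum_congr rfl fun h _ => ?_
    split_ifs
    · rfl
    · simp [gate, bitSum_zero]

theorem highSum_succ (K n : ℕ) (q x : R) (t : ℕ) (Q : R) (xs : List R) (A : List Bool) (h : ℕ)
    (b : ZMod n) (hA : A.length = xs.length) :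
    highSum K n q x (t + 1) Q xs A h b = ∑ h' ∈ Finset.range (K + 1), (Q * q) ^ h' *
      bitSum (xs.map (q * ·)) fun A' =>
        gate K n (h + ones A + h') (h' + cross A A') b
          (highSum K n q x t (Q * q) (xs.map (q * ·)) A' h') +
        if 0 < h then x * gate K n (h + ones A + h' - 1) (h' + cross A A') b
          (highSum K n q x t (Q * q) (xs.map (q * ·)) A' h') else 0 := by
  rw [highSum]
  by_cases hh : 0 < h
  · simp only [hh, if_true, topSum_succ _ _ _ _ _ _ _ _ _ _ hA, bitSum_add, mul_add,
      Finset.sum_add_distrib, bitSum_mul_left, Finset.mul_sum]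
    congr 1
    refine Finset.sum_congr rfl fun h' _ => ?_
    rw [show h - 1 + ones A + h' = h + ones A + h' - 1 by omega]
    ring
  · simp only [hh, if_false, topSum_succ _ _ _ _ _ _ _ _ _ _ hA, add_zero]

theorem gate_of_fits {K n s g : ℕ} {b : ZMod n} {φ : ZMod n → R} (h1 : Fits K n s b)
    (h2 : Fits K n g (b + s - K)) : gate K n s g b φ = φ (b + s - K) :=
  if_pos ⟨h1, h2⟩

/-- The recursions of `lowSum` and `highSum` differ in one point: the term with factor `x`, where
the window total drops by one, is present according to `0 < h'` in the former and to `0 < h` in the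
latter. Induction on the number of layers shifts this discrepancy upwards. When `h = 0` it appears
as a change of the parity by one, which is why the second half has two parities. -/
theorem highSum_eq {K n : ℕ} {q x : R} {t : ℕ} {Q : R} {xs : List R}
    (hz : ∀ s ≤ xs.length, ∀ b : ZMod n, Fits K n s b) (hq : Q * q ^ (t + 1) = 0)
    {A : List Bool} (hA : A.length = xs.length) :
    (∀ (h : ℕ) (b : ZMod n), 0 < h → Fits K n (h + ones A) b →
      highSum K n q x t Q xs A h b = (1 + x) * lowSum K n q x t Q xs A h b) ∧
    ∀ b : ZMod n, highSum K n q x t Q xs A 0 b + x * highSum K n q x t Q xs A 0 (b - 1) =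
      (1 + x) * lowSum K n q x t Q xs A 0 b := by
  induction t generalizing Q xs A with
  | zero =>
    have htop : ∀ h b, topSum K n q x 0 Q xs A h b = if Fits K n (h + ones A) b then 1 else 0 := by
      intro h b
      -- `hq` kills the letter that sticks out of the top layer, so that both sides end at the same
      -- layer.
      have : x * Q * q = 0 := by
        rw [mul_assoc, show Q * q = 0 by simpa using hq, mul_zero]
      rw [topSum, this, zero_mul, add_zero, layerSum]
      exact if_congr (by rw [ones_append_singleton]; simp) rfl rfl
    have hones : ∀ b : ZMod n, Fits K n (0 + ones A) b := fun b =>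
      hz _ (by have := ones_le_length A; omega) b
    constructor
    · intro h b hh hf
      simp only [highSum, htop, hh, if_true, lowSum, hf,
        show Fits K n (h - 1 + ones A) b from hf.mono (by omega)]
      ring
    · intro b
      simp only [highSum, htop, lowSum, hones, if_true, lt_irrefl, if_false]
      ring
  | succ t ih =>
    have hq' : Q * q * q ^ (t + 1) = 0 := by rw [← hq]; ring
    have ih' := fun (A' : List Bool) (hA' : A'.length = (xs.map (q * ·)).length) =>
      ih (Q := Q * q) (xs := xs.map (q * ·)) (by simpa using hz) hq' hA'
    have hcr : ∀ A' : List Bool, A'.length = (xs.map (q * ·)).length →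
        cross A A' ≤ xs.length ∧ ones A ≤ cross A A' ∧ ones A' ≤ cross A A' := by
      intro A' hA'
      have hAA : A.length = A'.length := by rw [hA, hA']; simp
      exact ⟨hA ▸ cross_le_length hAA, ones_le_cross_left hAA, ones_le_cross_right hAA⟩
    constructor
    · intro h b hh hf
      rw [highSum_succ _ _ _ _ _ _ _ _ _ _ hA, lowSum, Finset.mul_sum]
      refine Finset.sum_congr rfl fun h' _ => ?_
      rw [mul_left_comm (1 + x), ← bitSum_mul_left _ (1 + x)]
      refine congrArg ((Q * q) ^ h' * ·) ?_
      refine bitSum_congr fun A' hA' => ?_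
      obtain ⟨ih1, ih2⟩ := ih' A' hA'
      obtain ⟨hc1, hc2, hc3⟩ := hcr A' hA'
      rw [if_pos hh]
      -- For `h' = 0` all gates are open, since the letters alone always fit, and the two on the
      -- left pass on parities differing by one: this is the second half of the induction
      -- hypothesis. For `0 < h'` the first half applies to each gate.
      rcases Nat.eq_zero_or_pos h' with rfl | hh'
      · have hs1 : Fits K n (h + ones A - 1) b := hf.mono (by omega)
        have hs0 : Fits K n (h + ones A) b := hf
        have hg : ∀ b', Fits K n (0 + cross A A') b' := fun b' => hz _ (by omega) b'
        simp only [lt_irrefl, if_false, add_zero]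
        rw [gate_of_fits hs0 (hg _), gate_of_fits hs1 (hg _), gate_of_fits hs0 (hg _), ← ih2]
        congr 3
        rw [Nat.cast_sub (by omega)]
        push_cast
        ring
      · rw [if_pos hh']
        have e : ∀ s, gate K n s (h' + cross A A') b
            (highSum K n q x t (Q * q) (xs.map (q * ·)) A' h') = (1 + x) *
            gate K n s (h' + cross A A') b
              (lowSum K n q x t (Q * q) (xs.map (q * ·)) A' h') := by
          intro s
          rw [← gate_mul_left]
          exact gate_congr fun b' hb' => ih1 h' b' hh' (hb'.mono (by omega))
        rw [e, e]
        ring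
    · intro b
      rw [highSum_succ _ _ _ _ _ _ _ _ _ _ hA, highSum_succ _ _ _ _ _ _ _ _ _ _ hA, lowSum,
        Finset.mul_sum, Finset.mul_sum, ← Finset.sum_add_distrib]
      refine Finset.sum_congr rfl fun h' _ => ?_
      rw [mul_left_comm, mul_left_comm (1 + x), ← mul_add, ← bitSum_mul_left, ← bitSum_mul_left,
        ← bitSum_add]
      congr 1
      refine bitSum_congr fun A' hA' => ?_
      obtain ⟨ih1, ih2⟩ := ih' A' hA'
      obtain ⟨hc1, hc2, hc3⟩ := hcr A' hA'
      simp only [lt_irrefl, if_false, add_zero]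
      rcases Nat.eq_zero_or_pos h' with rfl | hh'
      · have hs : ∀ b', Fits K n (0 + ones A) b' := fun b' => hz _ (by omega) b'
        have hg : ∀ b', Fits K n (0 + cross A A') b' := fun b' => hz _ (by omega) b'
        simp only [lt_irrefl, if_false, add_zero]
        rw [gate_of_fits (hs _) (hg _), gate_of_fits (hs _) (hg _), gate_of_fits (hs _) (hg _),
          ← ih2]
        congr 3
        ring
      · rw [if_pos hh']
        have e : ∀ s b, gate K n s (h' + cross A A') b
            (highSum K n q x t (Q * q) (xs.map (q * ·)) A' h') = (1 + x) *
            gate K n s (h' + cross A A') b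
              (lowSum K n q x t (Q * q) (xs.map (q * ·)) A' h') := by
          intro s b
          rw [← gate_mul_left]
          exact gate_congr fun b' hb' => ih1 h' b' hh' (hb'.mono (by omega))
        -- Lowering the total by one and lowering `b` by one give the same next parity. The gates
        -- also open together: the crossing condition bounds `ones A + h'` by `K`, and in the case
        -- of equality it forces `b - 1 = 0`.
        have e2 : gate K n (0 + ones A + h') (h' + cross A A') (b - 1)
              (lowSum K n q x t (Q * q) (xs.map (q * ·)) A' h') =
            gate K n (0 + ones A + h' - 1) (h' + cross A A') b
              (lowSum K n q x t (Q * q) (xs.map (q * ·)) A' h') := by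
          have hb : b - 1 + ((0 + ones A + h' : ℕ) : ZMod n) - K =
              b + ((0 + ones A + h' - 1 : ℕ) : ZMod n) - K := by
            rw [Nat.cast_sub (by omega)]
            push_cast
            ring
          unfold gate
          rw [hb]
          refine if_congr (and_congr_left fun hg => ?_) rfl rfl
          have hle := hg.le
          refine iff_of_true ?_ (Fits.of_lt (by omega))
          by_cases hs : 0 + ones A + h' < K
          · exact Fits.of_lt hs
          · have h0 := hg.eq_zero (by omega)
            rw [← hb, show 0 + ones A + h' = K by omega] at h0
            exact Or.inr ⟨by omega, by simpa using h0⟩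
        rw [e, e, e2]
        ring

/-! ### Totals over the lowest layer and their boundary terms -/

/-- The generating function of the configurations of `t + 1` layers, of which the lowest one has
letters of weights `xs`, and `u` plain parts, which are not weighted. -/
def total (K n : ℕ) (q : R) (t : ℕ) (xs : List R) (u : ℕ) (b : ZMod n) : R :=
  bitSum xs fun A => layerSum K n q t 1 xs A u b

/-- The variant of `total` with an additional letter of weight `x` after the plain parts, which does
not occur in the lowest layer. -/
def lowTotal (K n : ℕ) (q x : R) (t : ℕ) (xs : List R) (u : ℕ) (b : ZMod n) : R :=
  bitSum xs fun A => lowSum K n q x t 1 xs A u b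

/-- The elementary symmetric polynomials. -/
def esym (j : ℤ) (xs : List R) : R := bitSum xs fun A => if (ones A : ℤ) = j then 1 else 0

theorem esym_nil (j : ℤ) : esym j ([] : List R) = if j = 0 then 1 else 0 := by
  simp [esym, bitSum, ones, eq_comm]

theorem esym_cons (j : ℤ) (x : R) (xs : List R) :
    esym j (x :: xs) = esym j xs + x * esym (j - 1) xs := by
  rw [esym, bitSum]
  congr 1
  · refine bitSum_congr fun A _ => ?_
    simp [ones]
  · congr 1
    refine bitSum_congr fun A _ => if_congr ?_ rfl rfl
    simp only [ones, Bool.toNat_true]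
    omega

theorem esym_perm {xs ys : List R} (h : xs.Perm ys) (j : ℤ) : esym j xs = esym j ys := by
  induction h generalizing j with
  | nil => rfl
  | cons x _ ih => simp only [esym_cons, ih]
  | swap x y l => simp only [esym_cons]; ring
  | trans _ _ ih1 ih2 => rw [ih1, ih2]

theorem esym_append_singleton (j : ℤ) (x : R) (xs : List R) :
    esym j (xs ++ [x]) = esym j xs + x * esym (j - 1) xs := by
  rw [← esym_cons]
  exact esym_perm (List.perm_append_singleton x xs) j

theorem esym_eq_zero {j : ℤ} {xs : List R} (h : j < 0 ∨ (xs.length : ℤ) < j) :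
    esym j xs = 0 := by
  rw [esym, bitSum_congr (ψ := fun _ => 0), bitSum_zero]
  intro A hA
  have := ones_le_length A
  rw [if_neg]
  omega

theorem esym_zero (xs : List R) : esym 0 xs = 1 := by
  induction xs with
  | nil => simp [esym_nil]
  | cons x xs ih =>
    rw [esym_cons, ih, esym_eq_zero (Or.inl (by omega)), mul_zero, add_zero]

theorem total_cons (K n : ℕ) (q x : R) (t : ℕ) (xs : List R) (u : ℕ) (b : ZMod n) :
    total K n q t (x :: xs) u b =
      lowTotal K n q x t xs u b + x * lowTotal K n q x t xs (u + 1) b := by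
  have h : ∀ (o : Bool) (A : List Bool), A.length = xs.length →
      layerSum K n q t 1 (x :: xs) (o :: A) u b = lowSum K n q x t 1 xs A (u + o.toNat) b := by
    intro o A hA
    rw [← layerSum_cons _ _ _ _ _ _ _ _ _ _ _ hA, mul_one]
  rw [total, bitSum, lowTotal, lowTotal]
  congr 1
  · exact bitSum_congr fun A hA => h false A hA
  · congr 1
    exact bitSum_congr fun A hA => h true A hA

theorem total_append_singleton (K n : ℕ) (q x : R) (t : ℕ) (xs : List R) (u : ℕ) (b : ZMod n) :
    total K n q t (xs ++ [x * q]) u b = bitSum xs fun A => topSum K n q x t 1 xs A u b := by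
  rw [total, bitSum_append_singleton]
  simp only [topSum, mul_one]

theorem total_eq_zero {K n : ℕ} {q : R} {t : ℕ} {xs : List R} {u : ℕ} {b : ZMod n} (hu : K < u) :
    total K n q t xs u b = 0 := by
  rw [total, bitSum_congr (ψ := fun _ => 0), bitSum_zero]
  intro A _
  exact layerSum_eq_zero fun h => absurd h.le (by omega)

/-- A full layer leaves no room for plain parts in the next layer and keeps the parity `0`. The
crossing conditions then hold automatically, so nothing about `A` survives in the result. -/
theorem layerSum_full {K n : ℕ} {q : R} {t : ℕ} {Q : R} {xs : List R} {A : List Bool} {f : ℕ}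
    (hA : A.length = xs.length) (hf : f + ones A = K)
    (hc : ∀ A' : List Bool, A'.length = xs.length → ones A' ≤ K → cross A A' ≤ K) :
    layerSum K n q (t + 1) Q xs A f 0 =
      bitSum (xs.map (q * ·)) fun A' => layerSum K n q t (Q * q) (xs.map (q * ·)) A' 0 0 := by
  rw [layerSum, Finset.sum_eq_single_of_mem 0 (by simp)]
  · rw [pow_zero, one_mul]
    refine bitSum_congr fun A' hA' => ?_
    have h0 : (0 : ZMod n) + ((f + ones A + 0 : ℕ) : ZMod n) - K = 0 := by
      rw [add_zero, hf]; simp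
    by_cases h1 : ones A' ≤ K
    · have h2 := hc A' (by simpa using hA') h1
      have h3 : ∀ s ≤ K, Fits K n s (0 : ZMod n) := fun s hs =>
        hs.lt_or_eq.elim Fits.of_lt fun h => Or.inr ⟨h, rfl⟩
      rw [gate_of_fits (h3 _ (by omega)) (by rw [h0]; exact h3 _ (by omega)), h0]
    · rw [layerSum_eq_zero fun h => absurd h.le (by omega), gate_eq_zero]
      have := ones_le_cross_right (A := A) (B := A') (by rw [hA, hA']; simp)
      omega
  · intro f' _ hf'
    rw [bitSum_congr (ψ := fun _ => 0), bitSum_zero, mul_zero]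
    intro A' _
    unfold gate
    rw [if_neg]
    rintro ⟨h, -⟩
    exact absurd h.le (by omega)

theorem topSum_full {K n : ℕ} {q x : R} {t : ℕ} {Q : R} {xs : List R} {A : List Bool} {f : ℕ}
    (hA : A.length = xs.length) (hf : f + ones A = K) (hxs : xs.length ≤ K) :
    topSum K n q x t Q xs A f 0 = match t with
      | 0 => 1
      | t + 1 => bitSum (xs.map (q * ·) ++ [x * (Q * q) * q]) fun A' =>
        layerSum K n q t (Q * q) (xs.map (q * ·) ++ [x * (Q * q) * q]) A' 0 0 := by
  have hf' : f + ones (A ++ [false]) = K := by rw [ones_append_singleton]; simpa using hf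
  rw [topSum, layerSum_eq_zero (A := A ++ [true]), mul_zero, add_zero]
  · cases t with
    | zero =>
      rw [layerSum]
      exact if_pos (Or.inr ⟨hf', rfl⟩)
    | succ t =>
      have hm : (xs ++ [x * Q * q]).map (q * ·) = xs.map (q * ·) ++ [x * (Q * q) * q] := by
        simp only [List.map_append, List.map_cons, List.map_nil]
        congr 2
        ring
      rw [layerSum_full (by simp [hA]) hf', hm]
      intro A' hA' h1
      rcases List.eq_nil_or_concat A' with rfl | ⟨B, c, rfl⟩
      · simp at hA'
      · rw [List.concat_eq_append] at *
        have hAB : A.length = B.length := by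
          have : B.length = xs.length := by simpa using hA'
          rw [hA, this]
        rw [cross_append_singleton hAB]
        rw [ones_append_singleton] at h1
        have := cross_le_length hAB
        simp only [Bool.toNat_false]
        omega
  · rw [ones_append_singleton]
    intro h
    exact absurd h.le (by simp only [Bool.toNat_true]; omega)

theorem lowSum_eq_zero {K n : ℕ} {q x : R} {t : ℕ} {Q : R} {xs : List R} {A : List Bool} {h : ℕ}
    {b : ZMod n} (hh : K < h + ones A) : lowSum K n q x t Q xs A h b = 0 := by
  cases t with
  | zero =>
    rw [lowSum]
    exact if_neg fun h => absurd h.le (by omega)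
  | succ t =>
    rw [lowSum]
    refine Finset.sum_eq_zero fun h' _ => ?_
    rw [bitSum_congr (ψ := fun _ => 0), bitSum_zero, mul_zero]
    intro A' _
    unfold gate
    rw [if_neg fun h => absurd h.1.le (by omega), zero_add]
    split_ifs with h1 h2
    · exact absurd h2.1.le (by omega)
    · rw [mul_zero]
    · rfl

theorem ones_replicate_false (l : ℕ) : ones (List.replicate l false) = 0 := by
  induction l with
  | zero => rfl
  | succ l ih => simp [List.replicate_succ, ones, ih]

theorem bitSum_eq_empty {xs : List R} {φ : List Bool → R}
    (h : ∀ A : List Bool, 0 < ones A → φ A = 0) :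
    bitSum xs φ = φ (List.replicate xs.length false) := by
  induction xs generalizing φ with
  | nil => rfl
  | cons x xs ih =>
    rw [bitSum, ih fun A hA => h _ (by simpa [ones] using hA),
      bitSum_congr (φ := fun A => φ (true :: A)) (ψ := fun _ => 0), bitSum_zero, mul_zero, add_zero]
    · rfl
    · exact fun A _ => h _ (by simp [ones])

/-- Since the sum above a full layer does not depend on its content, it can be computed with `K`
plain parts and no letters, the only choice that contributes to the right-hand side. -/
theorem total_full {K n : ℕ} {q x : R} {t : ℕ} {xs : List R} (hxs : xs.length ≤ K)
    {A : List Bool} (hA : A.length = xs.length) {f : ℕ} (hf : f + ones A = K) :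
    topSum K n q x t 1 xs A f 0 = total K n q t (xs ++ [x * q]) K 0 := by
  rw [total_append_singleton, bitSum_eq_empty, topSum_full hA hf hxs,
    topSum_full (by simp) (by rw [ones_replicate_false, add_zero]) hxs]
  intro B hB
  rw [topSum, layerSum_eq_zero, layerSum_eq_zero, mul_zero, add_zero] <;>
  · rw [ones_append_singleton]
    exact fun h => absurd h.le (by omega)

/-- The second half of `highSum_eq` summed over the lowest layer. The parity `-1` is what the value
at `u = -1` has to stand for. -/
theorem lowTotal_zero {K n : ℕ} {q x : R} {t : ℕ} {xs : List R}
    (hz : ∀ s ≤ xs.length, ∀ b : ZMod n, Fits K n s b) (hq : q ^ (t + 1) = 0) :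
    (1 + x) * lowTotal K n q x t xs 0 0 =
      total K n q t (xs ++ [x * q]) 0 0 + x * total K n q t (xs ++ [x * q]) 0 (-1) := by
  rw [lowTotal, ← bitSum_mul_left, total_append_singleton, total_append_singleton,
    ← bitSum_mul_left, ← bitSum_add]
  refine bitSum_congr fun A hA => ?_
  rw [← (highSum_eq hz (by rw [one_mul, hq]) hA).2]
  simp [highSum]

theorem lowTotal_pos {K n : ℕ} {q x : R} {t : ℕ} {xs : List R} (hxs : xs.length ≤ K)
    (hz : ∀ s ≤ xs.length, ∀ b : ZMod n, Fits K n s b) (hq : q ^ (t + 1) = 0) {u : ℕ}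
    (hu : 0 < u) :
    (1 + x) * lowTotal K n q x t xs u 0 =
      total K n q t (xs ++ [x * q]) u 0 + x * total K n q t (xs ++ [x * q]) (u - 1) 0 -
        x * esym (K + 1 - u) xs * total K n q t (xs ++ [x * q]) K 0 := by
  have key : ∀ A : List Bool, A.length = xs.length →
      (1 + x) * lowSum K n q x t 1 xs A u 0 =
        topSum K n q x t 1 xs A u 0 + x * topSum K n q x t 1 xs A (u - 1) 0 +
          (- x * total K n q t (xs ++ [x * q]) K 0) *
            if (ones A : ℤ) = K + 1 - u then 1 else 0 := by
    intro A hA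
    -- Below `K + 1` this is `highSum_eq`. At `K + 1` the low sum vanishes but `topSum` at `u - 1`
    -- is the sum over a full layer, and subtracting it produces the `esym` term. Above, every term
    -- is zero.
    rcases Nat.lt_trichotomy (u + ones A) (K + 1) with h | h | h
    · rw [← (highSum_eq hz (by rw [one_mul, hq]) hA).1 u 0 hu
        ((show u + ones A ≤ K by omega).lt_or_eq.elim Fits.of_lt fun h => Or.inr ⟨h, rfl⟩),
        highSum, if_pos hu, if_neg (by omega), mul_zero, add_zero]
    · rw [lowSum_eq_zero (by omega), if_pos (by omega), total_full hxs hA (f := u - 1) (by omega)]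
      have : topSum K n q x t 1 xs A u 0 = 0 := by
        rw [topSum, layerSum_eq_zero, layerSum_eq_zero, mul_zero, add_zero] <;>
        · rw [ones_append_singleton]
          exact fun h => absurd h.le (by omega)
      rw [this]
      ring
    · have : ∀ v, u - 1 ≤ v → topSum K n q x t 1 xs A v 0 = 0 := by
        intro v hv
        rw [topSum, layerSum_eq_zero, layerSum_eq_zero, mul_zero, add_zero] <;>
        · rw [ones_append_singleton]
          exact fun h => absurd h.le (by omega)
      rw [lowSum_eq_zero (by omega), if_neg (by omega), this u (by omega), this _ le_rfl]
      ring
  rw [lowTotal, ← bitSum_mul_left, bitSum_congr key, bitSum_add, bitSum_add, bitSum_mul_left,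
    bitSum_mul_left, ← total_append_singleton, ← total_append_singleton, esym]
  ring

/-! ### Reflection in `u` and the rotation recurrence -/

/-- `total` for an integer number of plain parts, extended by reflection to the negative ones. -/
def extTotal (K n : ℕ) (q : R) (t : ℕ) (xs : List R) (u : ℤ) : R :=
  if 0 ≤ u then total K n q t xs u.toNat 0
  else if n = 1 then total K n q t xs (-1 - u).toNat 0 else total K n q t xs (-u).toNat 0

theorem extTotal_natCast (K n : ℕ) (q : R) (t : ℕ) (xs : List R) (u : ℕ) :
    extTotal K n q t xs u = total K n q t xs u 0 := by simp [extTotal]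

theorem extTotal_of_gt {K n : ℕ} {q : R} {t : ℕ} {xs : List R} {u : ℤ} (hu : (K : ℤ) < u) :
    extTotal K n q t xs u = 0 := by
  rw [extTotal, if_pos (by omega), total_eq_zero (by omega)]

theorem extTotal_one_neg (K : ℕ) (q : R) (t : ℕ) (xs : List R) (u : ℤ) :
    extTotal K 1 q t xs (-1 - u) = extTotal K 1 q t xs u := by
  rcases lt_or_ge u 0 with hu | hu
  · rw [extTotal, if_pos (by omega), extTotal, if_neg (by omega), if_pos rfl]
  · rw [extTotal, if_neg (by omega), if_pos rfl, extTotal, if_pos hu]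
    congr 1
    omega

theorem extTotal_two_neg (K : ℕ) (q : R) (t : ℕ) (xs : List R) (u : ℤ) :
    extTotal K 2 q t xs (-u) = extTotal K 2 q t xs u := by
  rcases lt_trichotomy u 0 with hu | rfl | hu
  · rw [extTotal, if_pos (by omega), extTotal, if_neg (by omega), if_neg (by omega)]
  · simp
  · rw [extTotal, if_neg (by omega), if_neg (by omega), extTotal, if_pos hu.le]
    congr 1
    omega

/-- A full lowest layer of odd parity may be replaced by one with one more plain part. -/
theorem total_zero_neg_one {K : ℕ} {q : R} {t : ℕ} {xs : List R} :
    total K 2 q t xs 0 (-1) = total K 2 q t xs 1 0 := by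
  rw [total, total]
  refine bitSum_congr fun A hA => ?_
  -- Odd parity forbids `s = K`, which leaves `s + 1 ≤ K`, the condition for `s + 1` with parity
  -- zero.
  have hf : ∀ s, Fits K 2 s (-1) ↔ Fits K 2 (s + 1) 0 := by
    intro s
    simp only [Fits, show (-1 : ZMod 2) ≠ 0 by decide, and_false, or_false, and_true]
    omega
  cases t with
  | zero =>
    rw [layerSum, layerSum]
    refine if_congr ?_ rfl rfl
    rw [hf, show 0 + ones A + 1 = 1 + ones A by omega]
  | succ t =>
    rw [layerSum, layerSum]
    refine Finset.sum_congr rfl fun f' _ => ?_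
    congr 1
    refine bitSum_congr fun A' _ => ?_
    unfold gate
    have hb : (-1 : ZMod 2) + ((0 + ones A + f' : ℕ) : ZMod 2) - K =
        0 + ((1 + ones A + f' : ℕ) : ZMod 2) - K := by
      rw [show (-1 : ZMod 2) = 1 by decide]
      push_cast
      ring
    rw [hb]
    refine if_congr (and_congr_left' ?_) rfl rfl
    rw [hf, show 0 + ones A + f' + 1 = 1 + ones A + f' by omega]

/-- This explains the two reflections: they are chosen so that the formulas of `lowTotal` for `u =
0` and for `0 < u` merge into one recurrence. -/
theorem extTotal_neg_one {K n : ℕ} (hn : n = 1 ∨ n = 2) {q : R} {t : ℕ} {xs : List R} :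
    extTotal K n q t xs (-1) = total K n q t xs 0 (-1) := by
  rcases hn with rfl | rfl
  · rw [show (-1 : ZMod 1) = 0 from Subsingleton.elim _ _]
    simp [extTotal]
  · rw [total_zero_neg_one]
    simp [extTotal]

/-- Moving the first letter past the plain parts of its layer, to the end of the preceding layer. -/
theorem extTotal_cons {K n : ℕ} (hn : n = 1 ∨ n = 2) {q x : R} {t : ℕ} {xs : List R}
    (hxs : xs.length ≤ K) (hn2 : n = 2 → xs.length < K) (hq : q ^ (t + 1) = 0) {u : ℤ}
    (hu : 0 ≤ u) :
    (1 + x) * extTotal K n q t (x :: xs) u =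
      (1 + x ^ 2) * extTotal K n q t (xs ++ [x * q]) u +
        x * (extTotal K n q t (xs ++ [x * q]) (u - 1) +
          extTotal K n q t (xs ++ [x * q]) (u + 1)) -
        x * (esym (K + 1 - u) xs + x * esym (K - u) xs) * extTotal K n q t (xs ++ [x * q]) K := by
  lift u to ℕ using hu
  have hz : ∀ s ≤ xs.length, ∀ b : ZMod n, Fits K n s b := by
    intro s hs b
    rcases hn with rfl | rfl
    · exact (hs.trans hxs).lt_or_eq.elim Fits.of_lt fun h => Or.inr ⟨h, Subsingleton.elim _ _⟩
    · exact Fits.of_lt (by have := hn2 rfl; omega)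
  have h1 := lowTotal_pos (x := x) hxs hz hq (Nat.succ_pos u)
  rw [extTotal_natCast, extTotal_natCast, extTotal_natCast, total_cons, mul_add, mul_left_comm,
    Nat.succ_eq_add_one] at *
  rw [h1, show ((u : ℤ) + 1) = ((u + 1 : ℕ) : ℤ) by push_cast; rfl, extTotal_natCast,
    show (K : ℤ) + 1 - ((u + 1 : ℕ) : ℤ) = K - u by push_cast; ring]
  rcases Nat.eq_zero_or_pos u with rfl | hu
  · rw [lowTotal_zero hz hq]
    simp only [Nat.cast_zero, zero_sub, sub_zero, extTotal_neg_one hn]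
    rw [esym_eq_zero (j := (K : ℤ) + 1) (Or.inr (by omega))]
    simp only [Nat.zero_add, Nat.sub_self]
    ring
  · rw [lowTotal_pos hxs hz hq hu, show ((u : ℤ) - 1) = ((u - 1 : ℕ) : ℤ) by omega,
      extTotal_natCast, Nat.add_sub_cancel]
    ring

/-! ### Letters of weight zero, and symmetry in the letters for `n = 1` -/

theorem lowSum_zero (K n : ℕ) (q : R) (t : ℕ) (Q : R) (xs : List R) (A : List Bool) (h : ℕ)
    (b : ZMod n) : lowSum K n q 0 t Q xs A h b = layerSum K n q t Q xs A h b := by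
  induction t generalizing Q xs A h b with
  | zero => rfl
  | succ t ih =>
    have : ∀ Q xs A h, lowSum K n q 0 t Q xs A h = layerSum K n q t Q xs A h :=
      fun Q xs A h => funext fun b => ih Q xs A h b
    rw [lowSum, layerSum]
    simp [this]

theorem total_cons_zero (K n : ℕ) (q : R) (t : ℕ) (xs : List R) (u : ℕ) (b : ZMod n) :
    total K n q t (0 :: xs) u b = total K n q t xs u b := by
  rw [total_cons, zero_mul, add_zero]
  simp only [lowTotal, lowSum_zero, total]

theorem extTotal_cons_zero (K n : ℕ) (q : R) (t : ℕ) (xs : List R) (u : ℤ) :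
    extTotal K n q t (0 :: xs) u = extTotal K n q t xs u := by
  simp only [extTotal, total_cons_zero]

/-- Rotating both letters to the end applies two operators of the form `1 + x² + x (shift + inverse
shift)`, which commute. The boundary terms are made of elementary symmetric polynomials and match
once the rotated letters may be exchanged. -/
theorem extTotal_one_swap_nil {K : ℕ} {q a b : R} {t : ℕ} {l : List R}
    (hl : (l.length : ℤ) + 1 ≤ K) (hq : q ^ (t + 1) = 0) (ha : IsUnit (1 + a)) (hb : IsUnit (1 + b))
    (h : ∀ u, extTotal K 1 q t (l ++ [a * q, b * q]) u = extTotal K 1 q t (l ++ [b * q, a * q]) u)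
    {u : ℤ} (hu : 0 ≤ u) :
    extTotal K 1 q t (a :: b :: l) u = extTotal K 1 q t (b :: a :: l) u := by
  have h1 : ∀ (a b : R), ∀ v : ℤ, 0 ≤ v → _ := fun a b v hv =>
    extTotal_cons (K := K) (n := 1) (Or.inl rfl) (q := q) (x := a) (t := t) (xs := b :: l)
      (by simp only [List.length_cons]; omega) (by simp) hq hv
  have h2 : ∀ (a b : R), ∀ v : ℤ, 0 ≤ v → _ := fun a b v hv =>
    extTotal_cons (K := K) (n := 1) (Or.inl rfl) (q := q) (x := b) (t := t) (xs := l ++ [a * q])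
      (by simp only [List.length_append, List.length_singleton]; omega) (by simp) hq hv
  have hK : ∀ l : List R, extTotal K 1 q t l (K + 1) = 0 := fun l => extTotal_of_gt (by omega)
  -- In terms of `w = K - u` the indices of all `esym` terms normalise to `w` plus a constant.
  obtain ⟨w, rfl⟩ : ∃ w : ℤ, u = K - w := ⟨K - u, by ring⟩
  simp only [List.cons_append, List.append_assoc, List.nil_append, esym_cons,
    esym_append_singleton] at h1 h2
  rw [← sub_eq_zero, ← (ha.mul hb).mul_right_eq_zero]
  have i1 : (K : ℤ) + 1 - (K - w) = w + 1 := by ring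
  have i2 : (K : ℤ) - (K - w) = w := by ring
  have i3 : (K : ℤ) + 1 - (K - w - 1) = w + 2 := by ring
  have i4 : (K : ℤ) - (K - w - 1) = w + 1 := by ring
  have i5 : (K : ℤ) + 1 - (K - w + 1) = w := by ring
  have i6 : (K : ℤ) - (K - w + 1) = w - 1 := by ring
  have i7 : (K : ℤ) + 1 - K = 1 := by ring
  have i8 : (K : ℤ) - K = 0 := by ring
  have j1 : w + 1 - 1 = w := by ring
  have j2 : w + 2 - 1 = w + 1 := by ring
  have j3 : w - 1 - 1 = w - 2 := by ring
  have j4 : (1 : ℤ) - 1 = 0 := by ring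
  have j5 : (0 : ℤ) - 1 = -1 := by ring
  have en : esym (-1) l = 0 := esym_eq_zero (Or.inl (by omega))
  have a1 := h1 a b _ hu
  have b1 := h1 b a _ hu
  have a2 := h2 a b _ hu
  have b2 := h2 b a _ hu
  have a3 := h2 a b (K - w + 1) (by omega)
  have b3 := h2 b a (K - w + 1) (by omega)
  have a4 := h2 a b K (by omega)
  have b4 := h2 b a K (by omega)
  -- At `u = 0` the recurrence is not available for the neighbour `-1`. Its value is folded back to
  -- `0` by reflection, and the relevant top symmetric polynomials vanish because `l` has fewer than
  -- `K` letters.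
  rcases hu.eq_or_lt with hu0 | hu0
  · have hw : w = K := by omega
    subst hw
    have hm : ∀ l : List R, extTotal K 1 q t l (-1) = extTotal K 1 q t l 0 := fun l => by
      rw [← extTotal_one_neg]; rfl
    have e0 : esym (K : ℤ) l = 0 := esym_eq_zero (Or.inr (by omega))
    have e1 : esym ((K : ℤ) + 1) l = 0 := esym_eq_zero (Or.inr (by omega))
    simp only [i7, i8, j1, j3, j4, j5, en, esym_zero, hK, e0, e1, zero_add,
      sub_zero, hm, ← h] at a1 b1 a2 b2 a3 b3 a4 b4 ⊢
    linear_combination (1 + b) * a1 - (1 + a) * b1 + (1 + a ^ 2 + a) * a2 - (1 + b ^ 2 + b) * b2 +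
      a * a3 - b * b3 - a * (a * b * esym ((K : ℤ) - 1) l) * a4 +
      b * (a * b * esym ((K : ℤ) - 1) l) * b4
  · have a5 := h2 a b (K - w - 1) (by omega)
    have b5 := h2 b a (K - w - 1) (by omega)
    simp only [i1, i2, i3, i4, i5, i6, i7, i8, j1, j2, j3, j4, j5, en, esym_zero, hK, ← h]
      at a1 b1 a2 b2 a3 b3 a4 b4 a5 b5 ⊢
    linear_combination (1 + b) * a1 - (1 + a) * b1 + (1 + a ^ 2) * a2 - (1 + b ^ 2) * b2 +
      a * a3 - b * b3 + a * a5 - b * b5 -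
      a * (esym (w + 1) l + b * esym w l + a * (esym w l + b * esym (w - 1) l)) * a4 +
      b * (esym (w + 1) l + a * esym w l + b * (esym w l + a * esym (w - 1) l)) * b4

/-- Leading letters are rotated away until `a` and `b` come first. Rotating these two as well
multiplies them by `q`, which lowers `i`; for `i = 0` both are zero. Nilpotency makes each factor `1
+ x` cancellable. -/
theorem extTotal_one_swap {K : ℕ} {q : R} {t : ℕ} (hq : q ^ (t + 1) = 0) (i : ℕ) {a b : R}
    (hai : a * q ^ i = 0) (hbi : b * q ^ i = 0) (ha : IsNilpotent a) (hb : IsNilpotent b)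
    {l m : List R} (hl : ∀ x ∈ l, IsNilpotent x) (hm : ∀ x ∈ m, IsNilpotent x)
    (hK : l.length + m.length + 1 ≤ K) (u : ℤ) :
    extTotal K 1 q t (l ++ a :: b :: m) u = extTotal K 1 q t (l ++ b :: a :: m) u := by
  induction i generalizing a b l m u with
  | zero =>
    rw [pow_zero, mul_one] at hai hbi
    rw [hai, hbi]
  | succ i ih =>
    induction l generalizing m u with
    | nil =>
      have key : ∀ u, 0 ≤ u →
          extTotal K 1 q t (a :: b :: m) u = extTotal K 1 q t (b :: a :: m) u := fun u hu =>
        extTotal_one_swap_nil (by simp only [List.length_nil] at hK; omega) hq ha.isUnit_one_add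
          hb.isUnit_one_add (fun u => ih (by rw [← hai]; ring) (by rw [← hbi]; ring)
            ((Commute.all a q).isNilpotent_mul_right ha)
            ((Commute.all b q).isNilpotent_mul_right hb) hm (by simp) (by simpa using hK) u) hu
      rcases lt_or_ge u 0 with hu | hu
      · simpa only [List.nil_append, extTotal_one_neg] using key (-1 - u) (by omega)
      · exact key u hu
    | cons x l ihl =>
      have hx : IsNilpotent x := hl x (by simp)
      have hl' : ∀ y ∈ l, IsNilpotent y := fun y hy => hl y (by simp [hy])
      have hK' : l.length + m.length + 2 ≤ K := by simp only [List.length_cons] at hK; omega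
      have key : ∀ u, 0 ≤ u → extTotal K 1 q t (x :: (l ++ a :: b :: m)) u =
          extTotal K 1 q t (x :: (l ++ b :: a :: m)) u := by
        intro u hu
        have e : ∀ u, extTotal K 1 q t (l ++ a :: b :: m ++ [x * q]) u =
            extTotal K 1 q t (l ++ b :: a :: m ++ [x * q]) u := by
          intro u
          have := ihl hl' (m := m ++ [x * q]) (by
            intro y hy
            rcases List.mem_append.1 hy with hy | hy
            · exact hm y hy
            · rw [List.mem_singleton.1 hy]
              exact (Commute.all x q).isNilpotent_mul_right hx)
            (by simp only [List.length_append, List.length_singleton]; omega) u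
          simpa using this
        have hp : ∀ j, esym j (l ++ a :: b :: m) = esym j (l ++ b :: a :: m) := fun j =>
          esym_perm ((List.Perm.swap b a m).append_left l) j
        rw [← hx.isUnit_one_add.mul_right_inj,
          extTotal_cons (Or.inl rfl) (by simp only [List.length_append, List.length_cons]; omega)
            (by simp) hq hu,
          extTotal_cons (Or.inl rfl) (by simp only [List.length_append, List.length_cons]; omega)
            (by simp) hq hu]
        simp only [e, hp]
      rcases lt_or_ge u 0 with hu | hu
      · simpa only [List.cons_append, extTotal_one_neg] using key (-1 - u) (by omega)
      · exact key u hu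

/-! ### The defect between the moduli `2` and `1` -/

/-- The difference of the two sides of the identity relating the moduli `2` and `1`. -/
def defect (K : ℕ) (q : R) (t : ℕ) (xs : List R) (u : ℕ) : R :=
  2 * (∏ i ∈ Finset.range (t + 1), (1 + q ^ (i + 1))) * extTotal K 2 q t xs u -
    (extTotal K 1 q t (xs ++ [q]) u + extTotal K 1 q t (xs ++ [q]) (u - 1) -
      esym (K + 1 - u) xs * extTotal K 1 q t (xs ++ [q]) K)

/-- The `n = 2` part satisfies this by `extTotal_cons`. For the `n = 1` part the recurrences at `u`
and `u - 1` are added and the one at `K` accounts for the subtracted term. The reflection `v ↦ -1 -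
v` exchanges the two summands under `u ↦ -u`, whence the absolute value. -/
theorem defect_cons {K : ℕ} {q x : R} {t : ℕ} {l : List R} (hq : q ^ (t + 1) = 0)
    (hl : ∀ y ∈ l, IsNilpotent y) (hK : l.length < K) (u : ℕ) :
    (1 + x) * defect K q t (x :: l) u =
      (1 + x ^ 2) * defect K q t (l ++ [x * q]) u +
        x * (defect K q t (l ++ [x * q]) ((u : ℤ) - 1).natAbs +
          defect K q t (l ++ [x * q]) (u + 1)) -
        x * (esym (K + 1 - u) l + x * esym (K - u) l) * defect K q t (l ++ [x * q]) K := by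
  have hqn : IsNilpotent q := ⟨_, hq⟩
  -- Rotation puts `x * q` behind the distinguished letter `q`; symmetry restores `q` to the last
  -- place.
  have hsw : ∀ v, extTotal K 1 q t (l ++ [q] ++ [x * q]) v =
      extTotal K 1 q t (l ++ [x * q] ++ [q]) v := fun v => by
    have := extTotal_one_swap (m := []) hq (t + 1) (a := q) (b := x * q) (by rw [hq, mul_zero])
      (by rw [hq, mul_zero]) hqn ((Commute.all x q).isNilpotent_mul_left hqn) hl (by simp)
      (K := K) (by simp only [List.length_nil]; omega) v
    simpa using this
  have hF := extTotal_cons (K := K) (n := 2) (Or.inr rfl) (x := x) (xs := l) hK.le (fun _ => hK) hq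
    (u := u) (by omega)
  have hG : ∀ v : ℤ, 0 ≤ v → _ := fun v hv =>
    extTotal_cons (K := K) (n := 1) (Or.inl rfl) (x := x) (xs := l ++ [q])
      (by simp only [List.length_append, List.length_singleton]; omega) (by simp) hq hv
  simp only [hsw, esym_append_singleton] at hG
  have hGu := hG u (by omega)
  have hGK := hG K (by omega)
  have z1 : ∀ l : List R, extTotal K 1 q t l (K + 1) = 0 := fun l => extTotal_of_gt (by omega)
  have en : esym (-1) l = 0 := esym_eq_zero (Or.inl (by omega))
  have i7 : (K : ℤ) + 1 - K = 1 := by ring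
  have i8 : (K : ℤ) - K = 0 := by ring
  have j4 : (1 : ℤ) - 1 = 0 := by ring
  have j5 : (0 : ℤ) - 1 = -1 := by ring
  simp only [i7, i8, j4, j5, en, esym_zero, z1] at hGK
  generalize hP : (∏ i ∈ Finset.range (t + 1), (1 + q ^ (i + 1))) = P
  rcases Nat.eq_zero_or_pos u with rfl | hu
  · have hm : ∀ l : List R, extTotal K 1 q t l (-1) = extTotal K 1 q t l 0 := fun l => by
      rw [← extTotal_one_neg]; rfl
    have hm2 : ∀ l : List R, extTotal K 2 q t l (-1) = extTotal K 2 q t l 1 := fun l => by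
      rw [← extTotal_two_neg]; rfl
    have e0 : esym (K : ℤ) l = 0 := esym_eq_zero (Or.inr (by omega))
    have e1 : esym ((K : ℤ) + 1) l = 0 := esym_eq_zero (Or.inr (by omega))
    have i1 : (K : ℤ) + 1 - 1 = K := by ring
    simp only [defect, hP, List.cons_append, esym_cons, esym_append_singleton, Nat.cast_zero,
      sub_zero, Int.natAbs_neg, Int.natAbs_one, Nat.cast_one, sub_self,
      i1, i7, j5, esym_zero, e0, e1, hm, hm2, zero_add] at hF hGu ⊢
    linear_combination 2 * P * hF - 2 * hGu
  · have hGu' := hG (u - 1) (by omega)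
    have hn : (((u : ℤ) - 1).natAbs : ℤ) = u - 1 := by omega
    obtain ⟨w, hw⟩ : ∃ w : ℤ, (u : ℤ) = K - w := ⟨K - u, by ring⟩
    rw [hw] at hn
    have i1 : (K : ℤ) + 1 - (K - w) = w + 1 := by ring
    have i2 : (K : ℤ) - (K - w) = w := by ring
    have i3 : (K : ℤ) + 1 - (K - w - 1) = w + 2 := by ring
    have i4 : (K : ℤ) - (K - w - 1) = w + 1 := by ring
    have i5 : (K : ℤ) + 1 - (K - w + 1) = w := by ring
    have i6 : (K : ℤ) - (K - w + 1) = w - 1 := by ring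
    have j1 : w + 1 - 1 = w := by ring
    have j2 : w + 2 - 1 = w + 1 := by ring
    have j6 : (K : ℤ) - w - 1 + 1 = K - w := by ring
    have j7 : (K : ℤ) - w + 1 - 1 = K - w := by ring
    simp only [defect, hP, hn, List.cons_append, esym_cons, esym_append_singleton, Nat.cast_add,
      Nat.cast_one, hw, i1, i2, i3, i4, i5, i7, j1, j2, j4, j6, j7, esym_zero]
      at hF hGu hGu' ⊢
    linear_combination 2 * P * hF - hGu - hGu' + (esym (w + 1) l + x * esym w l) * hGK

/-! ### Evaluation at the letter `-q` -/

theorem bitSum_const (xs : List R) (c : R) :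
    bitSum xs (fun _ => c) = c * (xs.map fun x => 1 + x).prod := by
  induction xs with
  | nil => simp [bitSum]
  | cons x xs ih => rw [bitSum, ih, List.map_cons, List.prod_cons]; ring

/-- An additional last letter of weight `-Q * q` cancels the plain parts. -/
theorem topSum_neg_one {K n : ℕ} {q : R} {t : ℕ} {Q : R} {xs : List R}
    (hz : ∀ s ≤ xs.length, ∀ b : ZMod n, Fits K n s b) (hq : Q * q ^ (t + 1) = 0)
    {A : List Bool} (hA : A.length = xs.length) {h : ℕ} (hh : h + ones A ≤ K) :
    topSum K n q (-1) t Q xs A h 0 =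
      ∏ i ∈ Finset.range t, (xs.map fun y => 1 + y * q ^ (i + 1)).prod := by
  have hxs : xs.length ≤ K := (hz _ le_rfl 0).le
  induction t generalizing Q xs A h with
  | zero =>
    have e : ∀ h, h + ones A ≤ K → topSum K n q (-1) 0 Q xs A h 0 = 1 := by
      intro h hh
      have : (-1 : R) * Q * q = 0 := by
        rw [mul_assoc, show Q * q = 0 by simpa using hq, mul_zero]
      rw [topSum, this, zero_mul, add_zero, layerSum, ones_append_singleton]
      exact if_pos (hh.lt_or_eq.elim (fun h => Or.inl (by simpa using h))
        fun h => Or.inr ⟨by simpa using h, rfl⟩)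
    rw [e h hh]
    simp
  | succ t ih =>
    -- For `x = -1` the factor `1 + x` in `highSum_eq` vanishes, so neighbouring heights give equal
    -- sums. The height can thus be raised until the layer is full, after which the next layer is
    -- free.
    have step : ∀ d, h + d + ones A ≤ K → topSum K n q (-1) (t + 1) Q xs A h 0 =
        topSum K n q (-1) (t + 1) Q xs A (h + d) 0 := by
      intro d
      induction d with
      | zero => intro _; rfl
      | succ d ihd =>
        intro hd
        have h1 := (highSum_eq (x := -1) hz hq hA).1 (h + (d + 1)) 0 (by omega)
          (hd.lt_or_eq.elim Fits.of_lt fun h => Or.inr ⟨h, rfl⟩)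
        rw [add_neg_cancel, zero_mul, highSum, if_pos (by omega)] at h1
        rw [ihd (by omega), show h + d = h + (d + 1) - 1 by omega]
        linear_combination -h1
    rw [step (K - ones A - h) (by omega), topSum_full hA (by omega) hxs]
    simp only
    rw [bitSum_append_singleton, bitSum_congr (ψ := fun _ =>
      ∏ i ∈ Finset.range t, ((xs.map (q * ·)).map fun y => 1 + y * q ^ (i + 1)).prod),
      bitSum_const, Finset.prod_range_succ']
    · congr 1
      · refine Finset.prod_congr rfl fun i _ => ?_
        rw [List.map_map]
        congr 2
        funext y
        simp only [Function.comp_apply]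
        ring
      · rw [List.map_map]
        congr 2
        funext y
        simp only [Function.comp_apply]
        ring
    · intro A' hA'
      have hl := ones_le_length A'
      have hA'' : A'.length = xs.length := by simpa using hA'
      exact ih (xs := xs.map (q * ·)) (by simpa using hz) (by rw [← hq]; ring) hA'
        (by omega) (by simpa using hxs)

/-- Here `-q` is the added last letter over the empty alphabet, so the product of `topSum_neg_one`
has only empty factors. -/
theorem extTotal_two_neg_q {K : ℕ} {q : R} {t : ℕ} (hK : 0 < K) (hq : q ^ (t + 1) = 0) {u : ℕ}
    (hu : u ≤ K) : extTotal K 2 q t [-q] u = 1 := by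
  have h := total_append_singleton K 2 q (-1) t [] u 0
  have e := topSum_neg_one (K := K) (n := 2) (q := q) (t := t) (Q := 1) (xs := []) (A := [])
    (h := u) (fun s hs b => Fits.of_lt (by rw [List.length_nil] at hs; omega))
    (by rw [one_mul, hq]) rfl (by simpa [ones] using hu)
  rw [bitSum, e] at h
  rw [extTotal_natCast]
  simpa using h

/-- Here `-q` is the added last letter over the alphabet `[q]`. The letter `q` itself fits into the
lowest layer only if `u < K`, which accounts for the factor `1 + q`. -/
theorem extTotal_one_q_neg_q {K : ℕ} {q : R} {t : ℕ} (hK : 0 < K) (hq : q ^ (t + 1) = 0) {u : ℕ}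
    (hu : u ≤ K) : extTotal K 1 q t [q, -q] u =
      (if u < K then 1 + q else 1) * ∏ i ∈ Finset.range t, (1 + q ^ (i + 2)) := by
  have h := total_append_singleton K 1 q (-1) t [q] u 0
  have hz : ∀ s ≤ [q].length, ∀ b : ZMod 1, Fits K 1 s b := by
    intro s hs b
    simp only [List.length_singleton] at hs
    rcases lt_or_eq_of_le (show s ≤ K by omega) with h | h
    · exact Or.inl h
    · exact Or.inr ⟨h, Subsingleton.elim _ _⟩
  have e : (∏ i ∈ Finset.range t, ([q].map fun y => 1 + y * q ^ (i + 1)).prod) =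
      ∏ i ∈ Finset.range t, (1 + q ^ (i + 2)) :=
    Finset.prod_congr rfl fun i _ => by
      simp only [List.map_cons, List.map_nil, List.prod_singleton]; ring
  rw [bitSum, bitSum, bitSum, topSum_neg_one hz (by rw [one_mul, hq]) rfl
    (by simpa [ones] using hu), e] at h
  rw [extTotal_natCast]
  have h' : [q] ++ [-1 * q] = [q, -q] := by simp
  rw [h'] at h
  rw [h]
  split_ifs with hu'
  · rw [topSum_neg_one hz (by rw [one_mul, hq]) rfl (by simp [ones]; omega), e]
    ring
  · rw [topSum, layerSum_eq_zero, layerSum_eq_zero]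
    · ring
    · exact fun h => absurd h.le (by simp [ones]; omega)
    · exact fun h => absurd h.le (by simp [ones]; omega)

/-- Symmetry turns the alphabet `-q, q` into `q, -q`, where everything is explicit. The `esym` term
matters only at `u = K`, where it contributes the missing multiple of `q`, and at `u = K + 1`, where
it cancels the value at `K`. -/
theorem defect_neg_q {K : ℕ} {q : R} {t : ℕ} (hK : 0 < K) (hq : q ^ (t + 1) = 0) (u : ℕ) :
    defect K q t [-q] u = 0 := by
  have hqn : IsNilpotent q := ⟨_, hq⟩
  have hsw : ∀ v, extTotal K 1 q t ([-q] ++ [q]) v = extTotal K 1 q t [q, -q] v := fun v =>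
    extTotal_one_swap (l := []) (m := []) hq (t + 1) (a := -q) (b := q)
      (by rw [neg_mul, ← pow_succ', pow_succ, hq, zero_mul, neg_zero])
      (by rw [hq, mul_zero]) hqn.neg hqn (by simp) (by simp)
      (by simp only [List.length_nil]; omega) v
  have hP : ∏ i ∈ Finset.range (t + 1), (1 + q ^ (i + 1)) =
      (1 + q) * ∏ i ∈ Finset.range t, (1 + q ^ (i + 2)) := by
    rw [Finset.prod_range_succ', mul_comm]
    simp [add_assoc]
  rw [defect, hP]
  simp only [hsw]
  have hKK := extTotal_one_q_neg_q hK hq le_rfl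
  rw [if_neg (lt_irrefl K)] at hKK
  rcases Nat.lt_trichotomy u K with hu | rfl | hu
  · have h1 : extTotal K 1 q t [q, -q] ((u : ℤ) - 1) =
        (1 + q) * ∏ i ∈ Finset.range t, (1 + q ^ (i + 2)) := by
      rcases Nat.eq_zero_or_pos u with rfl | hu'
      · rw [Nat.cast_zero, zero_sub, show (-1 : ℤ) = -1 - 0 by ring, extTotal_one_neg,
          show (0 : ℤ) = ((0 : ℕ) : ℤ) by rfl, extTotal_one_q_neg_q hK hq hu.le, if_pos hu]
      · rw [show (u : ℤ) - 1 = ((u - 1 : ℕ) : ℤ) by omega,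
          extTotal_one_q_neg_q hK hq (by omega), if_pos (by omega)]
    rw [extTotal_two_neg_q hK hq hu.le, extTotal_one_q_neg_q hK hq hu.le, if_pos hu, h1,
      esym_eq_zero (Or.inr (by simp only [List.length_singleton]; omega))]
    ring
  · rw [extTotal_two_neg_q hK hq le_rfl, hKK, show (u : ℤ) - 1 = ((u - 1 : ℕ) : ℤ) by omega,
      extTotal_one_q_neg_q hK hq (by omega), if_pos (by omega), show (u : ℤ) + 1 - u = 1 by ring,
      esym_cons, esym_nil, esym_nil]
    simp only [one_ne_zero, if_false, sub_self, if_true]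
    ring
  · rw [extTotal_of_gt (by omega), extTotal_of_gt (u := (u : ℤ)) (by omega)]
    rcases eq_or_ne u (K + 1) with rfl | hu'
    · rw [show ((K + 1 : ℕ) : ℤ) - 1 = K by push_cast; ring,
        show (K : ℤ) + 1 - ((K + 1 : ℕ) : ℤ) = 0 by push_cast; ring, esym_zero]
      ring
    · rw [extTotal_of_gt (by omega), esym_eq_zero (Or.inl (by omega))]
      ring

/-- The recurrence read backwards: if the defect of `[x]` vanishes, each defect of `[x * q]` is `x`
times a combination of such defects. It is therefore divisible by every power of the nilpotent `x`.
-/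
theorem defect_mul_q {K : ℕ} {q x : R} {t : ℕ} (hK : 0 < K) (hq : q ^ (t + 1) = 0)
    (hx : IsNilpotent x) (h : ∀ u, defect K q t [x] u = 0) (u : ℕ) :
    defect K q t [x * q] u = 0 := by
  have key : ∀ (m : ℕ) (u : ℕ), x ^ m ∣ defect K q t [x * q] u := by
    intro m
    induction m with
    | zero => intro u; simp
    | succ m ih =>
      intro u
      have h1 := defect_cons (x := x) (l := []) hq (by simp) hK u
      simp only [h, mul_zero, List.nil_append] at h1
      have h2 : defect K q t [x * q] u = x * (
          (esym (K + 1 - u) [] + x * esym (K - u) []) * defect K q t [x * q] K -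
          x * defect K q t [x * q] u -
          (defect K q t [x * q] ((u : ℤ) - 1).natAbs + defect K q t [x * q] (u + 1))) := by
        linear_combination -h1
      rw [h2, pow_succ']
      exact mul_dvd_mul_left x (dvd_sub (dvd_sub ((ih K).mul_left _) ((ih u).mul_left _))
        (dvd_add (ih _) (ih _)))
  obtain ⟨m, hm⟩ := hx
  have := key m u
  rwa [hm, zero_dvd_iff] at this

theorem defect_nil {K : ℕ} {q : R} {t : ℕ} (hK : 0 < K) (hq : q ^ (t + 1) = 0) (u : ℕ) :
    defect K q t [] u = 0 := by
  have hqn : IsNilpotent q := ⟨_, hq⟩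
  have h : ∀ i u, defect K q t [-q * q ^ i] u = 0 := by
    intro i
    induction i with
    | zero => simpa using defect_neg_q hK hq
    | succ i ih =>
      intro u
      rw [pow_succ, ← mul_assoc]
      exact defect_mul_q hK hq ((Commute.all _ _).isNilpotent_mul_right hqn.neg) ih u
  -- Since `q ^ (t + 1) = 0` the letter has become zero, and erasing it leaves the empty alphabet.
  have h0 := h (t + 1) u
  rw [hq, mul_zero] at h0
  simpa only [defect, List.cons_append, List.nil_append, extTotal_cons_zero, esym_cons, zero_mul,
    add_zero] using h0

theorem defect_replicate_zero {K : ℕ} {q : R} {t : ℕ} (l u : ℕ) :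
    defect K q t (List.replicate l 0) u = defect K q t [] u := by
  induction l with
  | zero => rfl
  | succ l ih =>
    rw [← ih, List.replicate_succ]
    simp only [defect, List.cons_append, extTotal_cons_zero, esym_cons, zero_mul, add_zero]

/-- Each letter of `l` in turn goes to the end with an additional factor `q`; the recurrence carries
vanishing back because `1 + x` is a unit. -/
theorem defect_rotate {K : ℕ} {q : R} {t : ℕ} (hq : q ^ (t + 1) = 0) {l m : List R}
    (hl : ∀ y ∈ l, IsNilpotent y) (hm : ∀ y ∈ m, IsNilpotent y) (hK : l.length + m.length ≤ K)
    (h : ∀ u, defect K q t (m ++ l.map (· * q)) u = 0) (u : ℕ) :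
    defect K q t (l ++ m) u = 0 := by
  induction l generalizing m u with
  | nil => simpa using h u
  | cons x l ih =>
    have hx : IsNilpotent x := hl x (by simp)
    have hl' : ∀ y ∈ l, IsNilpotent y := fun y hy => hl y (by simp [hy])
    simp only [List.length_cons] at hK
    have h1 : ∀ u, defect K q t (l ++ (m ++ [x * q])) u = 0 := by
      refine ih (m := m ++ [x * q]) hl' ?_ ?_ ?_
      · intro y hy
        rcases List.mem_append.1 hy with hy | hy
        · exact hm y hy
        · rw [List.mem_singleton.1 hy]
          exact (Commute.all x q).isNilpotent_mul_right hx
      · rw [List.length_append, List.length_singleton]; omega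
      · simpa using h
    have hlen : (l ++ m).length < K := by rw [List.length_append]; omega
    have h2 := defect_cons (x := x) (l := l ++ m) hq (by
      intro y hy
      rcases List.mem_append.1 hy with hy | hy
      · exact hl' y hy
      · exact hm y hy) hlen u
    rw [List.append_assoc, h1, h1, h1, h1] at h2
    rw [← hx.isUnit_one_add.mul_right_eq_zero, List.cons_append, h2]
    ring

/-- After `t + 1` full rotations every letter carries the factor `q ^ (t + 1) = 0`, and only the
empty alphabet remains. -/
theorem defect_eq_zero {K : ℕ} {q : R} {t : ℕ} (hK : 0 < K) (hq : q ^ (t + 1) = 0) {l : List R}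
    (hl : ∀ y ∈ l, IsNilpotent y) (hlK : l.length ≤ K) (u : ℕ) : defect K q t l u = 0 := by
  have h : ∀ i, ∀ l : List R, (∀ y ∈ l, IsNilpotent y) → l.length ≤ K →
      (∀ u, defect K q t (l.map (· * q ^ i)) u = 0) → ∀ u, defect K q t l u = 0 := by
    intro i
    induction i with
    | zero => intro l _ _ h; simpa using h
    | succ i ih =>
      intro l hl hlK h u
      have := defect_rotate hq hl (m := []) (by simp) (by simpa using hlK) (by
        refine ih _ ?_ (by simpa using hlK) ?_
        · intro y hy
          simp only [List.nil_append, List.mem_map] at hy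
          obtain ⟨z, hz, rfl⟩ := hy
          exact (Commute.all z q).isNilpotent_mul_right (hl z hz)
        · intro u
          rw [← h u, List.nil_append, List.map_map]
          congr 2
          funext z
          simp only [Function.comp_apply]
          ring) u
      simpa using this
  refine h (t + 1) l hl hlK (fun u => ?_) u
  rw [hq]
  simp only [mul_zero, List.map_const']
  rw [defect_replicate_zero, defect_nil hK hq]

/-- The identity between the generating functions of the moduli `1` and `2`. -/
theorem two_mul_lowTotal_one {K : ℕ} {q : R} {t : ℕ} (hK : 0 < K) (hq : q ^ (t + 1) = 0)
    {xs : List R} (hxs : ∀ y ∈ xs, IsNilpotent y) (hl : xs.length ≤ K) (u : ℕ) :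
    2 * lowTotal K 1 q 1 t xs u 0 =
      2 * ((∏ i ∈ Finset.range (t + 1), (1 + q ^ (i + 1))) * total K 2 q t xs u 0) := by
  have hz : ∀ s ≤ xs.length, ∀ b : ZMod 1, Fits K 1 s b := fun s hs b =>
    (hs.trans hl).lt_or_eq.elim Fits.of_lt fun h => Or.inr ⟨h, Subsingleton.elim _ _⟩
  have hd := defect_eq_zero hK hq hxs hl u
  rw [defect, extTotal_natCast, extTotal_natCast, extTotal_natCast] at hd
  rcases Nat.eq_zero_or_pos u with rfl | hu
  · have h := lowTotal_zero (x := (1 : R)) hz hq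
    rw [one_mul, one_mul, ← extTotal_neg_one (Or.inl rfl)] at h
    rw [esym_eq_zero (Or.inr (by push_cast; omega))] at hd
    simp only [Nat.cast_zero, zero_sub] at hd
    linear_combination h - hd
  · have h := lowTotal_pos (x := (1 : R)) hl hz hq hu
    rw [show (u : ℤ) - 1 = ((u - 1 : ℕ) : ℤ) by omega, extTotal_natCast] at hd
    rw [one_mul, one_mul, one_mul] at h
    linear_combination h - hd

/-! ### Transfer to power series modulo a power of `X` -/

section Map

variable {S : Type*} [CommRing S]

theorem map_bitSum (φ : R →+* S) (xs : List R) (g : List Bool → R) :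
    φ (bitSum xs g) = bitSum (xs.map φ) fun A => φ (g A) := by
  induction xs generalizing g with
  | nil => rfl
  | cons x xs ih => simp only [bitSum, List.map_cons, map_add, map_mul, ih]

theorem map_layerSum (φ : R →+* S) (K n : ℕ) (q : R) (t : ℕ) (Q : R) (xs : List R) (A : List Bool)
    (f : ℕ) (b : ZMod n) :
    φ (layerSum K n q t Q xs A f b) = layerSum K n (φ q) t (φ Q) (xs.map φ) A f b := by
  induction t generalizing Q xs A f b with
  | zero => rw [layerSum, layerSum]; split_ifs <;> simp
  | succ t ih =>
    rw [layerSum, layerSum, map_sum]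
    refine Finset.sum_congr rfl fun f' _ => ?_
    rw [map_mul, map_pow, map_mul, map_bitSum, List.map_map, List.map_map,
      show φ ∘ (q * ·) = (φ q * ·) ∘ φ by funext y; simp]
    congr 2
    funext A'
    unfold gate
    split_ifs
    · rw [ih, map_mul, List.map_map, show φ ∘ (q * ·) = (φ q * ·) ∘ φ by funext y; simp]
    · exact map_zero φ

end Map

/-- The generating function of all layers, where the letters have weight `x` and `xs`, and
the letter of weight `x` does not occur in the lowest layer. -/
def baseTotal (K n : ℕ) (q : R) (t : ℕ) (x : R) (xs : List R) (u : ℕ) : R :=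
  bitSum xs fun A => layerSum K n q t 1 (x :: xs) (false :: A) u 0

theorem baseTotal_eq_lowTotal (K n : ℕ) (q : R) (t : ℕ) (x : R) (xs : List R) (u : ℕ) :
    baseTotal K n q t x xs u = lowTotal K n q x t xs u 0 := by
  refine bitSum_congr fun A hA => ?_
  have := layerSum_cons K n q x t 1 xs false A u (0 : ZMod n) hA
  simpa using this

theorem baseTotal_zero (K n : ℕ) (q : R) (t : ℕ) (xs : List R) (u : ℕ) :
    baseTotal K n q t 0 xs u = total K n q t xs u 0 := by
  rw [baseTotal_eq_lowTotal]
  exact bitSum_congr fun A _ => lowSum_zero ..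

/-- In the quotient by `X ^ (η (t + 1))` both `X ^ η` and all letters are nilpotent, as the
recurrences require, while the coefficients below that degree are unaffected. -/
theorem coeff_baseTotal_one {K η : ℕ} (hK : 0 < K) {αs : List ℕ} (hα : ∀ a ∈ αs, 0 < a)
    (hl : αs.length ≤ K) (t u : ℕ) {i : ℕ} (hi : i < η * (t + 1)) :
    coeff i (baseTotal K 1 (X ^ η : ℤ⟦X⟧) t 1 (αs.map (X ^ ·)) u) =
      coeff i ((∏ j ∈ Finset.range (t + 1), (1 + (X ^ η : ℤ⟦X⟧) ^ (j + 1))) *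
        baseTotal K 2 (X ^ η : ℤ⟦X⟧) t 0 (αs.map (X ^ ·)) u) := by
  set M := η * (t + 1) with hM
  let φ := Ideal.Quotient.mk (Ideal.span {(X ^ M : ℤ⟦X⟧)})
  have hφ : φ (X ^ M) = 0 := Ideal.Quotient.eq_zero_iff_mem.2 (Ideal.subset_span rfl)
  have hq : φ (X ^ η) ^ (t + 1) = 0 := by rw [← map_pow, ← pow_mul, ← hM, hφ]
  have hxs : ∀ y ∈ (αs.map fun a => (X ^ a : ℤ⟦X⟧)).map φ, IsNilpotent y := by
    intro y hy
    simp only [List.mem_map, exists_exists_and_eq_and] at hy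
    obtain ⟨a, ha, rfl⟩ := hy
    refine ⟨M, ?_⟩
    obtain ⟨c, hc⟩ := Nat.exists_eq_succ_of_ne_zero (hα a ha).ne'
    rw [← map_pow, ← pow_mul, hc, Nat.succ_mul, pow_add, map_mul, hφ, mul_zero]
  have h := two_mul_lowTotal_one hK hq hxs (by simpa using hl) u
  rw [← baseTotal_eq_lowTotal, ← baseTotal_zero] at h
  have hb : ∀ n (x : ℤ⟦X⟧), φ (baseTotal K n (X ^ η : ℤ⟦X⟧) t x (αs.map (X ^ ·)) u) =
      baseTotal K n (φ (X ^ η)) t (φ x) ((αs.map (X ^ ·)).map φ) u := by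
    intro n x
    rw [baseTotal, map_bitSum, baseTotal]
    refine bitSum_congr fun A _ => ?_
    rw [map_layerSum, map_one, List.map_cons]
  have hP : φ (∏ j ∈ Finset.range (t + 1), (1 + (X ^ η : ℤ⟦X⟧) ^ (j + 1))) =
      ∏ j ∈ Finset.range (t + 1), (1 + φ (X ^ η) ^ (j + 1)) := by simp
  have h1 := hb 1 1
  have h2 := hb 2 0
  rw [map_one] at h1
  rw [map_zero] at h2
  rw [← h1, ← h2, ← hP, ← map_mul, ← map_ofNat φ 2, ← map_mul, ← map_mul, ← sub_eq_zero, ← map_sub,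
    Ideal.Quotient.eq_zero_iff_mem, Ideal.mem_span_singleton, ← mul_sub, X_pow_dvd_iff] at h
  -- The identity in the quotient is doubled, and `2` may not be cancelled there; it is cancelled in
  -- the integer coefficients.
  have h3 := h i hi
  rw [show (2 : ℤ⟦X⟧) = C (2 : ℤ) by simp, coeff_C_mul, map_sub] at h3
  linarith

/-! ### Layer sums as weighted sums over admissible configurations -/

/-- The lists of Booleans of a given length. -/
def bits : ℕ → Finset (List Bool)
  | 0 => {[]}
  | l + 1 => (bits l).image (false :: ·) ∪ (bits l).image (true :: ·)

theorem mem_bits {l : ℕ} {A : List Bool} : A ∈ bits l ↔ A.length = l := by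
  induction l generalizing A with
  | zero => simp [bits]
  | succ l ih =>
    cases A with
    | nil => simp [bits]
    | cons a A => cases a <;> simp [bits, ih]

/-- The product of the weights of the letters of a subset. -/
def bitProd : List R → List Bool → R
  | x :: xs, a :: A => (if a then x else 1) * bitProd xs A
  | _, _ => 1

theorem bitSum_eq_sum (xs : List R) (φ : List Bool → R) :
    bitSum xs φ = ∑ A ∈ bits xs.length, bitProd xs A * φ A := by
  induction xs generalizing φ with
  | nil => simp [bitSum, bits, bitProd]
  | cons x xs ih =>
    rw [bitSum, List.length_cons, bits, Finset.sum_union, Finset.sum_image (by simp),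
      Finset.sum_image (by simp), ih, ih]
    · simp [bitProd, Finset.mul_sum, mul_assoc]
    · rw [Finset.disjoint_left]
      simp

/-- A list of layers, each given by the number of its plain parts and the subset of its letters, is
admissible after a layer with `f` plain parts and letters `A`, with parity `b`. -/
def Valid (K n : ℕ) : List Bool → ℕ → ZMod n → List (ℕ × List Bool) → Prop
  | A, f, b, [] => Fits K n (f + ones A) b
  | A, f, b, s :: c => Fits K n (f + ones A + s.1) b ∧
      Fits K n (s.1 + cross A s.2) (b + (f + ones A + s.1 : ℕ) - K) ∧
      Valid K n s.2 s.1 (b + (f + ones A + s.1 : ℕ) - K) c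

/-- The lists of `t` layers with at most `K` plain parts and with `l` letters in each layer. -/
def confs (K l : ℕ) : ℕ → Finset (List (ℕ × List Bool))
  | 0 => {[]}
  | t + 1 => ((Finset.range (K + 1) ×ˢ bits l) ×ˢ confs K l t).image fun p => p.1 :: p.2

theorem mem_confs {K l t : ℕ} {c : List (ℕ × List Bool)} :
    c ∈ confs K l t ↔ c.length = t ∧ ∀ s ∈ c, s.1 ≤ K ∧ s.2.length = l := by
  induction t generalizing c with
  | zero => simp +contextual [confs]
  | succ t ih =>
    cases c with
    | nil => simp [confs]
    | cons s c =>
      simp only [confs, Finset.mem_image, Finset.mem_product, Finset.mem_range, mem_bits, ih,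
        List.cons.injEq, List.length_cons, List.mem_cons, forall_eq_or_imp]
      constructor
      · rintro ⟨⟨s', c'⟩, ⟨⟨h1, h2⟩, h3, h4⟩, rfl, rfl⟩
        exact ⟨congrArg (· + 1) h3, ⟨Nat.lt_succ_iff.1 h1, h2⟩, h4⟩
      · rintro ⟨h1, ⟨h2, h3⟩, h4⟩
        exact ⟨⟨s, c⟩, ⟨⟨Nat.lt_succ_iff.2 h2, h3⟩, Nat.succ_injective h1, h4⟩, rfl, rfl⟩

/-- The weight of a list of layers. -/
def weight (q : R) : R → List R → List (ℕ × List Bool) → R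
  | _, _, [] => 1
  | Q, xs, s :: c => (Q * q) ^ s.1 * bitProd (xs.map (q * ·)) s.2 *
      weight q (Q * q) (xs.map (q * ·)) c

open Classical in
theorem layerSum_eq_sum (K n : ℕ) (q : R) (t : ℕ) (Q : R) (xs : List R) (A : List Bool) (f : ℕ)
    (b : ZMod n) : layerSum K n q t Q xs A f b =
      ∑ c ∈ confs K xs.length t, if Valid K n A f b c then weight q Q xs c else 0 := by
  induction t generalizing Q xs A f b with
  | zero =>
    rw [layerSum, confs, Finset.sum_singleton]
    exact if_congr Iff.rfl rfl rfl
  | succ t ih =>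
    rw [confs, Finset.sum_image, Finset.sum_product, Finset.sum_product, layerSum]
    · refine Finset.sum_congr rfl fun f' _ => ?_
      rw [bitSum_eq_sum, List.length_map, Finset.mul_sum]
      refine Finset.sum_congr rfl fun A' _ => ?_
      unfold gate
      split_ifs with h
      · rw [ih, List.length_map, Finset.mul_sum, Finset.mul_sum]
        refine Finset.sum_congr rfl fun c _ => ?_
        rw [if_congr (show Valid K n A f b ((f', A') :: c) ↔
          Valid K n A' f' (b + (f + ones A + f' : ℕ) - K) c from
          ⟨fun h' => h'.2.2, fun h' => ⟨h.1, h.2, h'⟩⟩) rfl rfl, weight]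
        split_ifs <;> ring
      · rw [mul_zero, mul_zero, Finset.sum_eq_zero]
        exact fun c _ => if_neg fun h' => h ⟨h'.1, h'.2.1⟩
    · rintro ⟨a, c⟩ _ ⟨a', c'⟩ _ h
      simpa using h

end Layered


/-! ### The order on parts and the end of a window -/

namespace OPart

theorem lt_def {p x : OPart} :
    p < x ↔ p.size < x.size ∨ (p.size = x.size ∧ (ofLex p).2 < (ofLex x).2) := Prod.Lex.lt_iff

theorem le_def {p x : OPart} :
    p ≤ x ↔ p.size < x.size ∨ (p.size = x.size ∧ (ofLex p).2 ≤ (ofLex x).2) := Prod.Lex.le_iff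

/-- The overlined part of size `m`. -/
def bar (m : ℕ) : OPart := toLex (m, true)

@[simp] theorem size_bar (m : ℕ) : (bar m).size = m := rfl

@[simp] theorem size_plain (m : ℕ) : (plain m).size = m := rfl

theorem overlined_bar (m : ℕ) : (bar m).Overlined := rfl

theorem not_overlined_plain (m : ℕ) : ¬ (plain m).Overlined := Bool.false_ne_true

theorem Overlined.eq_bar {p : OPart} (h : p.Overlined) : p = bar p.size :=
  Prod.ext rfl h

theorem eq_plain {p : OPart} (h : ¬ p.Overlined) : p = plain p.size :=
  Prod.ext rfl (Bool.eq_false_iff.2 h)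

/-- The smallest part which is not in the window of length `η` that starts at `p`. -/
def windowEnd (η : ℕ) (p : OPart) : OPart := bar (p.size + η)

theorem windowEnd_mono {η : ℕ} {p x : OPart} (h : p ≤ x) : windowEnd η p ≤ windowEnd η x := by
  rw [le_def] at h ⊢
  simp only [windowEnd, bar, size, ofLex_toLex] at h ⊢
  rcases h with h | h
  · exact Or.inl (by omega)
  · exact Or.inr ⟨by omega, le_rfl⟩

/-- The strictness clause excludes exactly the non-overlined part of size `p.size + η`, so that for
either kind of `p` the condition is the single threshold at the overlined part of that size. -/
theorem windowEnd_le_iff {η : ℕ} {p x : OPart} :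
    windowEnd η p ≤ x ↔ p.shift η ≤ x ∧ (¬ x.Overlined → p.shift η < x) := by
  rw [le_def, le_def, lt_def]
  simp only [windowEnd, bar, size, ofLex_toLex, shift, Overlined]
  rcases ofLex x with ⟨t, o'⟩
  rcases ofLex p with ⟨s, o⟩
  cases o <;> cases o' <;> simp [show ¬ (true ≤ false) by decide, show ¬ (true < false) by decide,
    show false < true by decide] <;> omega

theorem lt_windowEnd_iff {η : ℕ} {p x : OPart} :
    x < windowEnd η p ↔ x ≤ p.shift η ∧ (x.Overlined → x < p.shift η) := by
  rw [← not_le, windowEnd_le_iff, le_def, lt_def, le_def, lt_def]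
  simp only [size, ofLex_toLex, shift, Overlined]
  rcases ofLex x with ⟨t, o'⟩
  rcases ofLex p with ⟨s, o⟩
  cases o <;> cases o' <;> simp [show ¬ (true ≤ false) by decide, show ¬ (true < false) by decide,
    show false < true by decide] <;> omega

end OPart

namespace Layered

open OPart

/-! ### Difference and parity conditions as conditions on windows -/

section SortedList

variable {β : Type*} [LinearOrder β] {l : List β}

theorem filter_le_eq_take (hl : l.Pairwise (· ≥ ·)) (p : β) :
    l.filter (p ≤ ·) = l.take (l.countP (p ≤ ·)) := by
  induction l with
  | nil => rfl
  | cons x l ih =>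
    rw [List.pairwise_cons] at hl
    by_cases hx : p ≤ x
    · rw [List.filter_cons_of_pos (by simpa using hx), List.countP_cons_of_pos (by simpa using hx),
        List.take_succ_cons, ih hl.2]
    · have h : ∀ y ∈ l, ¬ p ≤ y := fun y hy h => hx (h.trans (hl.1 y hy))
      rw [List.filter_cons_of_neg (by simpa using hx), List.countP_cons_of_neg (by simpa using hx),
        List.countP_eq_zero.2 (by simpa using h), List.take_zero,
        List.filter_eq_nil_iff.2 (by simpa using h)]

theorem filter_lt_eq_drop (hl : l.Pairwise (· ≥ ·)) (p : β) :
    l.filter (· < p) = l.drop (l.countP (p ≤ ·)) := by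
  induction l with
  | nil => rfl
  | cons x l ih =>
    rw [List.pairwise_cons] at hl
    by_cases hx : p ≤ x
    · rw [List.filter_cons_of_neg (by simpa using hx), List.countP_cons_of_pos (by simpa using hx),
        List.drop_succ_cons, ih hl.2]
    · have h : ∀ y ∈ l, ¬ p ≤ y := fun y hy h => hx (h.trans (hl.1 y hy))
      rw [List.countP_cons_of_neg (by simpa using hx),
        List.countP_eq_zero.2 (by simpa using h), List.drop_zero, List.filter_eq_self.2]
      intro y hy
      rcases List.mem_cons.1 hy with rfl | hy
      · simpa using hx
      · simpa using h y hy

theorem getElem_le_getElem (hl : l.Pairwise (· ≥ ·)) {i j : ℕ} (hij : i ≤ j) (hj : j < l.length) :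
    l[j] ≤ l[i]'(hij.trans_lt hj) := by
  rcases hij.eq_or_lt with rfl | h
  · exact le_rfl
  · exact List.pairwise_iff_getElem.1 hl i j _ hj h

theorem mem_take_drop (hl : l.Pairwise (· ≥ ·)) {i m : ℕ} (hm : i + m < l.length) {x : β}
    (hx : x ∈ (l.drop i).take (m + 1)) : l[i + m] ≤ x ∧ x ≤ l[i] := by
  obtain ⟨a, ha, rfl⟩ := List.mem_iff_getElem.1 hx
  rw [List.length_take, List.length_drop] at ha
  rw [List.getElem_take, List.getElem_drop]
  exact ⟨getElem_le_getElem hl (by omega) _, getElem_le_getElem hl (by omega) _⟩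

end SortedList

/-- The part `x` belongs to the window of length `η` that starts at `s`. -/
def InWindow (η : ℕ) (s x : OPart) : Prop := s ≤ x ∧ x < windowEnd η s

instance (η : ℕ) (s x : OPart) : Decidable (InWindow η s x) := inferInstanceAs (Decidable (_ ∧ _))

/-- The window that starts at `s` has at most `K` parts, and if it has `K` parts then it satisfies
the parity condition. -/
def WindowCond (j K η r : ℕ) (π : Multiset OPart) (s : OPart) : Prop :=
  π.countP (InWindow η s) ≤ K ∧ (π.countP (InWindow η s) = K →
    (((π.filter (InWindow η s)).map fun x => x.size / η).sum : ℤ) ≡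
      (r : ℤ) - 1 + (π.countP fun x => x < windowEnd η s ∧ x.Overlined : ℕ) [ZMOD 2 - (j : ℤ)])

theorem filter_inWindow {l : List OPart} (hl : l.Pairwise (· ≥ ·)) (η : ℕ) (s : OPart) :
    l.filter (InWindow η s) =
      (l.drop (l.countP (windowEnd η s ≤ ·))).take (l.countP (InWindow η s)) := by
  have h1 : l.filter (InWindow η s) = (l.filter (· < windowEnd η s)).filter (s ≤ ·) := by
    rw [List.filter_filter]
    exact List.filter_congr fun x _ => Bool.decide_and _ _
  rw [List.countP_eq_length_filter, h1, filter_lt_eq_drop hl, filter_le_eq_take]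
  · rw [List.length_take, min_eq_left List.countP_le_length]
  · exact hl.sublist (List.drop_sublist _ _)

variable {j l K η r : ℕ} {α : Fin l → ℕ} {L : List OPart}

/-- The parts in a window are consecutive in the sorted list. A surplus would violate the difference
condition at both ends of a block of `K + 1` parts. In a full window the largest part is the last
one before the end of the window, so the two counts of overlined parts agree. -/
theorem windowCond_of_isOverB (hK : 0 < K) (hL : L.Pairwise (· ≥ ·))
    (h : IsOverB j α η (K + 1) r L) (s : OPart) : WindowCond j K η r L s := by
  have hw := filter_inWindow hL η s
  have hlen : (L.filter (InWindow η s)).length = L.countP (InWindow η s) :=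
    List.countP_eq_length_filter.symm
  set W := L.countP (InWindow η s) with hW
  set a := L.countP (windowEnd η s ≤ ·) with ha
  have hlen' := hlen
  rw [hw, List.length_take, List.length_drop] at hlen'
  have hmem : ∀ i, i < W → ∃ h : a + i < L.length, InWindow η s L[a + i] := by
    intro i hi
    have hi' : a + i < L.length := by omega
    refine ⟨hi', ?_⟩
    have : L[a + i] ∈ L.filter (InWindow η s) := by
      rw [hw]
      refine List.mem_iff_getElem.2 ⟨i, by rw [List.length_take, List.length_drop]; omega, ?_⟩
      rw [List.getElem_take, List.getElem_drop]
    simpa using (List.mem_filter.1 this).2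
  rw [WindowCond, Multiset.coe_countP, Multiset.filter_coe, Multiset.map_coe, Multiset.sum_coe,
    Multiset.coe_countP]
  constructor
  · by_contra hc
    change ¬ W ≤ K at hc
    obtain ⟨h0, h0'⟩ := hmem 0 (by omega)
    obtain ⟨h1, h1'⟩ := hmem K (by omega)
    have h2 := windowEnd_le_iff.2 (h.diff a h1)
    exact absurd (h0'.2.trans_le (windowEnd_mono h1'.1)) (not_lt.2 h2)
  · intro hc
    change W = K at hc
    obtain ⟨h0, h0'⟩ := hmem 0 (by omega)
    obtain ⟨h1, h1'⟩ := hmem (K - 1) (by omega)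
    have hlt := lt_windowEnd_iff.1 (h0'.2.trans_le (windowEnd_mono h1'.1))
    have h2 := h.parity a h1 hlt.1 (hlt.2)
    rw [hw, hc]
    refine h2.trans ?_
    rw [List.countP_congr]
    intro x hx
    have : x ≤ L[a] ↔ x < windowEnd η s := by
      refine ⟨fun h => h.trans_lt h0'.2, fun h => ?_⟩
      have hx' : x ∈ L.filter (· < windowEnd η s) := List.mem_filter.2 ⟨hx, by simpa using h⟩
      rw [filter_lt_eq_drop hL] at hx'
      obtain ⟨i, hi, rfl⟩ := List.mem_iff_getElem.1 hx'
      rw [List.getElem_drop]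
      exact getElem_le_getElem hL (by omega) _
    simp [this]

/-- Windows starting at parts suffice: a block of consecutive parts that is too short in size lies
in the window starting at its smallest member. With `K` parts it exhausts that window, and the
parity condition transfers. -/
theorem isOverB_of_windowCond (hK : 0 < K) (hL : L.Pairwise (· ≥ ·))
    (hcongr : ∀ p ∈ L, p.size ≡ 0 [MOD η] ∨ ∃ i, p.size ≡ α i [MOD η])
    (hnon : ∀ p ∈ L, ¬ p.Overlined → η ∣ p.size)
    (hsmall : (L.countP (fun p => p ≤ plain η) : ℤ) ≤ (r : ℤ) - 1)
    (h : ∀ s ∈ L, WindowCond j K η r L s) : IsOverB j α η (K + 1) r L := by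
  have key : ∀ i m, ∀ hm : i + m < L.length, L[i] < windowEnd η L[i + m] →
      ((L.drop i).take (m + 1)).Sublist (L.filter (InWindow η L[i + m])) := by
    intro i m hm hlt
    have h1 : ((L.drop i).take (m + 1)).Sublist L :=
      (List.take_sublist _ _).trans (List.drop_sublist _ _)
    have h2 := h1.filter (fun x => decide (InWindow η L[i + m] x))
    rwa [List.filter_eq_self.2] at h2
    intro x hx
    obtain ⟨h3, h4⟩ := mem_take_drop hL hm hx
    simpa using ⟨h3, h4.trans_lt hlt⟩
  have hlen : ∀ i m, i + m < L.length → ((L.drop i).take (m + 1)).length = m + 1 := by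
    intro i m hm
    rw [List.length_take, List.length_drop]; omega
  refine ⟨hcongr, hnon, fun i hi => ?_, hsmall, fun i hi h1 h2 => ?_⟩
  · rw [← windowEnd_le_iff]
    by_contra hc
    have h1 := (key i K hi (not_le.1 hc)).length_le
    have h2 := (h _ (List.getElem_mem hi)).1
    rw [Multiset.coe_countP, List.countP_eq_length_filter] at h2
    rw [hlen i K hi] at h1
    exact absurd (h1.trans h2) (by omega)
  · obtain ⟨m, rfl⟩ : ∃ m, K = m + 1 := ⟨K - 1, by omega⟩
    change i + m < L.length at hi
    have hlt : L[i] < windowEnd η L[i + m] := lt_windowEnd_iff.2 ⟨h1, h2⟩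
    have hk := key i m hi hlt
    obtain ⟨h3, h4⟩ := h _ (List.getElem_mem hi)
    rw [Multiset.coe_countP, List.countP_eq_length_filter] at h3 h4
    have h5 : (L.filter (InWindow η L[i + m])).length = m + 1 :=
      le_antisymm h3 (by rw [← hlen i m hi]; exact hk.length_le)
    have h6 := hk.eq_of_length (by rw [hlen i m hi, h5])
    have h7 := h4 h5
    rw [Multiset.filter_coe, Multiset.map_coe, Multiset.sum_coe, Multiset.coe_countP, ← h6] at h7
    refine h7.trans ?_
    rw [List.countP_congr]
    intro x hx
    have : x ≤ L[i] ↔ x < windowEnd η L[i + m] := by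
      refine ⟨fun h => h.trans_lt hlt, fun h => ?_⟩
      rcases le_or_gt L[i + m] x with h' | h'
      · have hx' : x ∈ L.filter (InWindow η L[i + m]) :=
          List.mem_filter.2 ⟨hx, by simpa using ⟨h', h⟩⟩
        rw [← h6] at hx'
        exact (mem_take_drop hL hi hx').2
      · exact h'.le.trans (getElem_le_getElem hL (by omega) _)
    simp [this]


theorem add_mul_inj {η a a' m m' : ℕ} (ha : a < η) (ha' : a' < η) (h : a + η * m = a' + η * m') :
    m = m' ∧ a = a' := by
  have h1 := congrArg (· / η) h
  have h0 : 0 < η := by omega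
  simp only [Nat.add_mul_div_left _ _ h0, Nat.div_eq_of_lt ha, Nat.div_eq_of_lt ha',
    zero_add] at h1
  exact ⟨h1, by rw [h1] at h; omega⟩

/-! ### Decomposition of a multiset of parts into layers -/

/-- Every plain part of `π` is a multiple of `η`, every overlined part has a residue in `αs` and
occurs only once, and all parts are less than `η * t`. -/
structure IsLayered (η : ℕ) (αs : List ℕ) (t : ℕ) (π : Multiset OPart) : Prop where
  plain : ∀ p ∈ π, ¬ p.Overlined → ∃ m < t, p = OPart.plain (η * m)
  bar : ∀ p ∈ π, p.Overlined → ∃ m < t, ∃ a ∈ αs, p = OPart.bar (a + η * m)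
  once : ∀ p ∈ π, p.Overlined → π.count p = 1

/-- The number of plain parts in a layer. -/
def plains (η : ℕ) (π : Multiset OPart) (m : ℕ) : ℕ := π.count (plain (η * m))

/-- The set of letters in a layer. -/
def letters (η : ℕ) (αs : List ℕ) (π : Multiset OPart) (m : ℕ) : List Bool :=
  αs.map fun a => decide (bar (a + η * m) ∈ π)

variable {η : ℕ} {αs : List ℕ} {t : ℕ} {π : Multiset OPart} {M : Type*} [AddCommMonoid M]

theorem sum_map_eq_sum_count (hlt : ∀ a ∈ αs, a < η) (hη : 0 < η)
    (hplain : ∀ p ∈ π, ¬ p.Overlined → ∃ m < t, p = plain (η * m))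
    (hbar : ∀ p ∈ π, p.Overlined → ∃ m < t, ∃ a ∈ αs, p = bar (a + η * m)) (w : OPart → M) :
    (π.map w).sum = ∑ m ∈ Finset.range t, (π.count (plain (η * m)) • w (plain (η * m)) +
      ∑ a ∈ αs.toFinset, π.count (bar (a + η * m)) • w (bar (a + η * m))) := by
  induction π using Multiset.induction with
  | empty => simp
  | cons p π ih =>
    rw [Multiset.map_cons, Multiset.sum_cons, ih (fun p hp => hplain p (by simp [hp]))
      (fun p hp => hbar p (by simp [hp]))]
    simp only [Multiset.count_cons, add_smul, Finset.sum_add_distrib, ite_smul, one_smul, zero_smul]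
    rw [add_add_add_comm, add_comm]
    congr 1
    by_cases hp : p.Overlined
    · obtain ⟨m, hm, a, ha, rfl⟩ := hbar p (by simp) hp
      rw [Finset.sum_eq_zero, zero_add, Finset.sum_eq_single m, Finset.sum_eq_single a, if_pos rfl]
      · intro a' _ hne
        rw [if_neg]
        intro h
        have := congrArg OPart.size h
        simp only [size_bar] at this
        omega
      · intro h
        exact absurd (List.mem_toFinset.2 ha) h
      · intro m' _ hne
        refine Finset.sum_eq_zero fun a' ha' => if_neg fun h => hne ?_
        have := congrArg OPart.size h
        simp only [size_bar] at this
        exact (add_mul_inj (hlt _ (List.mem_toFinset.1 ha')) (hlt _ ha) this).1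
      · intro h
        exact absurd (Finset.mem_range.2 hm) h
      · intro m' _
        refine if_neg fun h => ?_
        exact not_overlined_plain (η * m') (h ▸ hp)
    · obtain ⟨m, hm, rfl⟩ := hplain p (by simp) hp
      rw [Finset.sum_eq_single m, if_pos rfl, Finset.sum_eq_zero, add_zero]
      · intro m' _
        refine Finset.sum_eq_zero fun a' _ => if_neg fun h => hp ?_
        rw [← h]
        exact overlined_bar _
      · intro m' _ hne
        refine if_neg fun h => hne ?_
        have := congrArg OPart.size h
        simp only [size_plain] at this
        exact Nat.eq_of_mul_eq_mul_left hη this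
      · intro h
        exact absurd (Finset.mem_range.2 hm) h

theorem IsLayered.sum_map (h : IsLayered η αs t π) (hlt : ∀ a ∈ αs, a < η) (hη : 0 < η) {T : ℕ}
    (hT : t ≤ T) (w : OPart → M) :
    (π.map w).sum = ∑ m ∈ Finset.range T, (plains η π m • w (OPart.plain (η * m)) +
      ∑ a ∈ αs.toFinset, if OPart.bar (a + η * m) ∈ π then w (OPart.bar (a + η * m)) else 0) := by
  rw [sum_map_eq_sum_count (t := T) hlt hη
    (fun p hp ho => (h.plain p hp ho).imp fun m hm => ⟨hm.1.trans_le hT, hm.2⟩)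
    (fun p hp ho => (h.bar p hp ho).imp fun m hm => ⟨hm.1.trans_le hT, hm.2⟩)]
  refine Finset.sum_congr rfl fun m _ => congrArg _ (Finset.sum_congr rfl fun a _ => ?_)
  split_ifs with hmem
  · rw [h.once _ hmem (overlined_bar _), one_smul]
  · rw [Multiset.count_eq_zero.2 hmem, zero_smul]

theorem sum_map_filter (P : OPart → Prop) [DecidablePred P] (w : OPart → ℕ) :
    ((π.filter P).map w).sum = (π.map fun x => if P x then w x else 0).sum := by
  induction π using Multiset.induction with
  | empty => rfl
  | cons p π ih =>
    by_cases hp : P p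
    · rw [Multiset.filter_cons_of_pos _ hp]; simp [ih, hp]
    · rw [Multiset.filter_cons_of_neg _ hp]; simp [ih, hp]

theorem countP_eq_sum_map (P : OPart → Prop) [DecidablePred P] :
    π.countP P = (π.map fun x => if P x then 1 else 0).sum := by
  rw [← sum_map_filter, Multiset.countP_eq_card_filter]
  simp

theorem ones_map {l : List ℕ} (hl : l.Nodup) (p : ℕ → Prop) [DecidablePred p] :
    ones (l.map fun a => decide (p a)) = ∑ a ∈ l.toFinset, if p a then 1 else 0 := by
  rw [List.sum_toFinset _ hl]
  clear hl
  induction l with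
  | nil => rfl
  | cons a l ih =>
    rw [List.map_cons, ones, ih, List.map_cons, List.sum_cons]
    by_cases h : p a <;> simp [h]

theorem toFinset_drop (hs : αs.Pairwise (· < ·)) {i : ℕ} (hi : i < αs.length) :
    (αs.drop i).toFinset = αs.toFinset.filter (αs[i] ≤ ·) := by
  ext a
  simp only [List.mem_toFinset, Finset.mem_filter]
  constructor
  · intro h
    obtain ⟨j, hj, rfl⟩ := List.mem_iff_getElem.1 h
    rw [List.getElem_drop]
    refine ⟨List.getElem_mem _, ?_⟩
    rcases Nat.eq_zero_or_pos j with rfl | hj'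
    · rfl
    · exact (List.pairwise_iff_getElem.1 hs _ _ _ _ (by omega)).le
  · rintro ⟨h1, h2⟩
    obtain ⟨j, hj, rfl⟩ := List.mem_iff_getElem.1 h1
    have hij : i ≤ j := by
      by_contra hc
      exact absurd (List.pairwise_iff_getElem.1 hs _ _ hj hi (not_le.1 hc)) (not_lt.2 h2)
    refine List.mem_iff_getElem.2 ⟨j - i, by rw [List.length_drop]; omega, ?_⟩
    rw [List.getElem_drop]
    congr 1
    omega

theorem toFinset_take (hs : αs.Pairwise (· < ·)) {i : ℕ} (hi : i < αs.length) :
    (αs.take i).toFinset = αs.toFinset.filter (· < αs[i]) := by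
  ext a
  simp only [List.mem_toFinset, Finset.mem_filter]
  constructor
  · intro h
    obtain ⟨j, hj, rfl⟩ := List.mem_iff_getElem.1 h
    rw [List.length_take] at hj
    rw [List.getElem_take]
    exact ⟨List.getElem_mem _, List.pairwise_iff_getElem.1 hs _ _ _ _ (by omega)⟩
  · rintro ⟨h1, h2⟩
    obtain ⟨j, hj, rfl⟩ := List.mem_iff_getElem.1 h1
    have hij : j < i := by
      by_contra hc
      rcases (not_lt.1 hc).eq_or_lt with rfl | h
      · exact lt_irrefl _ h2
      · exact absurd (List.pairwise_iff_getElem.1 hs _ _ hi hj h) (not_lt.2 h2.le)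
    refine List.mem_iff_getElem.2 ⟨j, by rw [List.length_take]; omega, ?_⟩
    rw [List.getElem_take]

theorem ones_letters (hs : αs.Pairwise (· < ·)) (m : ℕ) :
    ones (letters η αs π m) = ∑ a ∈ αs.toFinset, if bar (a + η * m) ∈ π then 1 else 0 :=
  ones_map (hs.imp fun h => h.ne) fun a => bar (a + η * m) ∈ π

theorem ones_drop_letters (hs : αs.Pairwise (· < ·)) {i : ℕ} (hi : i < αs.length) (m : ℕ) :
    ones ((letters η αs π m).drop i) = ∑ a ∈ αs.toFinset,
      if bar (a + η * m) ∈ π then if αs[i] ≤ a then 1 else 0 else 0 := by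
  rw [letters, ← List.map_drop, ones_map ((hs.imp fun h => h.ne).sublist (List.drop_sublist _ _)),
    toFinset_drop hs hi, Finset.sum_filter]
  exact Finset.sum_congr rfl fun a _ => by split_ifs <;> rfl

theorem ones_take_letters (hs : αs.Pairwise (· < ·)) {i : ℕ} (hi : i < αs.length) (m : ℕ) :
    ones ((letters η αs π m).take i) = ∑ a ∈ αs.toFinset,
      if bar (a + η * m) ∈ π then if a < αs[i] then 1 else 0 else 0 := by
  rw [letters, ← List.map_take, ones_map ((hs.imp fun h => h.ne).sublist (List.take_sublist _ _)),
    toFinset_take hs hi, Finset.sum_filter]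
  exact Finset.sum_congr rfl fun a _ => by split_ifs <;> rfl

/-! ### Contents of the windows, layer by layer -/

theorem add_mul_le_iff {a b m m' : ℕ} (ha : a < η) (hb : b < η) :
    a + η * m ≤ b + η * m' ↔ m < m' ∨ (m = m' ∧ a ≤ b) := by
  rcases lt_trichotomy m m' with h | rfl | h
  · have := Nat.mul_le_mul_left η (Nat.succ_le_of_lt h)
    rw [Nat.mul_succ] at this
    simp only [h, true_or, iff_true]; omega
  · simp
  · have := Nat.mul_le_mul_left η (Nat.succ_le_of_lt h)
    rw [Nat.mul_succ] at this
    constructor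
    · intro h'; omega
    · rintro (h' | h') <;> omega

theorem bar_le_bar {x y : ℕ} : bar x ≤ bar y ↔ x ≤ y := by
  rw [le_def]; simp [bar, size]; omega

theorem plain_le_plain {x y : ℕ} : plain x ≤ plain y ↔ x ≤ y := by
  rw [le_def]; simp [plain, size]; omega

theorem plain_le_bar {x y : ℕ} : plain x ≤ bar y ↔ x ≤ y := by
  rw [le_def]; simp [plain, bar, size]; omega

theorem bar_le_plain {x y : ℕ} : bar x ≤ plain y ↔ x < y := by
  rw [le_def]; simp [plain, bar, size, show ¬ (true ≤ false) by decide]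

theorem windowEnd_plain (m : ℕ) : windowEnd η (plain (η * m)) = bar (0 + η * (m + 1)) := by
  rw [windowEnd, size_plain]; congr 1; ring

theorem windowEnd_bar (b m : ℕ) : windowEnd η (bar (b + η * m)) = bar (b + η * (m + 1)) := by
  rw [windowEnd, size_bar]; congr 1; ring

theorem plain_mem_window_plain (hη : 0 < η) (m₀ m : ℕ) :
    InWindow η (plain (η * m₀)) (plain (η * m)) ↔ m = m₀ ∨ m = m₀ + 1 := by
  rw [InWindow, windowEnd_plain, ← not_le, plain_le_plain, bar_le_plain, ← not_le,
    ← zero_add (η * m₀), ← zero_add (η * m), add_mul_le_iff hη hη, add_mul_le_iff hη hη]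
  omega

theorem bar_mem_window_plain {a : ℕ} (ha : a < η) (m₀ m : ℕ) :
    InWindow η (plain (η * m₀)) (bar (a + η * m)) ↔ m = m₀ := by
  have hη : 0 < η := by omega
  rw [InWindow, windowEnd_plain, ← not_le, plain_le_bar, bar_le_bar,
    ← zero_add (η * m₀), add_mul_le_iff hη ha, add_mul_le_iff hη ha]
  omega

theorem plain_mem_window_bar {b : ℕ} (hb : b < η) (m₀ m : ℕ) :
    InWindow η (bar (b + η * m₀)) (plain (η * m)) ↔ m = m₀ + 1 := by
  have hη : 0 < η := by omega
  rw [InWindow, windowEnd_bar, ← not_le, bar_le_plain, bar_le_plain, ← not_le, ← not_le,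
    ← zero_add (η * m), add_mul_le_iff hη hb, add_mul_le_iff hη hb]
  omega

theorem bar_mem_window_bar {a b : ℕ} (ha : a < η) (hb : b < η) (m₀ m : ℕ) :
    InWindow η (bar (b + η * m₀)) (bar (a + η * m)) ↔
      (m = m₀ ∧ b ≤ a) ∨ (m = m₀ + 1 ∧ a < b) := by
  rw [InWindow, windowEnd_bar, ← not_le, bar_le_bar, bar_le_bar, add_mul_le_iff hb ha,
    add_mul_le_iff hb ha]
  omega

theorem sum_window_plain (h : IsLayered η αs t π) (hs : αs.Pairwise (· < ·)) (hlt : ∀ a ∈ αs, a < η)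
    (hη : 0 < η) (G : ℕ → ℕ) {m₀ : ℕ} (hm₀ : m₀ < t) :
    (π.map fun x => if InWindow η (plain (η * m₀)) x then G (x.size / η) else 0).sum =
      G m₀ * (plains η π m₀ + ones (letters η αs π m₀)) + G (m₀ + 1) * plains η π (m₀ + 1) := by
  rw [h.sum_map hlt hη (Nat.le_succ t)]
  have e : ∀ m, (plains η π m • (if InWindow η (plain (η * m₀)) (plain (η * m)) then
      G ((plain (η * m)).size / η) else 0) + ∑ a ∈ αs.toFinset, if bar (a + η * m) ∈ π then
      if InWindow η (plain (η * m₀)) (bar (a + η * m)) then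
        G ((bar (a + η * m)).size / η) else 0 else 0) =
      (if m = m₀ then G m₀ * (plains η π m₀ + ones (letters η αs π m₀)) else 0) +
      (if m = m₀ + 1 then G (m₀ + 1) * plains η π (m₀ + 1) else 0) := by
    intro m
    simp only [plain_mem_window_plain hη, size_plain, size_bar, Nat.mul_div_cancel_left m hη]
    have e1 : ∀ a ∈ αs.toFinset, (if bar (a + η * m) ∈ π then
        if InWindow η (plain (η * m₀)) (bar (a + η * m)) then G ((a + η * m) / η) else 0 else 0) =
        if m = m₀ then G m₀ * (if bar (a + η * m₀) ∈ π then 1 else 0) else 0 := by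
      intro a ha
      have ha' := hlt a (List.mem_toFinset.1 ha)
      simp only [bar_mem_window_plain ha', Nat.add_mul_div_left a m hη, Nat.div_eq_of_lt ha',
        zero_add]
      by_cases hm : m = m₀
      · subst hm; simp
      · simp [hm]
    rw [Finset.sum_congr rfl e1]
    by_cases hm : m = m₀
    · subst hm
      simp only [true_or, if_true, show m ≠ m + 1 by omega, if_false, add_zero, smul_eq_mul,
        ← Finset.mul_sum, ← ones_letters hs]
      ring
    · by_cases hm' : m = m₀ + 1
      · subst hm'; simp [mul_comm]
      · simp [hm, hm']
  rw [Finset.sum_congr rfl fun m _ => e m, Finset.sum_add_distrib, Finset.sum_ite_eq',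
    Finset.sum_ite_eq', if_pos (Finset.mem_range.2 (by omega)),
    if_pos (Finset.mem_range.2 (by omega))]

theorem sum_window_bar (h : IsLayered η αs t π) (hs : αs.Pairwise (· < ·)) (hlt : ∀ a ∈ αs, a < η)
    (hη : 0 < η) (G : ℕ → ℕ) {m₀ : ℕ} (hm₀ : m₀ < t) {i : ℕ} (hi : i < αs.length) :
    (π.map fun x => if InWindow η (bar (αs[i] + η * m₀)) x then G (x.size / η) else 0).sum =
      G m₀ * ones ((letters η αs π m₀).drop i) +
        G (m₀ + 1) * (plains η π (m₀ + 1) + ones ((letters η αs π (m₀ + 1)).take i)) := by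
  rw [h.sum_map hlt hη (Nat.le_succ t)]
  have hi' : αs[i] < η := hlt _ (List.getElem_mem hi)
  have e : ∀ m, (plains η π m • (if InWindow η (bar (αs[i] + η * m₀)) (plain (η * m)) then
      G ((plain (η * m)).size / η) else 0) + ∑ a ∈ αs.toFinset, if bar (a + η * m) ∈ π then
      if InWindow η (bar (αs[i] + η * m₀)) (bar (a + η * m)) then
        G ((bar (a + η * m)).size / η) else 0 else 0) =
      (if m = m₀ then G m₀ * ones ((letters η αs π m₀).drop i) else 0) +
      (if m = m₀ + 1 then G (m₀ + 1) *
        (plains η π (m₀ + 1) + ones ((letters η αs π (m₀ + 1)).take i)) else 0) := by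
    intro m
    simp only [plain_mem_window_bar hi', size_plain, size_bar, Nat.mul_div_cancel_left m hη]
    have e1 : ∀ a ∈ αs.toFinset, (if bar (a + η * m) ∈ π then
        if InWindow η (bar (αs[i] + η * m₀)) (bar (a + η * m)) then G ((a + η * m) / η)
          else 0 else 0) =
        (if m = m₀ then G m₀ * (if bar (a + η * m₀) ∈ π then if αs[i] ≤ a then 1 else 0 else 0)
          else 0) +
        (if m = m₀ + 1 then G (m₀ + 1) *
          (if bar (a + η * (m₀ + 1)) ∈ π then if a < αs[i] then 1 else 0 else 0) else 0) := by
      intro a ha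
      have ha' := hlt a (List.mem_toFinset.1 ha)
      simp only [bar_mem_window_bar ha' hi', Nat.add_mul_div_left a m hη, Nat.div_eq_of_lt ha',
        zero_add]
      by_cases hm : m = m₀
      · subst hm; simp
      · by_cases hm' : m = m₀ + 1
        · subst hm'; simp
        · simp [hm, hm']
    rw [Finset.sum_congr rfl e1]
    by_cases hm : m = m₀
    · subst hm
      simp only [if_true, show m ≠ m + 1 by omega, if_false, add_zero, smul_eq_mul,
        ← Finset.mul_sum, ← ones_drop_letters hs hi, mul_zero, zero_add]
    · by_cases hm' : m = m₀ + 1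
      · subst hm'
        simp only [if_true, show m₀ + 1 ≠ m₀ by omega, if_false, smul_eq_mul,
          ← Finset.mul_sum, ← ones_take_letters hs hi, zero_add]
        ring
      · simp [hm, hm']
  rw [Finset.sum_congr rfl fun m _ => e m, Finset.sum_add_distrib, Finset.sum_ite_eq',
    Finset.sum_ite_eq', if_pos (Finset.mem_range.2 (by omega)),
    if_pos (Finset.mem_range.2 (by omega))]

theorem countP_window_plain (h : IsLayered η αs t π) (hs : αs.Pairwise (· < ·))
    (hlt : ∀ a ∈ αs, a < η) (hη : 0 < η) {m₀ : ℕ} (hm₀ : m₀ < t) :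
    π.countP (InWindow η (plain (η * m₀))) =
      plains η π m₀ + ones (letters η αs π m₀) + plains η π (m₀ + 1) := by
  rw [countP_eq_sum_map]
  simpa using sum_window_plain h hs hlt hη (fun _ => 1) hm₀

theorem countP_window_bar (h : IsLayered η αs t π) (hs : αs.Pairwise (· < ·))
    (hlt : ∀ a ∈ αs, a < η) (hη : 0 < η) {m₀ : ℕ} (hm₀ : m₀ < t) {i : ℕ} (hi : i < αs.length) :
    π.countP (InWindow η (bar (αs[i] + η * m₀))) = ones ((letters η αs π m₀).drop i) +
      (plains η π (m₀ + 1) + ones ((letters η αs π (m₀ + 1)).take i)) := by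
  rw [countP_eq_sum_map]
  simpa using sum_window_bar h hs hlt hη (fun _ => 1) hm₀ hi

theorem countP_overlined (h : IsLayered η αs t π) (hs : αs.Pairwise (· < ·))
    (hlt : ∀ a ∈ αs, a < η) {m₀ : ℕ} (hm₀ : m₀ ≤ t) {i : ℕ} (hi : i < αs.length) :
    (π.countP fun x => x < bar (αs[i] + η * m₀) ∧ x.Overlined) =
      ∑ m ∈ Finset.range m₀, ones (letters η αs π m) + ones ((letters η αs π m₀).take i) := by
  have hi' : αs[i] < η := hlt _ (List.getElem_mem hi)
  have hη : 0 < η := by omega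
  rw [countP_eq_sum_map, h.sum_map hlt hη (Nat.le_succ t),
    ← Finset.sum_subset (Finset.range_subset_range.2 (Nat.succ_le_succ hm₀)),
    Finset.sum_range_succ]
  · simp only [not_overlined_plain, and_false, if_false, smul_zero, zero_add, overlined_bar,
      and_true, ← not_le, bar_le_bar]
    congr 1
    · refine Finset.sum_congr rfl fun m hm => ?_
      rw [ones_letters hs]
      refine Finset.sum_congr rfl fun a ha => ?_
      have ha' := hlt a (List.mem_toFinset.1 ha)
      rw [Finset.mem_range] at hm
      have e : ¬ αs[i] + η * m₀ ≤ a + η * m := by rw [add_mul_le_iff hi' ha']; omega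
      rw [if_pos e]
    · rw [ones_take_letters hs hi]
      refine Finset.sum_congr rfl fun a ha => ?_
      simp [not_le]
  · intro m _ hm
    rw [Finset.mem_range] at hm
    simp only [not_overlined_plain, and_false, if_false, smul_zero, zero_add, overlined_bar,
      and_true, ← not_le, bar_le_bar]
    refine Finset.sum_eq_zero fun a ha => ?_
    have ha' := hlt a (List.mem_toFinset.1 ha)
    have e : ¬ ¬ αs[i] + η * m₀ ≤ a + η * m := by rw [add_mul_le_iff hi' ha']; omega
    rw [if_neg e, ite_self]

/-- The parts up to the plain `η` are those in the window of the absent plain part of size `0`; this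
makes the bound on small parts a window condition. -/
theorem countP_small (h : IsLayered η αs t π) (hs : αs.Pairwise (· < ·))
    (hlt : ∀ a ∈ αs, a < η) (hη : 0 < η) (ht : 0 < t) (h0 : plains η π 0 = 0) :
    (π.countP fun x => x ≤ plain η) = ones (letters η αs π 0) + plains η π 1 := by
  have := countP_window_plain h hs hlt hη ht
  rw [h0, zero_add, zero_add] at this
  rw [← this]
  refine Multiset.countP_congr rfl fun x _ => ?_
  rw [InWindow, windowEnd_plain, zero_add, zero_add, mul_one, mul_zero]
  simp only [eq_iff_iff]
  have hx : plain 0 ≤ x := by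
    rw [le_def]; simp [plain, size]; omega
  refine ⟨fun h => ⟨hx, h.trans_lt ?_⟩, fun h => ?_⟩
  · rw [← not_le, bar_le_plain]; omega
  · rcases em x.Overlined with ho | ho
    · have h2 := h.2
      rw [ho.eq_bar, ← not_le, bar_le_bar] at h2
      rw [ho.eq_bar, bar_le_plain]
      omega
    · have h2 := h.2
      rw [eq_plain ho, ← not_le, bar_le_plain] at h2
      rw [eq_plain ho, plain_le_plain]
      omega


theorem fits_iff {K n s : ℕ} {b : ZMod n} : Fits K n s b ↔ s ≤ K ∧ (s = K → b = 0) :=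
  ⟨fun h => ⟨h.le, h.eq_zero⟩, fun h => h.1.lt_or_eq.imp id fun h' => ⟨h', h.2 h'⟩⟩

/-! ### Parity bookkeeping and the translation into admissible layers -/

/-- The parity before the layer `m`, where `f` and `a` count the plain parts and the letters. -/
def parity (K n : ℕ) (f a : ℕ → ℕ) : ℕ → ZMod n
  | 0 => 0
  | m + 1 => parity K n f a m + (f m + a m + f (m + 1) : ℕ) - K

/-- Every intermediate `f i` is added twice and drops out because `2 = 0`. -/
theorem parity_eq {K n : ℕ} (h2 : (2 : ZMod n) = 0) (f a : ℕ → ℕ) (m : ℕ) :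
    parity K n f a m = f 0 + f m + ∑ i ∈ Finset.range m, (a i : ZMod n) - m * K := by
  induction m with
  | zero => simp only [parity, Finset.range_zero, Finset.sum_empty, Nat.cast_zero]
            linear_combination -(f 0 : ZMod n) * h2
  | succ m ih =>
    rw [parity, ih, Finset.sum_range_succ]
    push_cast
    linear_combination (f m : ZMod n) * h2

theorem valid_range' {K n : ℕ} (f : ℕ → ℕ) (A : ℕ → List Bool) (m t : ℕ) :
    Valid K n (A m) (f m) (parity K n f (fun i => ones (A i)) m)
      ((List.range' (m + 1) t).map fun i => (f i, A i)) ↔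
    (∀ i, m ≤ i → i < m + t →
      Fits K n (f i + ones (A i) + f (i + 1)) (parity K n f (fun i => ones (A i)) i) ∧
      Fits K n (f (i + 1) + cross (A i) (A (i + 1)))
        (parity K n f (fun i => ones (A i)) (i + 1))) ∧
    Fits K n (f (m + t) + ones (A (m + t))) (parity K n f (fun i => ones (A i)) (m + t)) := by
  induction t generalizing m with
  | zero =>
    simp only [List.range'_zero, List.map_nil, Valid, add_zero]
    exact ⟨fun h => ⟨fun i h1 h2 => by omega, h⟩, fun h => h.2⟩
  | succ t ih =>
    rw [List.range'_succ, List.map_cons, Valid]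
    have := ih (m + 1)
    rw [show m + 1 + t = m + (t + 1) by ring] at this
    change _ ∧ _ ∧ Valid K n (A (m + 1)) (f (m + 1)) (parity K n f (fun i => ones (A i)) (m + 1)) _ ↔ _
    rw [this]
    constructor
    · rintro ⟨h1, h2, h3, h4⟩
      refine ⟨fun i hi hi' => ?_, h4⟩
      rcases hi.eq_or_lt with rfl | hi
      · exact ⟨h1, h2⟩
      · exact h3 i hi (by omega)
    · rintro ⟨h1, h2⟩
      exact ⟨(h1 m le_rfl (by omega)).1, (h1 m le_rfl (by omega)).2,
        fun i hi hi' => h1 i (by omega) (by omega), h2⟩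

/-- `cross` is the maximum over all cut points of the two subsets, and all the windows cut in this
way share the same parity. -/
theorem fits_cross_iff {K n f : ℕ} {b : ZMod n} {A B : List Bool} (h : A.length = B.length) :
    Fits K n (f + cross A B) b ↔
      ∀ i ≤ A.length, Fits K n (ones (A.drop i) + (f + ones (B.take i))) b := by
  induction A generalizing B f with
  | nil =>
    cases B with
    | nil => simp [cross, ones]
    | cons b B => simp at h
  | cons a A ih =>
    cases B with
    | nil => simp at h
    | cons b' B =>
      have ih' := ih (B := B) (f := f + b'.toNat) (by simpa using h)
      have e : Fits K n (f + cross (a :: A) (b' :: B)) b ↔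
          Fits K n (f + ones (a :: A)) b ∧ Fits K n (f + b'.toNat + cross A B) b := by
        simp only [cross, ones, add_assoc]
        rcases le_total (a.toNat + ones A) (b'.toNat + cross A B) with h | h
        · rw [max_eq_right h]
          exact ⟨fun h' => ⟨h'.mono (by omega), h'⟩, fun h' => h'.2⟩
        · rw [max_eq_left h]
          exact ⟨fun h' => ⟨h', h'.mono (by omega)⟩, fun h' => h'.1⟩
      rw [e, ih']
      constructor
      · rintro ⟨h1, h2⟩ i hi
        cases i with
        | zero => simpa [ones, add_comm] using h1
        | succ i =>
          have := h2 i (by simpa using hi)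
          simpa only [List.drop_succ_cons, List.take_succ_cons, ones, add_assoc] using this
      · intro h'
        refine ⟨by simpa [ones, add_comm] using h' 0 (Nat.zero_le _), fun i hi => ?_⟩
        have := h' (i + 1) (by simpa using hi)
        simpa only [List.drop_succ_cons, List.take_succ_cons, ones, add_assoc] using this

/-- The numbers of plain parts, with `u` additional plain parts in the lowest layer. -/
def heights (η : ℕ) (π : Multiset OPart) (u m : ℕ) : ℕ := if m = 0 then u else plains η π m

variable {η : ℕ} {αs : List ℕ} {t : ℕ} {π : Multiset OPart} {j K n r u : ℕ}

/-- The parity before the layer `m` of `π`. -/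
def layerParity (K n η : ℕ) (αs : List ℕ) (π : Multiset OPart) (u m : ℕ) : ZMod n :=
  parity K n (heights η π u) (fun i => ones (letters η αs π i)) m

/-- In a full window the sum of the quotients is `m K` plus the number of parts in layer `m + 1`,
and `r - 1 = K - u`. Modulo `2` the congruence thus becomes the vanishing of the closed form in
`parity_eq`. -/
theorem windowCond_plain_iff (h : IsLayered η αs t π) (hs : αs.Pairwise (· < ·))
    (hlt : ∀ a ∈ αs, a < η) (hη : 0 < η) (h0 : αs.head? = some 0) (hn : (n : ℤ) = 2 - j)
    (h2 : (2 : ZMod n) = 0) (hu : u + r = K + 1) {m : ℕ} (hm : m < t) (hm0 : 0 < m) :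
    WindowCond j K η r π (plain (η * m)) ↔
      Fits K n (heights η π u m + ones (letters η αs π m) + heights η π u (m + 1))
        (layerParity K n η αs π u m) := by
  obtain ⟨βs, rfl⟩ : ∃ βs, αs = 0 :: βs := by
    cases αs with
    | nil => simp at h0
    | cons a l => exact ⟨l, by simp at h0; rw [h0]⟩
  have hV := countP_overlined h hs hlt (m₀ := m + 1) (by omega) (i := 0) (by simp)
  rw [List.getElem_cons_zero, ← windowEnd_plain, List.take_zero, ones, add_zero] at hV
  have hS := sum_window_plain h hs hlt hη (fun i => i) hm
  rw [← sum_map_filter] at hS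
  rw [WindowCond, countP_window_plain h hs hlt hη hm, fits_iff, heights, if_neg hm0.ne', heights,
    if_neg (Nat.succ_ne_zero m), hS, hV, layerParity, parity_eq h2]
  refine and_congr_right fun _ => forall_congr' fun hK => ?_
  rw [← hn, ← ZMod.intCast_eq_intCast_iff, ← sub_eq_zero]
  have e1 : (u : ZMod n) + r = K + 1 := by exact_mod_cast congrArg (Nat.cast (R := ZMod n)) hu
  have e2 := congrArg (Nat.cast (R := ZMod n)) hK
  push_cast at e2
  simp only [heights, if_true, if_neg hm0.ne']
  push_cast
  rw [Finset.sum_range_succ]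
  set S := ∑ i ∈ Finset.range m, (ones (letters η (0 :: βs) π i) : ZMod n)
  constructor <;> intro h'
  · linear_combination h' + e1 + (1 - m : ZMod n) * e2 +
      (K - plains η π (m + 1) - m * K + S) * h2
  · linear_combination h' - e1 - (1 - m : ZMod n) * e2 -
      (K - plains η π (m + 1) - m * K + S) * h2

theorem windowCond_bar_iff (h : IsLayered η αs t π) (hs : αs.Pairwise (· < ·))
    (hlt : ∀ a ∈ αs, a < η) (hη : 0 < η) (hn : (n : ℤ) = 2 - j)
    (h2 : (2 : ZMod n) = 0) (hu : u + r = K + 1) {m : ℕ} (hm : m < t) {i : ℕ} (hi : i < αs.length) :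
    WindowCond j K η r π (bar (αs[i] + η * m)) ↔
      Fits K n (ones ((letters η αs π m).drop i) +
        (heights η π u (m + 1) + ones ((letters η αs π (m + 1)).take i)))
        (layerParity K n η αs π u (m + 1)) := by
  have hV := countP_overlined h hs hlt (m₀ := m + 1) (by omega) hi
  rw [← windowEnd_bar] at hV
  have hS := sum_window_bar h hs hlt hη (fun i => i) hm hi
  rw [← sum_map_filter] at hS
  rw [WindowCond, countP_window_bar h hs hlt hη hm hi, fits_iff, heights,
    if_neg (Nat.succ_ne_zero m), hS, hV, layerParity, parity_eq h2]
  refine and_congr_right fun _ => forall_congr' fun hK => ?_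
  rw [← hn, ← ZMod.intCast_eq_intCast_iff, ← sub_eq_zero]
  have e1 : (u : ZMod n) + r = K + 1 := by exact_mod_cast congrArg (Nat.cast (R := ZMod n)) hu
  have e2 := congrArg (Nat.cast (R := ZMod n)) hK
  push_cast at e2
  simp only [heights, if_true, if_neg (Nat.succ_ne_zero m)]
  push_cast
  set S := ∑ i ∈ Finset.range (m + 1), (ones (letters η αs π i) : ZMod n)
  constructor <;> intro h'
  · linear_combination h' + e1 - (m : ZMod n) * e2 - (m * K - S) * h2
  · linear_combination h' - e1 + (m : ZMod n) * e2 + (m * K - S) * h2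

/-- Windows at plain parts with `0 < m` give the capacity conditions of `Valid`, those at letters
give the crossing conditions. At `m = 0` the `u` extra plain parts and the parity `0` turn the
capacity condition into the bound on small parts. -/
theorem isOverB_iff_valid {l : ℕ} {α : Fin l → ℕ} {L : List OPart} (hL : L.Pairwise (· ≥ ·))
    (hLπ : (L : Multiset OPart) = π)
    (h : IsLayered η αs t π) (hs : αs.Pairwise (· < ·)) (hlt : ∀ a ∈ αs, a < η) (hη : 0 < η)
    (h0 : αs.head? = some 0) (hn : (n : ℤ) = 2 - j) (h2 : (2 : ZMod n) = 0) (hu : u + r = K + 1)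
    (hK : 0 < K) (ht : 0 < t) (hsize : ∀ p ∈ π, p.size < η * t)
    (hpos : plains η π 0 = 0)
    (hcongr : ∀ p ∈ π, p.size ≡ 0 [MOD η] ∨ ∃ i, p.size ≡ α i [MOD η])
    (hnon : ∀ p ∈ π, ¬ p.Overlined → η ∣ p.size) :
    IsOverB j α η (K + 1) r L ↔ Valid K n (letters η αs π 0) u 0
      ((List.range' 1 t).map fun m => (plains η π m, letters η αs π m)) := by
  have hmem : ∀ p, p ∈ L ↔ p ∈ π := fun p => by rw [← hLπ, Multiset.mem_coe]
  have hV := valid_range' (K := K) (n := n) (heights η π u) (letters η αs π) 0 t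
  have hm : (List.range' (0 + 1) t).map (fun i => (heights η π u i, letters η αs π i)) =
      (List.range' 1 t).map fun m => (plains η π m, letters η αs π m) :=
    List.map_congr_left fun i hi => by
      rw [heights, if_neg]
      have := List.mem_range'_1.1 hi
      omega
  rw [hm] at hV
  change Valid K n (letters η αs π 0) u 0 _ ↔ _ at hV
  rw [hV]
  -- All sizes are below `η * t`, so layer `t` is empty and the final condition of `Valid` is free.
  have htop1 : plains η π t = 0 := Multiset.count_eq_zero.2 fun hp =>
    absurd (hsize _ hp) (by simp)
  have htop2 : ones (letters η αs π t) = 0 := by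
    rw [ones_letters hs]
    refine Finset.sum_eq_zero fun a _ => if_neg fun hp => ?_
    have := hsize _ hp
    simp only [size_bar] at this
    omega
  have hfin : Fits K n (heights η π u t + ones (letters η αs π t))
      (layerParity K n η αs π u t) := by
    rw [heights, if_neg ht.ne', htop1, htop2]
    exact Fits.of_lt hK
  have hsm : (L.countP fun p => p ≤ plain η) = ones (letters η αs π 0) + plains η π 1 := by
    rw [← countP_small h hs hlt hη ht hpos, ← hLπ, Multiset.coe_countP]
  have hlen : ∀ m, (letters η αs π m).length = αs.length := fun m => List.length_map _
  have hbase : Fits K n (heights η π u 0 + ones (letters η αs π 0) + heights η π u (0 + 1))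
      (layerParity K n η αs π u 0) ↔ (L.countP (fun p => p ≤ plain η) : ℤ) ≤ (r : ℤ) - 1 := by
    rw [hsm, fits_iff]
    change u + ones (letters η αs π 0) + plains η π 1 ≤ K ∧ (_ → (0 : ZMod n) = 0) ↔ _
    push_cast
    constructor
    · rintro ⟨h1, -⟩; omega
    · intro h1; exact ⟨by omega, fun _ => rfl⟩
  rw [zero_add]
  constructor
  · intro hB
    have hw : ∀ s, WindowCond j K η r π s := hLπ ▸ windowCond_of_isOverB hK hL hB
    have hP : ∀ i < t, Fits K n (heights η π u i + ones (letters η αs π i) + heights η π u (i + 1))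
        (layerParity K n η αs π u i) := by
      intro i hi
      rcases Nat.eq_zero_or_pos i with rfl | hi'
      · exact hbase.2 hB.small
      · exact (windowCond_plain_iff h hs hlt hη h0 hn h2 hu hi hi').1 (hw _)
    refine ⟨fun i _ hi => ⟨hP i hi, ?_⟩, hfin⟩
    rw [fits_cross_iff (by rw [hlen, hlen]), hlen]
    intro i' hi'
    rcases hi'.lt_or_eq with hi' | rfl
    · exact (windowCond_bar_iff h hs hlt hη hn h2 hu hi hi').1 (hw _)
    -- The cut after the last letter is no window of a part; it follows from the next plain window,
    -- or from the emptiness of layer `t`.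
    · rw [List.drop_of_length_le (hlen i).le, List.take_of_length_le (hlen _).le, ones, zero_add]
      rcases (Nat.succ_le_of_lt hi).eq_or_lt with rfl | hi
      · exact hfin
      · exact (hP (i + 1) hi).mono (by omega)
  · rintro ⟨hB, -⟩
    refine isOverB_of_windowCond hK hL (fun p hp => hcongr p ((hmem p).1 hp))
      (fun p hp => hnon p ((hmem p).1 hp)) (hbase.1 (hB 0 le_rfl ht).1) fun p hp => ?_
    rw [hmem] at hp
    rw [hLπ]
    by_cases ho : p.Overlined
    · obtain ⟨m, hm, a, ha, rfl⟩ := h.bar p hp ho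
      obtain ⟨i, hi, rfl⟩ := List.mem_iff_getElem.1 ha
      rw [windowCond_bar_iff h hs hlt hη hn h2 hu hm hi]
      have := (hB m (Nat.zero_le _) hm).2
      rw [fits_cross_iff (by rw [hlen, hlen]), hlen] at this
      exact this i hi.le
    · obtain ⟨m, hm, rfl⟩ := h.plain p hp ho
      have hm0 : 0 < m := by
        rcases Nat.eq_zero_or_pos m with rfl | h'
        · exact absurd hp (Multiset.count_eq_zero.1 hpos)
        · exact h'
      exact (windowCond_plain_iff h hs hlt hη h0 hn h2 hu hm hm0).2 (hB m (Nat.zero_le _) hm).1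


/-! ### Weights as powers of the variable -/

section Weights

variable {R : Type*} [CommRing R]

open Classical in
-- Giving the first letter weight `0` keeps exactly the configurations that never use it. This
-- removes the overlined multiples of `η` in the case of `B_0`.
theorem weight_zero_cons (q Q y : R) (xs : List R) (c : List (ℕ × List Bool))
    (hc : ∀ s ∈ c, s.2 ≠ []) : weight q Q (0 :: xs) c =
      if ∀ s ∈ c, s.2.head? ≠ some true then weight q Q (y :: xs) c else 0 := by
  induction c generalizing Q y xs with
  | nil => simp [weight]
  | cons s c ih =>
    obtain ⟨f, A⟩ := s
    have hA := hc (f, A) (by simp)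
    rw [weight, weight, List.map_cons, List.map_cons, mul_zero,
      ih (y := q * y) _ _ fun s hs => hc s (by simp [hs])]
    cases A with
    | nil => exact absurd rfl hA
    | cons a A =>
      cases a
      · simp [bitProd]
      · simp [bitProd]

/-- The sum of the letters in a subset. -/
def bitSize : List ℕ → List Bool → ℕ
  | x :: xs, a :: A => (if a then x else 0) + bitSize xs A
  | _, _ => 0

theorem bitProd_map_pow (y : R) (l : List ℕ) (A : List Bool) :
    bitProd (l.map (y ^ ·)) A = y ^ bitSize l A := by
  induction l generalizing A with
  | nil => simp [bitProd, bitSize]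
  | cons x l ih =>
    cases A with
    | nil => simp [bitProd, bitSize]
    | cons a A => simp only [List.map_cons, bitProd, bitSize, ih, pow_add]; split_ifs <;> simp

theorem bitSize_map (l : List ℕ) (hl : l.Nodup) (g : ℕ → ℕ) (p : ℕ → Prop) [DecidablePred p] :
    bitSize (l.map g) (l.map fun a => decide (p a)) =
      ∑ a ∈ l.toFinset, if p a then g a else 0 := by
  rw [List.sum_toFinset _ hl]
  clear hl
  induction l with
  | nil => rfl
  | cons a l ih => simp [bitSize, ih]

/-- The sum of the parts in a list of layers that follow the layer `m`. -/
def layersSize (η : ℕ) (αs : List ℕ) : ℕ → List (ℕ × List Bool) → ℕ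
  | _, [] => 0
  | m, s :: c => s.1 * (η * (m + 1)) + bitSize (αs.map (· + η * (m + 1))) s.2 +
      layersSize η αs (m + 1) c

theorem weight_eq_pow (y : R) (η : ℕ) (αs : List ℕ) (m : ℕ) (c : List (ℕ × List Bool)) :
    weight (y ^ η) (y ^ (η * m)) (αs.map fun a => y ^ (a + η * m)) c =
      y ^ layersSize η αs m c := by
  induction c generalizing m with
  | nil => simp [weight, layersSize]
  | cons s c ih =>
    have h1 : (αs.map fun a => y ^ (a + η * m)).map (y ^ η * ·) =
        αs.map fun a => y ^ (a + η * (m + 1)) := by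
      rw [List.map_map]
      refine List.map_congr_left fun a _ => ?_
      simp only [Function.comp_apply]
      ring
    have h2 : (αs.map fun a => y ^ (a + η * (m + 1))) = (αs.map (· + η * (m + 1))).map (y ^ ·) := by
      rw [List.map_map]; rfl
    rw [weight, h1, show y ^ (η * m) * y ^ η = y ^ (η * (m + 1)) by ring, ih, h2, bitProd_map_pow,
      layersSize]
    ring

theorem layersSize_range' (η : ℕ) (αs : List ℕ) (g : ℕ → ℕ × List Bool) (m t : ℕ) :
    layersSize η αs m ((List.range' (m + 1) t).map g) = ∑ i ∈ Finset.range t,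
      ((g (m + 1 + i)).1 * (η * (m + 1 + i)) +
        bitSize (αs.map (· + η * (m + 1 + i))) (g (m + 1 + i)).2) := by
  induction t generalizing m with
  | zero => rfl
  | succ t ih =>
    rw [List.range'_succ, List.map_cons, layersSize, ih, Finset.sum_range_succ', add_comm]
    congr 1
    exact Finset.sum_congr rfl fun i _ => by rw [show m + 1 + 1 + i = m + 1 + (i + 1) by ring]

end Weights

/-! ### Weight, uniqueness and existence for given layers -/

variable {η : ℕ} {αs : List ℕ} {t : ℕ} {π : Multiset OPart}

theorem sum_size {s : ℕ} (h : IsLayered η αs s π) (hst : s ≤ t + 1) (hs : αs.Pairwise (· < ·))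
    (hlt : ∀ a ∈ αs, a < η) (hη : 0 < η) :
    (π.map OPart.size).sum = bitSize αs (letters η αs π 0) +
      layersSize η αs 0 ((List.range' 1 t).map fun m => (plains η π m, letters η αs π m)) := by
  have hn : αs.Nodup := hs.imp fun h => h.ne
  have e : ∀ m, ∑ a ∈ αs.toFinset, (if bar (a + η * m) ∈ π then a + η * m else 0) =
      bitSize (αs.map (· + η * m)) (letters η αs π m) := fun m =>
    (bitSize_map αs hn (· + η * m) fun a => bar (a + η * m) ∈ π).symm
  have hm := layersSize_range' η αs (fun m => (plains η π m, letters η αs π m)) 0 t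
  rw [zero_add] at hm
  rw [h.sum_map hlt hη hst, hm, Finset.sum_range_succ', add_comm]
  refine congrArg₂ _ ?_ (Finset.sum_congr rfl fun i _ => ?_)
  · simp only [size_bar, size_plain]
    rw [e]
    simp
  · simp only [size_bar, size_plain]
    rw [e, smul_eq_mul, add_comm 1 i]

theorem eq_of_layers {π' : Multiset OPart} (h : IsLayered η αs t π) (h' : IsLayered η αs t π')
    (hlt : ∀ a ∈ αs, a < η) (hη : 0 < η) (hp : ∀ m < t, plains η π m = plains η π' m)
    (hl : ∀ m < t, letters η αs π m = letters η αs π' m) : π = π' := by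
  rw [← Multiset.sum_map_singleton π, ← Multiset.sum_map_singleton π', h.sum_map hlt hη le_rfl,
    h'.sum_map hlt hη le_rfl]
  refine Finset.sum_congr rfl fun m hm => ?_
  rw [Finset.mem_range] at hm
  rw [hp m hm]
  refine congrArg _ (Finset.sum_congr rfl fun a ha => ?_)
  have := List.map_inj_left.1 (hl m hm) a (List.mem_toFinset.1 ha)
  exact if_congr (decide_eq_decide.1 this) rfl rfl

theorem exists_layers (hs : αs.Pairwise (· < ·)) (hlt : ∀ a ∈ αs, a < η) (hη : 0 < η) (t : ℕ)
    (F : ℕ → ℕ) (B : ℕ → List Bool) (hB : ∀ m < t, (B m).length = αs.length) :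
    ∃ π, IsLayered η αs t π ∧ (∀ m < t, plains η π m = F m) ∧
      ∀ m < t, letters η αs π m = B m := by
  classical
  let P : Finset OPart := (Finset.range t).image (fun m => plain (η * m)) ∪
    (αs.toFinset ×ˢ Finset.range t).image fun x => bar (x.1 + η * x.2)
  -- The residue of an overlined part locates its bit in the layer; on `P` the position is always in
  -- range, so the default `false` is never used.
  let w : OPart → ℕ := fun p => if p.Overlined then
    ((B (p.size / η)).getD (αs.idxOf (p.size % η)) false).toNat else F (p.size / η)
  let π : Multiset OPart := ∑ p ∈ P, w p • {p}
  have hcount : ∀ p, π.count p = if p ∈ P then w p else 0 := by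
    intro p
    simp only [π, Multiset.count_sum', Multiset.count_nsmul, Multiset.count_singleton, mul_ite,
      mul_one, mul_zero, Finset.sum_ite_eq]
  have hmem : ∀ p ∈ π, p ∈ P := by
    intro p hp
    by_contra h
    have := hcount p
    rw [if_neg h] at this
    exact Multiset.count_eq_zero.1 this hp
  have hmemP : ∀ p ∈ P, (∃ m < t, p = plain (η * m)) ∨ ∃ m < t, ∃ a ∈ αs, p = bar (a + η * m) := by
    intro p hp
    rcases Finset.mem_union.1 hp with hp | hp
    · obtain ⟨m, hm, rfl⟩ := Finset.mem_image.1 hp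
      exact Or.inl ⟨m, Finset.mem_range.1 hm, rfl⟩
    · obtain ⟨⟨a, m⟩, hm, rfl⟩ := Finset.mem_image.1 hp
      rw [Finset.mem_product, List.mem_toFinset, Finset.mem_range] at hm
      exact Or.inr ⟨m, hm.2, a, hm.1, rfl⟩
  refine ⟨π, ⟨?_, ?_, ?_⟩, ?_, ?_⟩
  · intro p hp ho
    rcases hmemP p (hmem p hp) with h | ⟨m, hm, a, ha, rfl⟩
    · exact h
    · exact absurd (overlined_bar _) ho
  · intro p hp ho
    rcases hmemP p (hmem p hp) with ⟨m, hm, rfl⟩ | h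
    · exact absurd ho (not_overlined_plain _)
    · exact h
  · intro p hp ho
    have h1 := Multiset.one_le_count_iff_mem.2 hp
    have h2 := hcount p
    rw [if_pos (hmem p hp)] at h2
    have h3 : w p ≤ 1 := by
      simp only [w, if_pos ho]
      exact Bool.toNat_le _
    omega
  · intro m hm
    rw [plains, hcount, if_pos]
    · simp only [w, if_neg (not_overlined_plain _), size_plain, Nat.mul_div_cancel_left m hη]
    · exact Finset.mem_union_left _ (Finset.mem_image_of_mem _ (Finset.mem_range.2 hm))
  · intro m hm
    refine List.ext_getElem (by rw [letters, List.length_map, hB m hm]) fun i h1 h2 => ?_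
    have hi : i < αs.length := by rwa [← hB m hm]
    have ha := hlt _ (List.getElem_mem hi)
    have hP : bar (αs[i] + η * m) ∈ P := Finset.mem_union_right _ (Finset.mem_image.2
      ⟨(αs[i], m), by simp [hm], rfl⟩)
    have hidx : αs.idxOf αs[i] = i := List.Nodup.idxOf_getElem (hs.imp fun h => h.ne) i hi
    simp only [letters, List.getElem_map]
    rw [Bool.eq_iff_iff, decide_eq_true_iff, ← Multiset.count_pos, hcount, if_pos hP]
    simp only [w, if_pos (overlined_bar _), size_bar, Nat.add_mul_div_left _ _ hη,
      Nat.div_eq_of_lt ha, zero_add, Nat.add_mul_mod_self_left, Nat.mod_eq_of_lt ha, hidx,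
      List.getD_eq_getElem _ _ h2]
    cases (B m)[i] <;> simp

theorem Valid.le {K n : ℕ} {A : List Bool} {f : ℕ} {b : ZMod n} {c : List (ℕ × List Bool)}
    (h : Valid K n A f b c) : ∀ s ∈ c, s.1 ≤ K := by
  induction c generalizing A f b with
  | nil => simp
  | cons s c ih =>
    intro s' hs'
    rcases List.mem_cons.1 hs' with rfl | hs'
    · exact le_trans (Nat.le_add_left _ _) h.1.le
    · exact ih h.2.2 s' hs'


/-! ### Overpartitions correspond to admissible lists of layers -/

/-- The residues of the parts. -/
def residues {l : ℕ} (α : Fin l → ℕ) : List ℕ := 0 :: List.ofFn α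

section

variable {l : ℕ} {α : Fin l → ℕ} {η : ℕ}

theorem mem_residues {a : ℕ} : a ∈ residues α ↔ a = 0 ∨ ∃ i, α i = a := by
  simp [residues, List.mem_ofFn]

theorem residues_lt (hη : 0 < η) (hα_lt : ∀ i, α i < η) : ∀ a ∈ residues α, a < η := by
  intro a ha
  rcases mem_residues.1 ha with rfl | ⟨i, rfl⟩
  · exact hη
  · exact hα_lt i

theorem residues_pairwise (hα_pos : ∀ i, 0 < α i) (hα_mono : StrictMono α) :
    (residues α).Pairwise (· < ·) := by
  rw [residues, List.pairwise_cons]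
  refine ⟨fun a ha => ?_, ?_⟩
  · obtain ⟨i, rfl⟩ := List.mem_ofFn.1 ha
    exact hα_pos i
  · rw [List.pairwise_ofFn]
    exact fun i j h => hα_mono h

theorem mod_mem_residues_iff (hα_lt : ∀ i, α i < η) {p : ℕ} :
    p % η ∈ residues α ↔ p ≡ 0 [MOD η] ∨ ∃ i, p ≡ α i [MOD η] := by
  rw [mem_residues]
  simp only [Nat.ModEq, Nat.zero_mod, Nat.mod_eq_of_lt (hα_lt _), eq_comm (a := α _)]

theorem isLayered_of {π : Multiset OPart} {t : ℕ}
    (hres : ∀ p ∈ π, p.size % η ∈ residues α)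
    (hnon : ∀ p ∈ π, ¬ p.Overlined → η ∣ p.size) (honce : ∀ p ∈ π, p.Overlined → π.count p = 1)
    (hsize : ∀ p ∈ π, p.size < η * t) : IsLayered η (residues α) t π := by
  refine ⟨fun p hp ho => ?_, fun p hp ho => ?_, honce⟩
  · obtain ⟨m, hm⟩ := hnon p hp ho
    refine ⟨m, ?_, by rw [← hm]; exact eq_plain ho⟩
    have := hsize p hp
    rw [hm] at this
    exact lt_of_mul_lt_mul_left this (Nat.zero_le _)
  · refine ⟨p.size / η, Nat.div_lt_of_lt_mul (hsize p hp), p.size % η, hres p hp, ?_⟩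
    rw [Nat.mod_add_div]
    exact ho.eq_bar

theorem IsLayered.mod_mem (hα_lt : ∀ i, α i < η) (hη : 0 < η) {π : Multiset OPart} {t : ℕ}
    (h : IsLayered η (residues α) t π) : ∀ p ∈ π, p.size % η ∈ residues α := by
  intro p hp
  by_cases ho : p.Overlined
  · obtain ⟨m, -, a, ha, rfl⟩ := h.bar p hp ho
    rwa [size_bar, Nat.add_mul_mod_self_left, Nat.mod_eq_of_lt (residues_lt hη hα_lt a ha)]
  · obtain ⟨m, -, rfl⟩ := h.plain p hp ho
    rw [size_plain, Nat.mul_mod_right]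
    exact mem_residues.2 (Or.inl rfl)

theorem IsLayered.dvd {αs : List ℕ} {π : Multiset OPart} {t : ℕ} (h : IsLayered η αs t π) :
    ∀ p ∈ π, ¬ p.Overlined → η ∣ p.size := by
  intro p hp ho
  obtain ⟨m, -, rfl⟩ := h.plain p hp ho
  exact Dvd.intro _ rfl

theorem size_le {N : ℕ} (π : Overpartition N) : ∀ p ∈ π.parts, p.size ≤ N := fun p hp => by
  rw [← π.parts_sum]
  exact Multiset.le_sum_of_mem (Multiset.mem_map_of_mem _ hp)

theorem bar_zero_notMem {N : ℕ} (π : Overpartition N) : bar 0 ∉ π.parts := fun h =>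
  absurd (π.parts_pos _ h) (by simp)

theorem plains_zero {N : ℕ} (π : Overpartition N) : plains η π.parts 0 = 0 :=
  Multiset.count_eq_zero.2 fun h => absurd (π.parts_pos _ h) (by simp)

theorem letters_zero {N : ℕ} (π : Overpartition N) : letters η (residues α) π.parts 0 =
    false :: (letters η (residues α) π.parts 0).tail := by
  simp [letters, residues, bar_zero_notMem]

variable (α η) in
/-- The overpartitions of `N` that satisfy the conditions for `j` and that, if `z` holds, do not
have overlined multiples of `η`. -/
def Counted (j k r N : ℕ) (z : Prop) : Set (Overpartition N) :=
  {π | IsOverB j α η k r π.seq ∧ (z → ∀ p ∈ π.parts, p.Overlined → ¬ η ∣ p.size)}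

theorem Counted.isLayered (hα_lt : ∀ i, α i < η) {j k r N t : ℕ} {z : Prop}
    (hN : N < η * t) {π : Overpartition N} (h : π ∈ Counted α η j k r N z) :
    IsLayered η (residues α) t π.parts := by
  have hmem : ∀ p, p ∈ π.parts → p ∈ π.seq := fun p hp => by
    rwa [Overpartition.seq, Multiset.mem_sort]
  exact isLayered_of
    (fun p hp => (mod_mem_residues_iff hα_lt).2 (h.1.congr p (hmem p hp)))
    (fun p hp => h.1.nonoverlined p (hmem p hp)) π.overlined_once
    fun p hp => (size_le π p hp).trans_lt hN

/-- The lowest letters and the list of layers of an overpartition. -/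
def toLayers (η : ℕ) (αs : List ℕ) (t : ℕ) (π : Multiset OPart) :
    List Bool × List (ℕ × List Bool) :=
  ((letters η αs π 0).tail, (List.range' 1 t).map fun m => (plains η π m, letters η αs π m))

open Classical in
/-- The admissible lists of layers that correspond to `Counted`. -/
noncomputable def layerFinset {l : ℕ} (α : Fin l → ℕ) (η K n u t N : ℕ) (z : Prop) :
    Finset (List Bool × List (ℕ × List Bool)) :=
  (bits l ×ˢ confs K (l + 1) t).filter fun x => Valid K n (false :: x.1) u 0 x.2 ∧
    (z → ∀ s ∈ x.2, s.2.head? ≠ some true) ∧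
    bitSize (List.ofFn α) x.1 + layersSize η (residues α) 0 x.2 = N

end

section

variable {l : ℕ} {α : Fin l → ℕ} {η j K n r u t N : ℕ} {z : Prop}

open Classical in
theorem mem_layerFinset {x : List Bool × List (ℕ × List Bool)} :
    x ∈ layerFinset α η K n u t N z ↔
      (x.1.length = l ∧ x.2.length = t ∧ ∀ s ∈ x.2, s.1 ≤ K ∧ s.2.length = l + 1) ∧
      Valid K n (false :: x.1) u 0 x.2 ∧ (z → ∀ s ∈ x.2, s.2.head? ≠ some true) ∧
      bitSize (List.ofFn α) x.1 + layersSize η (residues α) 0 x.2 = N := by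
  rw [← mem_bits, ← mem_confs, ← Finset.mem_product]
  exact Finset.mem_filter

theorem head_letters (m : ℕ) (π : Multiset OPart) :
    (letters η (residues α) π m).head? = some (decide (bar (η * m) ∈ π)) := by
  simp [letters, residues]

theorem isOverB_seq_iff (hα_pos : ∀ i, 0 < α i) (hα_mono : StrictMono α) (hα_lt : ∀ i, α i < η)
    (hη : 0 < η) (hn : (n : ℤ) = 2 - j) (h2 : (2 : ZMod n) = 0) (hu : u + r = K + 1) (hK : 0 < K)
    (hN : N < η * t) (π : Overpartition N) (h : IsLayered η (residues α) t π.parts) :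
    IsOverB j α η (K + 1) r π.seq ↔ Valid K n (false :: (toLayers η (residues α) t π.parts).1) u 0
      (toLayers η (residues α) t π.parts).2 := by
  have ht : 0 < t := Nat.pos_of_ne_zero (by rintro rfl; simp at hN)
  rw [toLayers, ← letters_zero]
  exact isOverB_iff_valid (Multiset.pairwise_sort _ _) (Multiset.sort_eq _ _) h
    (residues_pairwise hα_pos hα_mono) (residues_lt hη hα_lt) hη rfl hn h2 hu hK ht
    (fun p hp => (size_le π p hp).trans_lt hN) (plains_zero π)
    (fun p hp => (mod_mem_residues_iff hα_lt).1 (h.mod_mem hα_lt hη p hp)) h.dvd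

theorem toLayers_mem (hα_pos : ∀ i, 0 < α i) (hα_mono : StrictMono α) (hα_lt : ∀ i, α i < η)
    (hη : 0 < η) (hn : (n : ℤ) = 2 - j) (h2 : (2 : ZMod n) = 0) (hu : u + r = K + 1) (hK : 0 < K)
    (hN : N < η * t) {π : Overpartition N} (h : π ∈ Counted α η j (K + 1) r N z) :
    toLayers η (residues α) t π.parts ∈ layerFinset α η K n u t N z := by
  have hlay := Counted.isLayered hα_lt hN h
  have hV := (isOverB_seq_iff hα_pos hα_mono hα_lt hη hn h2 hu hK hN π hlay).1 h.1
  have hsum := sum_size hlay (Nat.le_succ t) (residues_pairwise hα_pos hα_mono) (residues_lt hη hα_lt) hη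
  rw [π.parts_sum, letters_zero] at hsum
  have hlen : ∀ m, (letters η (residues α) π.parts m).length = l + 1 := fun m => by
    simp [letters, residues]
  rw [mem_layerFinset]
  refine ⟨⟨by simp [toLayers, hlen], by simp [toLayers], fun s hs => ⟨hV.le s hs, ?_⟩⟩, hV, ?_, ?_⟩
  · obtain ⟨m, -, rfl⟩ := List.mem_map.1 hs
    exact hlen m
  · intro hz s hs
    obtain ⟨m, -, rfl⟩ := List.mem_map.1 hs
    rw [head_letters]
    intro hc
    have hc' : bar (η * m) ∈ π.parts := by simpa using hc
    exact h.2 hz _ hc' (overlined_bar _) (Dvd.intro _ rfl)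
  · refine Eq.trans ?_ hsum.symm
    simp [toLayers, residues, bitSize]

theorem toLayers_inj (hα_lt : ∀ i, α i < η) (hη : 0 < η) (hN : N < η * t) {k : ℕ}
    {π π' : Overpartition N} (h : π ∈ Counted α η j k r N z) (h' : π' ∈ Counted α η j k r N z)
    (he : toLayers η (residues α) t π.parts = toLayers η (residues α) t π'.parts) : π = π' := by
  rw [toLayers, toLayers, Prod.mk.injEq] at he
  have hm : ∀ m < t, (plains η π.parts m, letters η (residues α) π.parts m) =
      (plains η π'.parts m, letters η (residues α) π'.parts m) := by
    intro m hm
    rcases Nat.eq_zero_or_pos m with rfl | hm'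
    · rw [plains_zero, plains_zero, letters_zero, letters_zero π', he.1]
    · exact List.map_inj_left.1 he.2 m (List.mem_range'_1.2 ⟨hm', by omega⟩)
  exact Overpartition.ext (eq_of_layers (Counted.isLayered hα_lt hN h)
    (Counted.isLayered hα_lt hN h') (residues_lt hη hα_lt) hη
    (fun m hm' => congrArg Prod.fst (hm m hm')) fun m hm' => congrArg Prod.snd (hm m hm'))

theorem exists_toLayers (hα_pos : ∀ i, 0 < α i) (hα_mono : StrictMono α) (hα_lt : ∀ i, α i < η)
    (hη : 0 < η) (hn : (n : ℤ) = 2 - j) (h2 : (2 : ZMod n) = 0) (hu : u + r = K + 1) (hK : 0 < K)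
    (hN : N < η * t) {x : List Bool × List (ℕ × List Bool)}
    (hx : x ∈ layerFinset α η K n u t N z) :
    ∃ π ∈ Counted α η j (K + 1) r N z, toLayers η (residues α) t π.parts = x := by
  obtain ⟨A, c⟩ := x
  rw [mem_layerFinset] at hx
  obtain ⟨⟨hA, hc, hcs⟩, hV, hz, hsum⟩ := hx
  simp only at hA hc hcs hV hz hsum
  -- Layer `0` has neither plain parts nor the letter `0`, since parts have positive size.
  let st : List (ℕ × List Bool) := (0, false :: A) :: c
  have hlt := residues_lt hη hα_lt
  have hs := residues_pairwise hα_pos hα_mono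
  have hst : ∀ m < t + 1, (st.getD m (0, [])).2.length = (residues α).length := by
    intro m hm
    rw [List.getD_eq_getElem _ _ (by simp [st, hc, hm])]
    have : st[m]'(by simp [st, hc, hm]) ∈ st := List.getElem_mem _
    rcases List.mem_cons.1 this with h | h
    · rw [h]; simp [residues, hA]
    · rw [(hcs _ h).2]; simp [residues]
  obtain ⟨π, hπ, hF, hB⟩ := exists_layers hs hlt hη (t + 1) (fun m => (st.getD m (0, [])).1)
    (fun m => (st.getD m (0, [])).2) hst
  have h0 : letters η (residues α) π 0 = false :: A := hB 0 (by omega)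
  have hp0 : plains η π 0 = 0 := hF 0 (by omega)
  have hmap : ((List.range' 1 t).map fun m => (plains η π m, letters η (residues α) π m)) = c := by
    refine List.ext_getElem (by simp [hc]) fun i h1 h2 => ?_
    have hi : i < t := by rwa [hc] at h2
    rw [List.getElem_map, List.getElem_range', hF _ (by omega), hB _ (by omega), one_mul,
      add_comm 1 i]
    simp only [st, List.getD_cons_succ, List.getD_eq_getElem _ _ h2, Prod.mk.eta]
  have hto : toLayers η (residues α) t π = (A, c) := by rw [toLayers, hmap, h0, List.tail_cons]
  have hbar0 : bar 0 ∉ π := by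
    have := head_letters (η := η) (α := α) 0 π
    rw [h0, mul_zero] at this
    simpa using this
  have hpos : ∀ p ∈ π, 0 < p.size := by
    intro p hp
    refine Nat.pos_of_ne_zero fun h => ?_
    by_cases ho : p.Overlined
    · rw [ho.eq_bar, h] at hp
      exact hbar0 hp
    · rw [eq_plain ho, h] at hp
      exact Multiset.count_eq_zero.1 hp0 (by rwa [mul_zero])
  have hpsum : (π.map OPart.size).sum = N := by
    rw [sum_size hπ le_rfl hs hlt hη, hmap, h0, ← hsum]
    simp [residues, bitSize]
  let ρ : Overpartition N := ⟨π, hpos, hpsum, hπ.once⟩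
  have hlay : IsLayered η (residues α) t ρ.parts := isLayered_of (hπ.mod_mem hα_lt hη) hπ.dvd
    hπ.once fun p hp => (size_le ρ p hp).trans_lt hN
  refine ⟨ρ, ⟨?_, ?_⟩, hto⟩
  · rw [isOverB_seq_iff hα_pos hα_mono hα_lt hη hn h2 hu hK hN ρ hlay]
    change Valid K n (false :: (toLayers η (residues α) t π).1) u 0
      (toLayers η (residues α) t π).2
    rw [hto]
    exact hV
  · intro hz' p hp ho hd
    obtain ⟨m, hm⟩ := hd
    have hp' : bar (η * m) ∈ π := by rw [← hm, ← ho.eq_bar]; exact hp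
    have hm0 : 1 ≤ m := Nat.pos_of_ne_zero fun h => hbar0 (by rw [h, mul_zero] at hp'; exact hp')
    have hmt : m < t := by
      have := (size_le ρ p hp).trans_lt hN
      rw [hm] at this
      exact lt_of_mul_lt_mul_left this (Nat.zero_le _)
    refine hz hz' (plains η π m, letters η (residues α) π m) ?_ ?_
    · rw [← hmap]
      exact List.mem_map.2 ⟨m, List.mem_range'_1.2 ⟨hm0, by omega⟩, rfl⟩
    · rw [head_letters]
      simpa using hp'

theorem card_counted (hα_pos : ∀ i, 0 < α i) (hα_mono : StrictMono α) (hα_lt : ∀ i, α i < η)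
    (hη : 0 < η) (hn : (n : ℤ) = 2 - j) (h2 : (2 : ZMod n) = 0) (hu : u + r = K + 1) (hK : 0 < K)
    (hN : N < η * t) :
    Nat.card (Counted α η j (K + 1) r N z) = (layerFinset α η K n u t N z).card := by
  have hf : ∀ π : Counted α η j (K + 1) r N z,
      toLayers η (residues α) t π.1.parts ∈ layerFinset α η K n u t N z :=
    fun π => toLayers_mem hα_pos hα_mono hα_lt hη hn h2 hu hK hN π.2
  rw [← Nat.card_eq_finsetCard]
  refine Nat.card_eq_of_bijective
    (fun π => (⟨_, hf π⟩ : layerFinset α η K n u t N z)) ⟨fun π π' h => ?_, fun x => ?_⟩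
  · exact Subtype.ext (toLayers_inj hα_lt hη hN π.2 π'.2 (congrArg Subtype.val h))
  · obtain ⟨π, hπ, h⟩ := exists_toLayers hα_pos hα_mono hα_lt hη hn h2 hu hK hN x.2
    exact ⟨⟨π, hπ⟩, Subtype.ext h⟩

open Classical in
theorem coeff_baseTotal (hα_pos : ∀ i, 0 < α i) (hα_mono : StrictMono α) (hα_lt : ∀ i, α i < η)
    (hη : 0 < η) (hn : (n : ℤ) = 2 - j) (h2 : (2 : ZMod n) = 0) (hu : u + r = K + 1) (hK : 0 < K)
    (hN : N < η * t) :
    coeff N (baseTotal K n (X ^ η : ℤ⟦X⟧) t (if z then 0 else 1) ((List.ofFn α).map (X ^ ·)) u) =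
      (Nat.card (Counted α η j (K + 1) r N z) : ℤ) := by
  rw [card_counted hα_pos hα_mono hα_lt hη hn h2 hu hK hN, layerFinset, Finset.card_filter,
    Finset.sum_product, baseTotal, bitSum_eq_sum, List.length_map, List.length_ofFn, map_sum]
  push_cast
  refine Finset.sum_congr rfl fun A _ => ?_
  rw [layerSum_eq_sum, Finset.mul_sum, map_sum, List.length_cons, List.length_map, List.length_ofFn]
  refine Finset.sum_congr rfl fun c hc => ?_
  have hw : weight (X ^ η : ℤ⟦X⟧) 1 (1 :: (List.ofFn α).map (X ^ ·)) c =
      X ^ layersSize η (residues α) 0 c := by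
    rw [← weight_eq_pow]
    simp [residues]
  have hw' : weight (X ^ η : ℤ⟦X⟧) 1 ((if z then 0 else 1) :: (List.ofFn α).map (X ^ ·)) c =
      if z → ∀ s ∈ c, s.2.head? ≠ some true then X ^ layersSize η (residues α) 0 c else 0 := by
    by_cases hz : z
    · rw [if_pos hz, weight_zero_cons _ _ 1, hw]
      · exact if_congr (by simp [hz]) rfl rfl
      · intro s hs h
        have := ((mem_confs.1 hc).2 s hs).2
        simp [h] at this
    · rw [if_neg hz, hw, if_pos fun h => absurd h hz]
  rw [hw', bitProd_map_pow]
  by_cases h1 : Valid K n (false :: A) u 0 c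
  · by_cases h3 : z → ∀ s ∈ c, s.2.head? ≠ some true
    · rw [if_pos h1, if_pos h3, ← pow_add, coeff_X_pow]
      exact if_congr ⟨fun h => ⟨h1, h3, h.symm⟩, fun h => h.2.2.symm⟩ rfl rfl
    · rw [if_pos h1, if_neg h3, mul_zero, map_zero, if_neg fun h => h3 h.2.1]
  · rw [if_neg h1, mul_zero, map_zero, if_neg fun h => h1 h.1]

end


/-! ### Partitions as overpartitions without overlined multiples of `η` -/

/-- The part of size `p` that is overlined when `p` is not a multiple of `η`. -/
def tag (η p : ℕ) : OPart := toLex (p, !decide (η ∣ p))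

theorem overlined_tag {η p : ℕ} : (tag η p).Overlined ↔ ¬ η ∣ p := by
  simp [tag, Overlined]

theorem strictMono_tag (η : ℕ) : StrictMono (tag η) := fun p p' h => by
  rw [lt_def]; exact Or.inl h

theorem shift_tag (η p : ℕ) : (tag η p).shift η = tag η (p + η) := by
  simp [tag, shift, size]

theorem plain_eq_tag (η : ℕ) : plain η = tag η η := by simp [plain, tag]

theorem tag_size {η : ℕ} {p : OPart} (h : p.Overlined ↔ ¬ η ∣ p.size) : tag η p.size = p := by
  refine Prod.ext rfl ?_
  change (!decide (η ∣ p.size)) = (ofLex p).2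
  rw [Bool.eq_iff_iff, Bool.not_eq_true', decide_eq_false_iff_not]
  exact h.symm

variable {j l η k r : ℕ} {α : Fin l → ℕ}

/-- `tag` preserves the order, commutes with adding `η`, and makes overlined mean not divisible by
`η`. Every clause transfers literally except the one on repetitions. -/
theorem isB_iff {L : List ℕ} : IsB j α η k r L ↔
    IsOverB j α η k r (L.map (tag η)) ∧ ∀ p ∈ L, ¬ η ∣ p → L.count p = 1 := by
  have hle : ∀ {a b}, tag η a ≤ tag η b ↔ a ≤ b := (strictMono_tag η).le_iff_le
  have hlt : ∀ {a b}, tag η a < tag η b ↔ a < b := (strictMono_tag η).lt_iff_lt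
  have hmap : ∀ i m, ((((L.map (tag η)).drop i).take m).map fun p => p.size / η) =
      (((L.drop i).take m).map fun p => p / η) := by
    intro i m
    rw [← List.map_drop, ← List.map_take, List.map_map]
    rfl
  have hc1 : (L.map (tag η)).countP (fun p => p ≤ plain η) = L.countP fun p => p ≤ η := by
    rw [List.countP_map]
    exact List.countP_congr fun x _ => by simp [plain_eq_tag, hle]
  have hc2 : ∀ a, (L.map (tag η)).countP (fun p => p ≤ tag η a ∧ p.Overlined) =
      L.countP fun p => p ≤ a ∧ ¬ η ∣ p := by
    intro a
    rw [List.countP_map]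
    exact List.countP_congr fun x _ => by simp [hle, overlined_tag]
  constructor
  · intro h
    refine ⟨⟨?_, ?_, ?_, ?_, ?_⟩, h.repeated⟩
    · intro p hp
      obtain ⟨x, hx, rfl⟩ := List.mem_map.1 hp
      exact h.congr x hx
    · intro p hp ho
      obtain ⟨x, hx, rfl⟩ := List.mem_map.1 hp
      rw [overlined_tag, not_not] at ho
      exact ho
    · intro i hi
      have := h.diff i (by simpa using hi)
      simpa only [List.getElem_map, shift_tag, hle, hlt, overlined_tag, not_not] using this
    · rw [hc1]
      exact h.small
    · intro i hi h1 h2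
      rw [List.getElem_map, List.getElem_map, shift_tag, hle] at h1
      rw [List.getElem_map, List.getElem_map, shift_tag, hlt, overlined_tag] at h2
      rw [hmap, List.getElem_map, hc2]
      exact h.parity i (by simpa using hi) h1 h2
  · rintro ⟨h, hrep⟩
    refine ⟨?_, hrep, ?_, ?_, ?_⟩
    · intro p hp
      exact h.congr _ (List.mem_map_of_mem hp)
    · intro i hi
      have := h.diff i (by simpa using hi)
      simpa only [List.getElem_map, shift_tag, hle, hlt, overlined_tag, not_not] using this
    · rw [← hc1]
      exact h.small
    · intro i hi h1 h2
      have := h.parity i (by simpa using hi)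
        (by rw [List.getElem_map, List.getElem_map, shift_tag, hle]; exact h1)
        (by rw [List.getElem_map, List.getElem_map, shift_tag, hlt, overlined_tag]; exact h2)
      rwa [hmap, List.getElem_map, hc2] at this

/-- A partition in which only multiples of `η` are repeated, with all other parts overlined. -/
def tagged {N : ℕ} (η : ℕ) (π : N.Partition) (h : ∀ p ∈ π.parts, ¬ η ∣ p → π.parts.count p = 1) :
    Overpartition N where
  parts := π.parts.map (tag η)
  parts_pos p hp := by
    obtain ⟨x, hx, rfl⟩ := Multiset.mem_map.1 hp
    exact π.parts_pos hx
  parts_sum := by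
    rw [Multiset.map_map]
    exact (congrArg _ (Multiset.map_id' _)).trans π.parts_sum
  overlined_once p hp ho := by
    obtain ⟨x, hx, rfl⟩ := Multiset.mem_map.1 hp
    rw [Multiset.count_map_eq_count' _ _ (strictMono_tag η).injective]
    exact h x hx (overlined_tag.1 ho)

theorem seq_tagged {N : ℕ} (π : N.Partition) (h) : (tagged η π h).seq = π.seq.map (tag η) := by
  refine List.Perm.eq_of_pairwise (le := (· ≥ ·)) (fun a b _ _ h1 h2 => le_antisymm h2 h1)
    (Multiset.pairwise_sort _ _) ?_ ?_
  · rw [List.pairwise_map]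
    exact (Multiset.pairwise_sort π.parts (· ≥ ·)).imp fun h => (strictMono_tag η).monotone h
  · rw [← Multiset.coe_eq_coe, Overpartition.seq, Multiset.sort_eq, ← Multiset.map_coe,
      Nat.Partition.seq, Multiset.sort_eq]
    rfl

theorem numB_eq (N : ℕ) : numB j α η k r N = Nat.card (Counted α η j k r N True) := by
  have hrep : ∀ π : {π : N.Partition // IsB j α η k r π.seq}, ∀ p ∈ π.1.parts, ¬ η ∣ p →
      π.1.parts.count p = 1 := by
    intro π p hp hd
    have := π.2.repeated p (by rwa [Nat.Partition.seq, Multiset.mem_sort]) hd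
    rwa [Nat.Partition.seq, ← Multiset.coe_count, Multiset.sort_eq] at this
  refine Nat.card_eq_of_bijective (fun π => (⟨tagged η π.1 (hrep π), ?_, ?_⟩ :
    Counted α η j k r N True)) ⟨fun π π' h => ?_, ?_⟩
  · rw [seq_tagged]
    exact (isB_iff.1 π.2).1
  · intro _ p hp ho
    obtain ⟨x, hx, rfl⟩ := Multiset.mem_map.1 hp
    exact overlined_tag.1 ho
  · have h' : π.1.parts.map (tag η) = π'.1.parts.map (tag η) :=
      congrArg (fun x => x.1.parts) h
    exact Subtype.ext (Nat.Partition.ext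
      (Multiset.map_injective (strictMono_tag η).injective h'))
  · rintro ⟨ρ, hρ, hz⟩
    have htag : ∀ p ∈ ρ.parts, tag η p.size = p := fun p hp => by
      refine tag_size ⟨fun ho => hz trivial p hp ho, fun hd => ?_⟩
      by_contra ho
      exact hd (hρ.nonoverlined p (by rwa [Overpartition.seq, Multiset.mem_sort]) ho)
    have hparts : (ρ.parts.map OPart.size).map (tag η) = ρ.parts := by
      rw [Multiset.map_map]
      exact (Multiset.map_congr rfl htag).trans (Multiset.map_id' _)
    let π : N.Partition := ⟨ρ.parts.map OPart.size, fun hp => by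
      obtain ⟨x, hx, rfl⟩ := Multiset.mem_map.1 hp
      exact ρ.parts_pos x hx, ρ.parts_sum⟩
    have hcount : ∀ p ∈ π.parts, ¬ η ∣ p → π.parts.count p = 1 := by
      intro p hp hd
      obtain ⟨x, hx, rfl⟩ := Multiset.mem_map.1 hp
      rw [← Multiset.count_map_eq_count' _ _ (strictMono_tag η).injective, hparts, htag x hx]
      refine ρ.overlined_once x hx ?_
      rw [← htag x hx]
      exact overlined_tag.2 hd
    have he : tagged η π hcount = ρ := Overpartition.ext hparts
    refine ⟨⟨π, isB_iff.2 ⟨?_, ?_⟩⟩, Subtype.ext he⟩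
    · rw [← seq_tagged π hcount, he]
      exact hρ
    · intro p hp hd
      rw [Nat.Partition.seq, Multiset.mem_sort] at hp
      rw [Nat.Partition.seq, ← Multiset.coe_count, Multiset.sort_eq]
      exact hcount p hp hd

theorem numOverB_eq (N : ℕ) : numOverB j α η k r N = Nat.card (Counted α η j k r N False) :=
  Nat.card_congr (Equiv.subtypeEquivRight fun _ => ⟨fun h => ⟨h, False.elim⟩, fun h => h.1⟩)

/-! ### Distinct multiples of `η` and the infinite product -/

/-- The number of partitions of `N` into distinct multiples of `η`. -/
noncomputable def numD (η N : ℕ) : ℕ :=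
  Nat.card {ζ : N.Partition // ζ.parts.Nodup ∧ ∀ p ∈ ζ.parts, η ∣ p}

theorem numD_eq {N T : ℕ} (hη : 0 < η) (hN : N < η * (T + 1)) :
    numD η N = ((Finset.range T).powerset.filter fun S => ∑ i ∈ S, η * (i + 1) = N).card := by
  have hinj : Function.Injective fun i => η * (i + 1) := fun a b h =>
    Nat.succ_injective (Nat.eq_of_mul_eq_mul_left hη h)
  rw [← Nat.card_eq_finsetCard]
  let F : ((Finset.range T).powerset.filter fun S => ∑ i ∈ S, η * (i + 1) = N) →
      {ζ : N.Partition // ζ.parts.Nodup ∧ ∀ p ∈ ζ.parts, η ∣ p} := fun S =>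
    ⟨⟨S.1.val.map fun i => η * (i + 1), fun hp => by
      obtain ⟨x, -, rfl⟩ := Multiset.mem_map.1 hp
      positivity, (Finset.mem_filter.1 S.2).2⟩, S.1.nodup.map hinj, fun p hp => by
      obtain ⟨x, -, rfl⟩ := Multiset.mem_map.1 hp
      exact Dvd.intro _ rfl⟩
  refine (Nat.card_eq_of_bijective F ⟨fun S S' h => ?_, ?_⟩).symm
  · exact Subtype.ext (Finset.val_injective (Multiset.map_injective hinj
      (congrArg (fun x => x.1.parts) h)))
  · rintro ⟨ζ, hn, hd⟩
    have hparts : ((Finset.range T).filter fun i => η * (i + 1) ∈ ζ.parts).val.map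
        (fun i => η * (i + 1)) = ζ.parts := by
      refine (Multiset.Nodup.ext ((Finset.nodup _).map hinj) hn).2 fun p => ?_
      rw [Multiset.mem_map]
      constructor
      · rintro ⟨i, hi, rfl⟩
        rw [Finset.mem_val, Finset.mem_filter] at hi
        exact hi.2
      · intro hp
        obtain ⟨m, rfl⟩ := hd p hp
        have h1 := ζ.parts_pos hp
        have h2 : η * m ≤ N := by
          rw [← ζ.parts_sum]
          exact Multiset.le_sum_of_mem hp
        have h3 : m < T + 1 := lt_of_mul_lt_mul_left (h2.trans_lt hN) (Nat.zero_le _)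
        obtain ⟨i, rfl⟩ : ∃ i, m = i + 1 := ⟨m - 1, by
          have := Nat.pos_of_mul_pos_left h1
          omega⟩
        refine ⟨i, ?_, rfl⟩
        rw [Finset.mem_val, Finset.mem_filter, Finset.mem_range]
        exact ⟨by omega, hp⟩
    refine ⟨⟨_, Finset.mem_filter.2 ⟨Finset.mem_powerset.2 (Finset.filter_subset _ _), ?_⟩⟩,
      Subtype.ext (Nat.Partition.ext hparts)⟩
    exact (congrArg Multiset.sum hparts).trans ζ.parts_sum

theorem coeff_prod_eq_numD {N T : ℕ} (hη : 0 < η) (hN : N < η * (T + 1)) :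
    coeff N (∏ i ∈ Finset.range T, (1 + (X ^ η : ℤ⟦X⟧) ^ (i + 1))) = (numD η N : ℤ) := by
  rw [numD_eq hη hN, Finset.prod_one_add, map_sum, Finset.card_filter]
  push_cast
  refine Finset.sum_congr rfl fun S _ => ?_
  simp only [← pow_mul]
  rw [Finset.prod_pow_eq_pow_sum, coeff_X_pow]
  exact if_congr eq_comm rfl rfl

/-- The coefficient of degree `N` is constant along the partial products from `T = N` on, and
coefficients are continuous. -/
theorem coeff_qPochInf (hη : 0 < η) (N : ℕ) :
    coeff N (qPochInf (-(X ^ η)) (X ^ η)) = (numD η N : ℤ) := by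
  have h := (multipliable_qPochInf hη).hasProd.tendsto_prod_nat
  have h1 := ((PowerSeries.WithPiTopology.continuous_coeff ℤ N).tendsto _).comp h
  refine tendsto_nhds_unique h1 (tendsto_const_nhds.congr' ?_)
  filter_upwards [Filter.eventually_ge_atTop N] with T hT
  rw [← coeff_prod_eq_numD (T := T) hη (by nlinarith)]
  simp only [Function.comp_apply]
  exact congrArg _ (Finset.prod_congr rfl fun i _ => by rw [neg_mul, sub_neg_eq_add, pow_succ'])

/-! ### The convolution identity and the bijection -/

theorem numOverB_eq_sum (hη : 0 < η) (hα_pos : ∀ i, 0 < α i) (hα_mono : StrictMono α)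
    (hα_lt : ∀ i, α i < η) (hkr : r ≤ k) (hkl : l < k) (hne : ¬ (k = 1 ∧ r = 1)) (N : ℕ) :
    numOverB 1 α η k r N =
      ∑ p ∈ Finset.HasAntidiagonal.antidiagonal N, numD η p.1 * numB 0 α η k r p.2 := by
  rcases Nat.eq_zero_or_pos r with rfl | hr
  -- For `r = 0` the number of small parts would be at most `-1`, so both sides count nothing.
  · have h1 : ∀ L, ¬ IsOverB 1 α η k 0 L := fun L h => by
      have := h.small
      push_cast at this
      omega
    have h2 : ∀ L, ¬ IsB 0 α η k 0 L := fun L h => by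
      have := h.small
      push_cast at this
      omega
    simp [numOverB, numB, h1, h2]
  · obtain ⟨K, rfl⟩ : ∃ K, k = K + 1 := ⟨k - 1, by omega⟩
    -- `K = 0` would mean `k = r = 1`.
    have hK : 0 < K := by omega
    have hu : K + 1 - r + r = K + 1 := by omega
    -- `N + 1` layers above the lowest one suffice for every weight up to `N`: the top layer is then
    -- empty, and the truncation degree `η * (N + 2)` is not reached.
    have hlt : ∀ M ≤ N, M < η * (N + 1) := fun M hM => by nlinarith
    have h := coeff_baseTotal_one (η := η) hK (αs := List.ofFn α) (by
      intro a ha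
      obtain ⟨i, rfl⟩ := List.mem_ofFn.1 ha
      exact hα_pos i) (by simpa using Nat.lt_succ_iff.1 hkl) (N + 1) (K + 1 - r) (i := N)
      ((hlt N le_rfl).trans_le (Nat.mul_le_mul_left _ (Nat.le_succ _)))
    have h1 := coeff_baseTotal (z := False) (j := 1) (n := 1) hα_pos hα_mono hα_lt hη (by norm_num)
      (Subsingleton.elim _ _) hu hK (hlt N le_rfl)
    have h2 := fun M (hM : M ≤ N) => coeff_baseTotal (z := True) (j := 0) (n := 2) hα_pos hα_mono
      hα_lt hη (by norm_num) (by decide) hu hK (hlt M hM)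
    simp only [if_true, if_false, ← numB_eq, ← numOverB_eq] at h1 h2
    rw [h1, coeff_mul] at h
    zify
    rw [h]
    refine Finset.sum_congr rfl fun p hp => ?_
    rw [Finset.HasAntidiagonal.mem_antidiagonal] at hp
    rw [h2 _ (by omega), coeff_prod_eq_numD hη]
    exact (hlt p.1 (by omega)).trans_le (Nat.mul_le_mul_left _ (by omega))

/-- Finite fibres of equal size are matched by arbitrary bijections, which are then glued. -/
theorem exists_equiv_of_card_fiber {A B : Type*} (f : A → ℕ) (g : B → ℕ)
    (hf : ∀ n, Finite {a // f a = n}) (hg : ∀ n, Finite {b // g b = n})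
    (h : ∀ n, Nat.card {a // f a = n} = Nat.card {b // g b = n}) :
    ∃ Φ : A ≃ B, ∀ a, g (Φ a) = f a := by
  have e : ∀ n, Nonempty ({a // f a = n} ≃ {b // g b = n}) := fun n =>
    have := hf n; have := hg n; Finite.card_eq.1 (h n)
  replace e := fun n => (e n).some
  refine ⟨((Equiv.sigmaFiberEquiv f).symm.trans (Equiv.sigmaCongrRight e)).trans
    (Equiv.sigmaFiberEquiv g), fun a => ?_⟩
  exact (e (f a) ⟨a, rfl⟩).2

end Layered

theorem theorem1p7 (l k r η : ℕ) (α : Fin l → ℕ)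
    (hη : 0 < η)
    (hα_pos : ∀ i, 0 < α i) (hα_mono : StrictMono α) (hα_lt : ∀ i, α i < η)
    (hα_symm : ∀ i, α i + α i.rev = η)
    (hkr : r ≤ k) (hrl : l ≤ r) (hkl : l < k)
    (hne : ¬ (k = 1 ∧ r = 1)) :
    (PowerSeries.mk (fun n => (numOverB 1 α η k r n : ℤ)) =
      qPochInf (-(PowerSeries.X ^ η)) (PowerSeries.X ^ η) *
        PowerSeries.mk (fun n => (numB 0 α η k r n : ℤ))) ∧
    ∃ Φ : SetD η × SetB 0 α η k r ≃ SetOverB 1 α η k r,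
      ∀ (ζ : SetD η) (μ : SetB 0 α η k r),
        (Φ (ζ, μ)).val.1 = ζ.val.1 + μ.val.1 := by
  have key := Layered.numOverB_eq_sum hη hα_pos hα_mono hα_lt hkr hkl hne
  refine ⟨?_, ?_⟩
  · ext N
    rw [coeff_mul, coeff_mk, key N]
    push_cast
    exact Finset.sum_congr rfl fun p _ => by rw [Layered.coeff_qPochInf hη, coeff_mk]
  -- A pair of total weight `N` is a splitting of `N` together with members of the two prescribed
  -- weights, so the fibre has the size given by the convolution in `key`.
  · let E : ∀ N, (Σ p : Finset.HasAntidiagonal.antidiagonal N,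
        {ζ : p.1.1.Partition // ζ.parts.Nodup ∧ ∀ x ∈ ζ.parts, η ∣ x} ×
          {μ : p.1.2.Partition // IsB 0 α η k r μ.seq}) →
        {x : SetD η × SetB 0 α η k r // x.1.val.1 + x.2.val.1 = N} := fun N x =>
      ⟨(⟨⟨x.1.1.1, x.2.1.1⟩, x.2.1.2⟩, ⟨⟨x.1.1.2, x.2.2.1⟩, x.2.2.2⟩),
        Finset.HasAntidiagonal.mem_antidiagonal.1 x.1.2⟩
    have hE : ∀ N, Function.Bijective (E N) := by
      intro N
      constructor
      · rintro ⟨⟨⟨i, j⟩, hij⟩, ⟨ζ, hζ⟩, μ, hμ⟩ ⟨⟨⟨i', j'⟩, hij'⟩, ⟨ζ', hζ'⟩, μ', hμ'⟩ h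
        have h1 := congrArg (fun x => (x.1.1.1, x.1.2.1)) h
        simp only [E, Prod.mk.injEq, Sigma.mk.injEq] at h1
        obtain ⟨⟨rfl, h1⟩, rfl, h2⟩ := h1
        rw [heq_iff_eq] at h1 h2
        subst h1 h2
        rfl
      · rintro ⟨⟨⟨⟨i, ζ⟩, hζ⟩, ⟨j, μ⟩, hμ⟩, h⟩
        exact ⟨⟨⟨(i, j), Finset.HasAntidiagonal.mem_antidiagonal.2 h⟩, ⟨ζ, hζ⟩, μ, hμ⟩, rfl⟩
    let E' : ∀ N, {π : Overpartition N // IsOverB 1 α η k r π.seq} →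
        {x : SetOverB 1 α η k r // x.val.1 = N} := fun N π => ⟨⟨⟨N, π.1⟩, π.2⟩, rfl⟩
    have hE' : ∀ N, Function.Bijective (E' N) := by
      intro N
      constructor
      · rintro ⟨π, hπ⟩ ⟨π', hπ'⟩ h
        have h1 := congrArg (fun x => x.1.1) h
        simp only [E', Sigma.mk.injEq, heq_eq_eq, true_and] at h1
        exact Subtype.ext h1
      · rintro ⟨⟨⟨i, π⟩, hπ⟩, rfl⟩
        exact ⟨⟨π, hπ⟩, rfl⟩
    obtain ⟨Φ, hΦ⟩ := Layered.exists_equiv_of_card_fiber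
      (fun x : SetD η × SetB 0 α η k r => x.1.val.1 + x.2.val.1)
      (fun x : SetOverB 1 α η k r => x.val.1)
      (fun N => Finite.of_surjective _ (hE N).2) (fun N => Finite.of_surjective _ (hE' N).2)
      fun N => by
        rw [← Nat.card_eq_of_bijective _ (hE N), ← Nat.card_eq_of_bijective _ (hE' N),
          Nat.card_sigma]
        simp only [Nat.card_prod]
        refine Eq.trans ?_ (key N).symm
        exact Finset.sum_coe_sort (Finset.HasAntidiagonal.antidiagonal N)
          fun p => Layered.numD η p.1 * numB 0 α η k r p.2
    exact ⟨Φ, fun ζ μ => hΦ (ζ, μ)⟩
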